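/- **Setting.** Let $k$ be an algebraically closed, uncountable field of characteristic $0$, let $n\ge 0$, $A=k[x_1,\dots,x_n]$, and $\mathcal V=\mathrm{Der}_k(A)$. Let $A\#U(\mathcal V)$ be the smash product: the vector space $A\otimes U(\mathcal V)$ with product $(f\otimes u)(g\otimes v)=\sum f\,u^{(1)}(g)\otimes u^{(2)}v$, where $\Delta(u)=\sum u^{(1)}\otimes u^{(2)}$ is the usual coproduct of $U(\mathcal V)$. An $A\mathcal V$-module is a left module over $A\#U(\mathcal V)$. Let $\mathcal D\subset \mathrm{End}_k(A)$ be the Weyl algebra, i.e. the subalgebra generated by $A$ (acting by multiplication) and $\mathcal V$. Let $\mathcal L_+=\mathfrak m\,\mathrm{Der}_k(k[X_1,\dots,X_n])$ with $\mathfrak m=(X_1,\dots,X_n)$. If $P$ is a $\mathcal D$-module and $Q$ is an $\mathcal L_+$-module, then $P\otimes_k Q$ is an $A\mathcal V$-module with $$f\,(p\otimes q)=fp\otimes q,\qquad x^r\tfrac{\partial}{\partial x_i}(p\otimes q)=\Big(x^r\tfrac{\partial}{\partial x_i}p\Big)\otimes q+\sum_{0<m\le r}\binom rm\,(x^{r-m}p)\otimes\Big(X^m\tfrac{\partial}{\partial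 X_i}q\Big)$$ for $f\in A$, multi-indices $r$ and $1\le i\le n$. A $\mathfrak{gl}_n$-module is viewed as an $\mathcal L_+$-module through the surjection $\mathcal L_+\to\mathfrak{gl}_n(k)$ with $X_j\frac{\partial}{\partial X_i}\mapsto E_{ji}$ and $X^m\frac{\partial}{\partial X_i}\mapsto 0$ for $|m|>1$. For a finitely generated $k$-algebra $R$ and a finitely generated left $R$-module $M$, the Gelfand–Kirillov dimension is $\mathrm{GKdim}_R(M)=\limsup_{m\to\infty}\log_m\dim_k(C^mM_0)$, where $C\ni 1$ is a finite-dimensional generating subspace of $R$ and $M_0$ is a finite-dimensional generating subspace of $M$ (the value does not depend on the choices). A module over $R=A\#U(\mathcal V)$ or over $R=\mathcal D$ is called holonomic if it is finitely generated and is either zero or of Gelfand–Kirillov dimension $n$ over $R$. **Theorem.** Let $M$ be a simple holonomic $A\mathcal V$-module. Then there are a simple holonomic $\mathcal D$-module $P$ and a simple finite-dimensional $\mathfrak{gl}_n(k)$-module $Q$ such that $M\cong P\otimes_k Q$ as $A\mathcal V$-modules. -/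

import Mathlib

open scoped TensorProduct

attribute [local instance 100] LieRing.ofAssociativeRing

universe u v w

namespace AVMod

/-! ### Polynomials and polynomial vector fields -/

section Basic

variable (k : Type u) [Field k] (n : ℕ)

/-- The polynomial algebra `A = k[x₁, …, xₙ]`. -/
abbrev Poly : Type u := MvPolynomial (Fin n) k

/-- The Lie algebra of `k`-derivations of `k[x₁, …, xₙ]`. -/
abbrev Vect : Type u := Derivation k (Poly k n) (Poly k n)

/-- The universal enveloping algebra of the Lie algebra of derivations. -/
abbrev UVect : Type u := UniversalEnvelopingAlgebra k (Vect k n)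

end Basic

/-! ### The smash product `A # U(Der A)` -/

section Smash

variable (k : Type u) [Field k] (n : ℕ)

/-- The action of `U(Der A)` on `A` extending the tautological action of `Der A`. -/
noncomputable def polyAct : UVect k n →ₐ[k] Module.End k (Poly k n) :=
  UniversalEnvelopingAlgebra.lift k (LieModule.toEnd k (Vect k n) (Poly k n))

/-- The coproduct of the enveloping algebra: `d ↦ d ⊗ 1 + 1 ⊗ d` for `d ∈ Der A`. -/
noncomputable def comul : UVect k n →ₐ[k] UVect k n ⊗[k] UVect k n :=
  UniversalEnvelopingAlgebra.lift k
    { toFun := fun d => UniversalEnvelopingAlgebra.ι k d ⊗ₜ[k] 1 +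
        1 ⊗ₜ[k] UniversalEnvelopingAlgebra.ι k d
      map_add' := fun d e => by
        simp only [map_add, TensorProduct.add_tmul, TensorProduct.tmul_add]; abel
      map_smul' := fun c d => by
        simp only [map_smul, TensorProduct.smul_tmul', TensorProduct.tmul_smul, smul_add,
          RingHom.id_apply]
      map_lie' := fun {d e} => by
        simp only [LieHom.map_lie, LieRing.of_associative_ring_bracket, mul_add, add_mul,
          Algebra.TensorProduct.tmul_mul_tmul, one_mul, mul_one, TensorProduct.sub_tmul,
          TensorProduct.tmul_sub]
        abel }

/-- `u ↦ (g ⊗ v ↦ ∑ u⁽¹⁾(g) ⊗ u⁽²⁾ v)`, where `Δ(u) = ∑ u⁽¹⁾ ⊗ u⁽²⁾`. -/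
noncomputable def diagAct :
    UVect k n →ₐ[k] Module.End k (Poly k n ⊗[k] UVect k n) :=
  (Module.endTensorEndAlgHom (R := k) (S := k) (A := k)
      (M := Poly k n) (N := UVect k n)).comp
    ((Algebra.TensorProduct.map (polyAct k n) (Algebra.lmul k (UVect k n))).comp (comul k n))

/-- The left multiplications of the smash product:
`f ⊗ u ↦ (g ⊗ v ↦ ∑ f u⁽¹⁾(g) ⊗ u⁽²⁾ v)`. -/
noncomputable def smashMul :
    Poly k n ⊗[k] UVect k n →ₗ[k] Module.End k (Poly k n ⊗[k] UVect k n) :=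
  TensorProduct.lift
    (((LinearMap.mul k (Module.End k (Poly k n ⊗[k] UVect k n))).comp
      ((LinearMap.rTensorHom (UVect k n)).comp (Algebra.lmul k (Poly k n)).toLinearMap)).compl₂
      (diagAct k n).toLinearMap)

/-- The smash product `A # U(Der A)`: the vector space `A ⊗ U(Der A)` with the product
`(f ⊗ u)(g ⊗ v) = ∑ f u⁽¹⁾(g) ⊗ u⁽²⁾ v`. -/
def AVAlg : Type u := Poly k n ⊗[k] UVect k n

noncomputable instance : AddCommGroup (AVAlg k n) :=
  inferInstanceAs (AddCommGroup (Poly k n ⊗[k] UVect k n))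

noncomputable instance : Module k (AVAlg k n) :=
  inferInstanceAs (Module k (Poly k n ⊗[k] UVect k n))

variable {k n}

theorem polyAct_ι (d : Vect k n) (f : Poly k n) :
    polyAct k n (UniversalEnvelopingAlgebra.ι k d) f = d f := by
  rw [polyAct, UniversalEnvelopingAlgebra.lift_ι_apply]; rfl

theorem diagAct_ι (d : Vect k n) (g : Poly k n) (v : UVect k n) :
    diagAct k n (UniversalEnvelopingAlgebra.ι k d) (g ⊗ₜ v) =
      d g ⊗ₜ v + g ⊗ₜ (UniversalEnvelopingAlgebra.ι k d * v) := by
  have h : comul k n (UniversalEnvelopingAlgebra.ι k d) =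
      UniversalEnvelopingAlgebra.ι k d ⊗ₜ[k] 1 +
        1 ⊗ₜ[k] UniversalEnvelopingAlgebra.ι k d := by
    rw [comul, UniversalEnvelopingAlgebra.lift_ι_apply]; rfl
  rw [diagAct, AlgHom.comp_apply, AlgHom.comp_apply, h]
  simp only [map_add, Algebra.TensorProduct.map_tmul, map_one]
  have h1 := Module.endTensorEndAlgHom_apply (R := k) (S := k) (A := k)
    (M := Poly k n) (N := UVect k n) (polyAct k n (UniversalEnvelopingAlgebra.ι k d)) 1
  have h2 := Module.endTensorEndAlgHom_apply (R := k) (S := k) (A := k)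
    (M := Poly k n) (N := UVect k n) 1 (Algebra.lmul k _ (UniversalEnvelopingAlgebra.ι k d))
  rw [h1, h2, LinearMap.add_apply, TensorProduct.AlgebraTensorModule.map_tmul,
    TensorProduct.AlgebraTensorModule.map_tmul, polyAct_ι]
  rfl

theorem smashMul_tmul (f : Poly k n) (u : UVect k n) (t : Poly k n ⊗[k] UVect k n) :
    smashMul k n (f ⊗ₜ u) t =
      LinearMap.rTensor (UVect k n) (LinearMap.mulLeft k f) (diagAct k n u t) := rfl

theorem smashMul_rTensor (f : Poly k n) (s t : Poly k n ⊗[k] UVect k n) :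
    smashMul k n (LinearMap.rTensor (UVect k n) (LinearMap.mulLeft k f) s) t =
      LinearMap.rTensor (UVect k n) (LinearMap.mulLeft k f) (smashMul k n s t) := by
  induction s with
  | zero => simp
  | add x y hx hy => simp only [map_add, LinearMap.add_apply, hx, hy]
  | tmul g v =>
    rw [LinearMap.rTensor_tmul, smashMul_tmul, smashMul_tmul, LinearMap.mulLeft_apply,
      LinearMap.mulLeft_mul, LinearMap.rTensor_comp, LinearMap.comp_apply]

theorem uvect_induction {p : UVect k n → Prop}
    (hc : ∀ c : k, p (algebraMap k _ c))
    (hι : ∀ d, p (UniversalEnvelopingAlgebra.ι k d))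
    (hm : ∀ a b, p a → p b → p (a * b)) (ha : ∀ a b, p a → p b → p (a + b))
    (x : UVect k n) : p x := by
  let S : Subalgebra k (UVect k n) :=
    { carrier := {x | p x}
      mul_mem' := fun {a b} h1 h2 => hm a b h1 h2
      add_mem' := fun {a b} h1 h2 => ha a b h1 h2
      algebraMap_mem' := hc }
  let F : UVect k n →ₐ[k] S := UniversalEnvelopingAlgebra.lift k
    { toFun := fun d => ⟨UniversalEnvelopingAlgebra.ι k d, hι d⟩
      map_add' := fun d e => Subtype.ext (by simp)
      map_smul' := fun c d => Subtype.ext (by simp)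
      map_lie' := fun {d e} => Subtype.ext (by
        simp [LieRing.of_associative_ring_bracket]) }
  have h : S.val.comp F = AlgHom.id k _ := by
    apply UniversalEnvelopingAlgebra.hom_ext
    ext d
    simp only [LieHom.comp_apply, AlgHom.coe_toLieHom, AlgHom.comp_apply, F]
    rw [UniversalEnvelopingAlgebra.lift_ι_apply]
    rfl
  have h2 := DFunLike.congr_fun h x
  have h3 : ((F x : S) : UVect k n) = x := h2
  exact h3 ▸ (F x).2

theorem smashMul_diagAct (u : UVect k n) (s t : Poly k n ⊗[k] UVect k n) :
    smashMul k n (diagAct k n u s) t = diagAct k n u (smashMul k n s t) := by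
  induction u using uvect_induction generalizing s t with
  | hc c => simp [Algebra.algebraMap_eq_smul_one]
  | hm a b ha hb => simp only [map_mul, Module.End.mul_apply, ha, hb]
  | ha a b ha hb => simp only [map_add, LinearMap.add_apply, ha, hb]
  | hι d =>
    induction s with
    | zero => simp
    | add x y hx hy => simp only [map_add, LinearMap.add_apply, hx, hy]
    | tmul g v =>
      rw [diagAct_ι, map_add, LinearMap.add_apply, smashMul_tmul, smashMul_tmul, smashMul_tmul,
        map_mul, Module.End.mul_apply]
      induction diagAct k n v t with
      | zero => simp
      | add x y hx hy => simp only [map_add] at hx hy ⊢; rw [← hx, ← hy]; abel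
      | tmul h w =>
        simp only [LinearMap.rTensor_tmul, LinearMap.mulLeft_apply, diagAct_ι, map_add,
          Derivation.leibniz, smul_eq_mul, TensorProduct.add_tmul]
        rw [mul_comm h (d g)]
        abel

theorem smashMul_assoc (r s t : Poly k n ⊗[k] UVect k n) :
    smashMul k n (smashMul k n r s) t = smashMul k n r (smashMul k n s t) := by
  induction r with
  | zero => simp
  | add x y hx hy => simp only [map_add, LinearMap.add_apply, hx, hy]
  | tmul f u => simp only [smashMul_tmul, smashMul_rTensor, smashMul_diagAct]

theorem diagAct_one_tmul (u : UVect k n) :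
    diagAct k n u (1 ⊗ₜ 1) = 1 ⊗ₜ u := by
  have h : ∀ v : UVect k n, diagAct k n u (1 ⊗ₜ v) = 1 ⊗ₜ (u * v) := by
    induction u using uvect_induction with
    | hc c => intro v; simp [Algebra.algebraMap_eq_smul_one]
    | hm a b ha hb => intro v; simp [ha, hb, mul_assoc]
    | ha a b ha hb => intro v; simp [ha, hb, add_mul, TensorProduct.tmul_add]
    | hι d => intro v; simp [diagAct_ι, -UniversalEnvelopingAlgebra.ι_apply]
  simpa using h 1

theorem smashMul_one_left (a : Poly k n ⊗[k] UVect k n) : smashMul k n (1 ⊗ₜ 1) a = a := by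
  rw [smashMul_tmul, map_one, LinearMap.mulLeft_one, LinearMap.rTensor_id]
  rfl

theorem smashMul_one_right (a : Poly k n ⊗[k] UVect k n) : smashMul k n a (1 ⊗ₜ 1) = a := by
  induction a with
  | zero => simp
  | add x y hx hy => rw [map_add, LinearMap.add_apply, hx, hy]
  | tmul f u =>
    rw [smashMul_tmul, diagAct_one_tmul, LinearMap.rTensor_tmul, LinearMap.mulLeft_apply, mul_one]

variable (k n) in
noncomputable instance : Ring (AVAlg k n) :=
  { (inferInstance : AddCommGroup (AVAlg k n)) with
    mul := fun a b => smashMul k n a b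
    one := (1 ⊗ₜ 1 : Poly k n ⊗[k] UVect k n)
    left_distrib := fun a b c => map_add (smashMul k n a) b c
    right_distrib := fun a b c => LinearMap.map_add₂ (smashMul k n) a b c
    zero_mul := fun a => LinearMap.map_zero₂ (smashMul k n) a
    mul_zero := fun a => map_zero (smashMul k n a)
    mul_assoc := smashMul_assoc
    one_mul := smashMul_one_left
    mul_one := smashMul_one_right }

variable (k n) in
noncomputable instance : Algebra k (AVAlg k n) :=
  Algebra.ofModule
    (fun c a b => LinearMap.map_smul₂ (smashMul k n) c a b)
    (fun c a b => map_smul (smashMul k n a) c b)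

/-- The element `f # u` of the smash product. -/
noncomputable def AVAlg.mk (f : Poly k n) (u : UVect k n) : AVAlg k n := f ⊗ₜ[k] u

/-- `(f # η)(g # μ) = f η(g) # μ + f g # η μ` for `f, g ∈ A` and `η ∈ Der A`. -/
theorem AVAlg.mk_ι_mul_mk (f g : Poly k n) (η : Vect k n) (μ : UVect k n) :
    AVAlg.mk f (UniversalEnvelopingAlgebra.ι k η) * AVAlg.mk g μ =
      AVAlg.mk (f * η g) μ + AVAlg.mk (f * g) (UniversalEnvelopingAlgebra.ι k η * μ) := by
  have h : smashMul k n (f ⊗ₜ UniversalEnvelopingAlgebra.ι k η) (g ⊗ₜ μ) =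
      (f * η g) ⊗ₜ μ + (f * g) ⊗ₜ (UniversalEnvelopingAlgebra.ι k η * μ) := by
    rw [smashMul_tmul, diagAct_ι, map_add]
    rfl
  exact h

section Lift

variable {B : Type w} [Ring B] [Algebra k B] (α : Poly k n →ₐ[k] B) (β : Vect k n →ₗ⁅k⁆ B)

/-- The linear map `f ⊗ u ↦ α(f) β(u)`. -/
noncomputable def liftAux : Poly k n ⊗[k] UVect k n →ₗ[k] B :=
  TensorProduct.lift ((LinearMap.mul k B).compl₁₂ α.toLinearMap
    (UniversalEnvelopingAlgebra.lift k β).toLinearMap)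

theorem liftAux_tmul (f : Poly k n) (u : UVect k n) :
    liftAux α β (f ⊗ₜ u) = α f * UniversalEnvelopingAlgebra.lift k β u := rfl

theorem liftAux_mul (h : ∀ d f, β d * α f = α (d f) + α f * β d)
    (a b : Poly k n ⊗[k] UVect k n) :
    liftAux α β (smashMul k n a b) = liftAux α β a * liftAux α β b := by
  have h1 : ∀ f t, liftAux α β (LinearMap.rTensor (UVect k n) (LinearMap.mulLeft k f) t) =
      α f * liftAux α β t := by
    intro f t
    induction t with
    | zero => simp
    | add x y hx hy => simp only [map_add, hx, hy, mul_add]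
    | tmul g v => simp [liftAux_tmul, mul_assoc]
  have h2 : ∀ u t, liftAux α β (diagAct k n u t) =
      UniversalEnvelopingAlgebra.lift k β u * liftAux α β t := by
    intro u
    induction u using uvect_induction with
    | hc c => intro t; simp [Algebra.algebraMap_eq_smul_one]
    | hm a b ha hb => intro t; simp [ha, hb, mul_assoc]
    | ha a b ha hb => intro t; simp [ha, hb, add_mul]
    | hι d =>
      intro t
      induction t with
      | zero => simp
      | add x y hx hy => simp only [map_add, hx, hy, mul_add]
      | tmul g v =>
        simp only [diagAct_ι, map_add, liftAux_tmul, map_mul,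
          UniversalEnvelopingAlgebra.lift_ι_apply]
        rw [← mul_assoc (β d), h, add_mul, mul_assoc]
  induction a with
  | zero => simp
  | add x y hx hy => simp only [map_add, LinearMap.add_apply, hx, hy, add_mul]
  | tmul f u => rw [smashMul_tmul, h1, h2, liftAux_tmul, mul_assoc]

/-- The algebra homomorphism `f ⊗ u ↦ α(f) β(u)` out of the smash product, for an algebra
homomorphism `α` on `A` and a Lie algebra homomorphism `β` on `Der A` with
`[β(d), α(f)] = α(d(f))`. -/
noncomputable def AVAlg.lift (h : ∀ d f, β d * α f = α (d f) + α f * β d) : AVAlg k n →ₐ[k] B :=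
  AlgHom.ofLinearMap (A := AVAlg k n) (liftAux α β)
    (show liftAux α β (1 ⊗ₜ 1) = 1 by simp [liftAux_tmul])
    (liftAux_mul α β h)

theorem AVAlg.lift_mk (h : ∀ d f, β d * α f = α (d f) + α f * β d) (f : Poly k n)
    (u : UVect k n) :
    AVAlg.lift α β h (AVAlg.mk f u) = α f * UniversalEnvelopingAlgebra.lift k β u := rfl

end Lift

end Smash
/-! ### The Weyl algebra -/

section Weyl

variable (k : Type u) [Field k] (n : ℕ)

/-- The Weyl algebra, as a subalgebra of `End_k(A)`: it is generated by `A` (acting by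
multiplication) and `Der A`. -/
noncomputable def weylSubalgebra : Subalgebra k (Module.End k (Poly k n)) :=
  Algebra.adjoin k (Set.range (fun f : Poly k n => LinearMap.mulLeft k f) ∪
    Set.range (fun d : Vect k n => (d : Poly k n →ₗ[k] Poly k n)))

/-- The Weyl algebra `𝓓`. -/
def Weyl : Type u := weylSubalgebra k n

noncomputable instance : Ring (Weyl k n) := inferInstanceAs (Ring (weylSubalgebra k n))

noncomputable instance : Algebra k (Weyl k n) := inferInstanceAs (Algebra k (weylSubalgebra k n))

/-- The inclusion of the Weyl algebra in `End_k(A)`. -/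
noncomputable def Weyl.val : Weyl k n →ₐ[k] Module.End k (Poly k n) := (weylSubalgebra k n).val

theorem Weyl.val_injective : Function.Injective (Weyl.val k n) := Subtype.val_injective

/-- The inclusion of `A` in the Weyl algebra. -/
noncomputable def Weyl.ofPoly : Poly k n →ₐ[k] Weyl k n :=
  (Algebra.lmul k (Poly k n)).codRestrict (weylSubalgebra k n)
    (fun f => Algebra.subset_adjoin (Or.inl ⟨f, rfl⟩))

/-- The inclusion of `Der A` in the Weyl algebra. -/
noncomputable def Weyl.ofVect : Vect k n →ₗ⁅k⁆ Weyl k n where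
  toFun d := (⟨d, Algebra.subset_adjoin (Or.inr ⟨d, rfl⟩)⟩ : weylSubalgebra k n)
  map_add' _ _ := rfl
  map_smul' _ _ := rfl
  map_lie' := fun {d e} => by
    refine Weyl.val_injective k n (LinearMap.ext fun f => ?_)
    exact Derivation.commutator_apply (D1 := d) (D2 := e) f

variable {k n}

theorem Weyl.ofVect_mul_ofPoly (d : Vect k n) (f : Poly k n) :
    Weyl.ofVect k n d * Weyl.ofPoly k n f =
      Weyl.ofPoly k n (d f) + Weyl.ofPoly k n f * Weyl.ofVect k n d := by
  refine Weyl.val_injective k n (LinearMap.ext fun g => ?_)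
  rw [map_add, map_mul, map_mul]
  change d (f * g) = d f * g + f * d g
  rw [Derivation.leibniz, smul_eq_mul, smul_eq_mul]
  ring

end Weyl

/-! ### The Lie algebra of vector fields vanishing at the origin -/

section LPlus

variable (k : Type u) [Field k] (n : ℕ)

theorem apply_mem_of_mem_smul_top {d : Vect k n}
    (hd : d ∈ (MvPolynomial.idealOfVars (Fin n) k • ⊤ : Submodule (Poly k n) (Vect k n)))
    (f : Poly k n) : d f ∈ MvPolynomial.idealOfVars (Fin n) k := by
  induction hd using Submodule.smul_induction_on' with
  | smul r hr e _ => exact Ideal.mul_mem_right _ _ hr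
  | add x _ y _ hx hy => exact Ideal.add_mem _ hx hy

theorem mem_smul_top_iff (d : Vect k n) :
    d ∈ (MvPolynomial.idealOfVars (Fin n) k • ⊤ : Submodule (Poly k n) (Vect k n)) ↔
      ∀ f, d f ∈ MvPolynomial.idealOfVars (Fin n) k := by
  refine ⟨apply_mem_of_mem_smul_top k n, fun h => ?_⟩
  have : d = ∑ i, d (MvPolynomial.X i) • (MvPolynomial.pderiv i : Vect k n) := by
    apply MvPolynomial.derivation_ext
    intro j
    have h1 := congrFun (map_sum (Derivation.coeFnAddMonoidHom (R := k) (A := Poly k n)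
      (M := Poly k n)) (fun i => d (MvPolynomial.X i) • MvPolynomial.pderiv i) Finset.univ)
      (MvPolynomial.X j)
    refine Eq.trans ?_ h1.symm
    simp [Finset.sum_apply, MvPolynomial.pderiv_X, Pi.single_apply]
  rw [this]
  exact Submodule.sum_mem _ fun i _ => Submodule.smul_mem_smul (h _) trivial

/-- The Lie algebra `𝓛₊ = 𝔪 Der(k[X₁, …, Xₙ])`, where `𝔪 = (X₁, …, Xₙ)`. -/
noncomputable def LPlus : LieSubalgebra k (Vect k n) :=
  { ((MvPolynomial.idealOfVars (Fin n) k • ⊤ :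
      Submodule (Poly k n) (Vect k n)).restrictScalars k) with
    lie_mem' := fun {d e} hd he => by
      have hd' := apply_mem_of_mem_smul_top k n hd
      have he' := apply_mem_of_mem_smul_top k n he
      refine (mem_smul_top_iff k n _).2 fun f => ?_
      rw [Derivation.commutator_apply]
      exact Ideal.sub_mem _ (hd' _) (he' _) }

variable {k n}

theorem mem_LPlus (d : Vect k n) :
    d ∈ LPlus k n ↔ ∀ f, d f ∈ MvPolynomial.idealOfVars (Fin n) k :=
  mem_smul_top_iff k n d

theorem monomial_mem_idealOfVars {m : Fin n →₀ ℕ} (hm : m ≠ 0) :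
    (MvPolynomial.monomial m 1 : Poly k n) ∈ MvPolynomial.idealOfVars (Fin n) k := by
  obtain ⟨i, hi⟩ := Finsupp.ne_iff.1 hm
  have h : (MvPolynomial.monomial m 1 : Poly k n) =
      MvPolynomial.monomial (m - Finsupp.single i 1) 1 * MvPolynomial.X i := by
    rw [MvPolynomial.X, MvPolynomial.monomial_mul, one_mul, tsub_add_cancel_of_le]
    rw [Finsupp.single_le_iff]
    exact Nat.one_le_iff_ne_zero.2 hi
  rw [h]
  exact Ideal.mul_mem_left _ _ (Ideal.subset_span ⟨i, rfl⟩)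

theorem monomial_smul_mem_LPlus {m : Fin n →₀ ℕ} (hm : m ≠ 0) (d : Vect k n) :
    MvPolynomial.monomial m (1 : k) • d ∈ LPlus k n := by
  refine (mem_LPlus _).2 fun f => ?_
  rw [Derivation.smul_apply, smul_eq_mul]
  exact Ideal.mul_mem_right _ _ (monomial_mem_idealOfVars hm)

variable (k) in
/-- The vector field `X^m ∂/∂X_p` as an element of `𝓛₊`, for `m ≠ 0` (by convention `0` for
`m = 0`). -/
noncomputable def LPlus.elt (m : Fin n →₀ ℕ) (p : Fin n) : LPlus k n :=
  if hm : m = 0 then 0 else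
    ⟨MvPolynomial.monomial m (1 : k) • MvPolynomial.pderiv p,
      monomial_smul_mem_LPlus hm _⟩

theorem coeff_single_mul (j : Fin n) (p q : Poly k n) :
    MvPolynomial.coeff (Finsupp.single j 1) (p * q) =
      MvPolynomial.coeff 0 p * MvPolynomial.coeff (Finsupp.single j 1) q +
        MvPolynomial.coeff (Finsupp.single j 1) p * MvPolynomial.coeff 0 q := by
  rw [MvPolynomial.coeff_mul, Finsupp.antidiagonal_single]
  simp [Finset.Nat.antidiagonal_succ]

theorem coeff_zero_of_mem {f : Poly k n} (hf : f ∈ MvPolynomial.idealOfVars (Fin n) k) :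
    MvPolynomial.coeff 0 f = 0 := by
  rw [← pow_one (MvPolynomial.idealOfVars (Fin n) k), MvPolynomial.mem_pow_idealOfVars_iff'] at hf
  exact hf 0 (by simp)

theorem coeff_single_apply (d : Vect k n) (hd : d ∈ LPlus k n) (f : Poly k n) (j : Fin n) :
    MvPolynomial.coeff (Finsupp.single j 1) (d f) =
      ∑ l, MvPolynomial.coeff (Finsupp.single j 1) (d (MvPolynomial.X l)) *
        MvPolynomial.coeff (Finsupp.single l 1) f := by
  have h0 : ∀ g, MvPolynomial.coeff 0 (d g) = 0 := fun g =>
    coeff_zero_of_mem ((mem_LPlus d).1 hd g)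
  induction f using MvPolynomial.induction_on with
  | C a => simp [MvPolynomial.coeff_C, Finsupp.single_eq_zero, eq_comm]
  | add p q hp hq =>
    simp only [map_add, MvPolynomial.coeff_add, hp, hq, mul_add, Finset.sum_add_distrib]
  | mul_X p i _ =>
    rw [Derivation.leibniz, smul_eq_mul, smul_eq_mul, MvPolynomial.coeff_add, coeff_single_mul,
      coeff_single_mul, h0, h0]
    simp [coeff_single_mul, MvPolynomial.coeff_X, Finsupp.single_left_inj, mul_comm,
      Finset.sum_ite_eq]

variable (k n) in
/-- The linear part of an element of `𝓛₊`: the matrix with `(j, i)` entry the coefficient of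
`X_j ∂/∂X_i`. -/
noncomputable def linPart : LPlus k n →ₗ[k] Matrix (Fin n) (Fin n) k where
  toFun d := Matrix.of fun j i =>
    MvPolynomial.coeff (Finsupp.single j 1) (d.1 (MvPolynomial.X i))
  map_add' d e := by
    ext j i
    exact MvPolynomial.coeff_add _ (d.1 (MvPolynomial.X i)) (e.1 (MvPolynomial.X i))
  map_smul' c d := by
    ext j i
    exact MvPolynomial.coeff_smul _ c (d.1 (MvPolynomial.X i))

theorem linPart_lie (d e : LPlus k n) :
    linPart k n ⁅d, e⁆ = linPart k n d * linPart k n e - linPart k n e * linPart k n d := by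
  ext j i
  have h : linPart k n ⁅d, e⁆ j i = MvPolynomial.coeff (Finsupp.single j 1)
      (d.1 (e.1 (MvPolynomial.X i)) - e.1 (d.1 (MvPolynomial.X i))) := rfl
  rw [h, MvPolynomial.coeff_sub, coeff_single_apply d.1 d.2, coeff_single_apply e.1 e.2,
    Matrix.sub_apply, Matrix.mul_apply, Matrix.mul_apply]
  rfl

variable (k n) in
/-- The projection of `𝓛₊` onto `𝔤𝔩ₙ`, which is its quotient by the vector fields with coefficients
in `𝔪²`: `X_j ∂/∂X_i ↦ E_{ji}`, and `X^m ∂/∂X_i ↦ 0` for `|m| > 1`. -/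
noncomputable def glProj : LPlus k n →ₗ⁅k⁆ Matrix (Fin n) (Fin n) k :=
  { linPart k n with map_lie' := fun {d e} => linPart_lie d e }

end LPlus

/-! ### The homomorphism `A # U(Der A) → 𝓓 ⊗ U(𝓛₊)` -/

section Phi

variable (k : Type u) [Field k] (n : ℕ)

/-- The linear map `A → A ⊗ 𝓛₊`, `x^r ↦ ∑_{0 < m ≤ r} (r choose m) x^{r-m} ⊗ X^m ∂/∂X_p`. -/
noncomputable def taylorTerm (p : Fin n) : Poly k n →ₗ[k] Poly k n ⊗[k] LPlus k n :=
  (MvPolynomial.basisMonomials (Fin n) k).constr k fun r =>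
    ∑ m ∈ (Finset.Iic r).erase 0, ((∏ i, (r i).choose (m i) : ℕ) : k) •
      ((MvPolynomial.monomial (r - m) (1 : k) : Poly k n) ⊗ₜ[k] LPlus.elt k m p)

/-- The linear map `Der A → A ⊗ 𝓛₊`,
`x^r ∂/∂x_p ↦ ∑_{0 < m ≤ r} (r choose m) x^{r-m} ⊗ X^m ∂/∂X_p`. -/
noncomputable def taylorPart : Vect k n →ₗ[k] Poly k n ⊗[k] LPlus k n where
  toFun d := ∑ p, taylorTerm k n p (d (MvPolynomial.X p))
  map_add' d e := by simp [Finset.sum_add_distrib]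
  map_smul' c d := by simp [Finset.smul_sum]

/-- The linear map `A ⊗ 𝓛₊ → 𝓓 ⊗ U(𝓛₊)`. -/
noncomputable def tensorIncl : Poly k n ⊗[k] LPlus k n →ₗ[k]
    Weyl k n ⊗[k] UniversalEnvelopingAlgebra k (LPlus k n) :=
  TensorProduct.map (Weyl.ofPoly k n).toLinearMap
    (UniversalEnvelopingAlgebra.ι k (L := LPlus k n) : LPlus k n →ₗ[k] _)

/-- The linear map `Der A → 𝓓 ⊗ U(𝓛₊)`,
`x^r ∂/∂x_p ↦ x^r ∂/∂x_p ⊗ 1 + ∑_{0 < m ≤ r} (r choose m) x^{r-m} ⊗ X^m ∂/∂X_p`. -/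
noncomputable def phiVectAux : Vect k n →ₗ[k]
    Weyl k n ⊗[k] UniversalEnvelopingAlgebra k (LPlus k n) where
  toFun d := Weyl.ofVect k n d ⊗ₜ 1 + tensorIncl k n (taylorPart k n d)
  map_add' d e := by simp only [map_add, TensorProduct.add_tmul]; abel
  map_smul' c d := by simp [TensorProduct.smul_tmul']

/-- The Taylor expansion `f(x) ↦ f(x + X)`. -/
noncomputable def taylor : Poly k n →ₐ[k] Poly k n ⊗[k] Poly k n :=
  MvPolynomial.aeval fun i => MvPolynomial.X i ⊗ₜ 1 + 1 ⊗ₜ MvPolynomial.X i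

/-- The `i`-th coefficient of an element of `A ⊗ 𝓛₊`. -/
noncomputable def comp (i : Fin n) : Poly k n ⊗[k] LPlus k n →ₗ[k] Poly k n ⊗[k] Poly k n :=
  LinearMap.lTensor (Poly k n)
    { toFun := fun d : LPlus k n => d.1 (MvPolynomial.X i)
      map_add' := fun _ _ => rfl
      map_smul' := fun _ _ => rfl }

/-- The action of `A ⊗ 𝓛₊` on `A ⊗ k[X]`. -/
noncomputable def hat : Poly k n ⊗[k] LPlus k n →ₗ[k] Module.End k (Poly k n ⊗[k] Poly k n) :=
  TensorProduct.lift
    ((TensorProduct.mapBilinear (.id k) (Poly k n) (Poly k n) (Poly k n) (Poly k n)).compl₁₂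
      (Algebra.lmul k (Poly k n)).toLinearMap
      { toFun := fun d : LPlus k n => (d.1 : Poly k n →ₗ[k] Poly k n)
        map_add' := fun _ _ => rfl
        map_smul' := fun _ _ => rfl })

/-- The `A`-bilinear extension of the bracket of `𝓛₊` to `A ⊗ 𝓛₊`. -/
noncomputable def extBracket : Poly k n ⊗[k] LPlus k n →ₗ[k] Poly k n ⊗[k] LPlus k n →ₗ[k]
    Poly k n ⊗[k] LPlus k n :=
  TensorProduct.map₂ (LinearMap.mul k (Poly k n))
    (LieModule.toEnd k (LPlus k n) (LPlus k n) : LPlus k n →ₗ[k] Module.End k (LPlus k n))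

variable {k n}

theorem extBracket_tmul (a b : Poly k n) (l l' : LPlus k n) :
    extBracket k n (a ⊗ₜ l) (b ⊗ₜ l') = (a * b) ⊗ₜ ⁅l, l'⁆ := rfl

theorem hat_tmul (a b g : Poly k n) (l : LPlus k n) :
    hat k n (a ⊗ₜ l) (b ⊗ₜ g) = (a * b) ⊗ₜ (l.1 g) := rfl

theorem comp_tmul (i : Fin n) (a : Poly k n) (l : LPlus k n) :
    comp k n i (a ⊗ₜ l) = a ⊗ₜ (l.1 (MvPolynomial.X i)) := rfl

theorem comp_injective {s t : Poly k n ⊗[k] LPlus k n} (h : ∀ i, comp k n i s = comp k n i t) :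
    s = t := by
  let j : LPlus k n →ₗ[k] (Fin n → Poly k n) :=
    { toFun := fun d i => d.1 (MvPolynomial.X i)
      map_add' := fun _ _ => rfl
      map_smul' := fun _ _ => rfl }
  have hj : Function.Injective j := fun d e hde =>
    Subtype.ext (MvPolynomial.derivation_ext fun i => congrFun hde i)
  have hJ := Module.Flat.lTensor_preserves_injective_linearMap (M := Poly k n) j hj
  apply hJ
  apply (TensorProduct.piRight k k (Poly k n) (fun _ : Fin n => Poly k n)).injective
  have hc : ∀ t i, TensorProduct.piRight k k (Poly k n) (fun _ : Fin n => Poly k n)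
      (j.lTensor (Poly k n) t) i = comp k n i t := by
    intro t i
    induction t with
    | zero => simp
    | add x y hx hy => simp only [map_add, Pi.add_apply, hx, hy]
    | tmul a l => rfl
  ext1 i
  rw [hc, hc, h i]

theorem hat_mul (s : Poly k n ⊗[k] LPlus k n) (x y : Poly k n ⊗[k] Poly k n) :
    hat k n s (x * y) = x * hat k n s y + hat k n s x * y := by
  induction s with
  | zero => simp
  | add a b ha hb => simp only [map_add, LinearMap.add_apply, ha, hb]; ring
  | tmul a l =>
    induction x with
    | zero => simp
    | add x x' hx hx' => simp only [add_mul, map_add, hx, hx']; ring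
    | tmul b g =>
      induction y with
      | zero => simp
      | add y y' hy hy' => simp only [mul_add, map_add, hy, hy']; ring
      | tmul c h =>
        simp only [Algebra.TensorProduct.tmul_mul_tmul, hat_tmul, Derivation.leibniz, smul_eq_mul,
          TensorProduct.tmul_add]
        rw [mul_left_comm b a c, mul_assoc a b c, mul_comm (l.1 g) h]

theorem hat_tmul_one (s : Poly k n ⊗[k] LPlus k n) (a : Poly k n) :
    hat k n s (a ⊗ₜ 1) = 0 := by
  induction s with
  | zero => simp
  | add x y hx hy => simp [hx, hy]
  | tmul b l => simp [hat_tmul]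

theorem hat_one_tmul_X (s : Poly k n ⊗[k] LPlus k n) (i : Fin n) :
    hat k n s (1 ⊗ₜ MvPolynomial.X i) = comp k n i s := by
  induction s with
  | zero => simp
  | add x y hx hy => simp [hx, hy]
  | tmul b l => simp [hat_tmul, comp_tmul]

theorem rTensor_mul (d : Vect k n) (x y : Poly k n ⊗[k] Poly k n) :
    LinearMap.rTensor (Poly k n) (d : Poly k n →ₗ[k] Poly k n) (x * y) =
      x * LinearMap.rTensor (Poly k n) (d : Poly k n →ₗ[k] Poly k n) y +
        LinearMap.rTensor (Poly k n) (d : Poly k n →ₗ[k] Poly k n) x * y := by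
  induction x with
  | zero => simp
  | add x x' hx hx' => simp only [add_mul, map_add, hx, hx']; ring
  | tmul b g =>
    induction y with
    | zero => simp
    | add y y' hy hy' => simp only [mul_add, map_add, hy, hy']; ring
    | tmul c h =>
      simp only [Algebra.TensorProduct.tmul_mul_tmul, LinearMap.rTensor_tmul,
        Derivation.coeFn_coe, Derivation.leibniz, smul_eq_mul, TensorProduct.add_tmul]
      rw [mul_comm c (d b)]

theorem elt_apply_X {m : Fin n →₀ ℕ} (hm : m ≠ 0) (p i : Fin n) :
    (LPlus.elt k m p).1 (MvPolynomial.X i) =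
      if i = p then MvPolynomial.monomial m (1 : k) else 0 := by
  rw [LPlus.elt, dif_neg hm]
  change MvPolynomial.monomial m (1 : k) •
    (MvPolynomial.pderiv p (MvPolynomial.X i) : Poly k n) = _
  rw [MvPolynomial.pderiv_X, Pi.single_apply]
  split_ifs <;> simp_all

theorem taylor_monomial (r : Fin n →₀ ℕ) :
    taylor k n (MvPolynomial.monomial r 1) =
      ∑ m ∈ Finset.Iic r, ((∏ i, (r i).choose (m i) : ℕ) : k) •
        (MvPolynomial.monomial (r - m) (1 : k) ⊗ₜ[k] MvPolynomial.monomial m (1 : k)) := by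
  have hmon : ∀ s : Fin n →₀ ℕ, (MvPolynomial.monomial s 1 : Poly k n) =
      ∏ i, MvPolynomial.X i ^ s i := by
    intro s
    rw [MvPolynomial.monomial_eq, MvPolynomial.C_1, one_mul, Finsupp.prod_fintype _ _ (by simp)]
  have hpt : ∀ f g : Fin n → Poly k n, (∏ i, (f i ⊗ₜ[k] g i)) = (∏ i, f i) ⊗ₜ[k] (∏ i, g i) := by
    intro f g
    induction (Finset.univ : Finset (Fin n)) using Finset.cons_induction with
    | empty => simp [Algebra.TensorProduct.one_def]
    | cons i s hi ih => rw [Finset.prod_cons, Finset.prod_cons, Finset.prod_cons, ih,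
        Algebra.TensorProduct.tmul_mul_tmul]
  rw [hmon, map_prod]
  simp only [map_pow, taylor, MvPolynomial.aeval_X]
  simp_rw [add_comm (MvPolynomial.X (R := k) (_ : Fin n) ⊗ₜ[k] (1 : Poly k n)), add_pow]
  rw [Finset.prod_univ_sum]
  refine Finset.sum_nbij' (fun f => Finsupp.equivFunOnFinite.symm f) (fun m => m) ?_ ?_ ?_ ?_ ?_
  · intro f hf
    simp only [Fintype.mem_piFinset, Finset.mem_range, Finset.mem_Iic] at hf ⊢
    intro i
    exact Nat.lt_succ_iff.1 (hf i)
  · intro m hm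
    simp only [Fintype.mem_piFinset, Finset.mem_range, Finset.mem_Iic] at hm ⊢
    intro i
    exact Nat.lt_succ_iff.2 (hm i)
  · intro f _; rfl
  · intro m _; ext; rfl
  · intro f _
    rw [hmon, hmon, ← hpt, Nat.cast_smul_eq_nsmul, nsmul_eq_mul, Nat.cast_prod,
      ← Finset.prod_mul_distrib]
    refine Finset.prod_congr rfl fun i _ => ?_
    rw [mul_comm]
    congr 1
    simp [Algebra.TensorProduct.tmul_pow]

theorem taylorTerm_monomial (p : Fin n) (r : Fin n →₀ ℕ) :
    taylorTerm k n p (MvPolynomial.monomial r 1) =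
      ∑ m ∈ (Finset.Iic r).erase 0, ((∏ i, (r i).choose (m i) : ℕ) : k) •
        ((MvPolynomial.monomial (r - m) (1 : k) : Poly k n) ⊗ₜ[k] LPlus.elt k m p) := by
  have := (MvPolynomial.basisMonomials (Fin n) k).constr_basis k (fun r =>
    ∑ m ∈ (Finset.Iic r).erase 0, ((∏ i, (r i).choose (m i) : ℕ) : k) •
      ((MvPolynomial.monomial (r - m) (1 : k) : Poly k n) ⊗ₜ[k] LPlus.elt k m p)) r
  rwa [MvPolynomial.coe_basisMonomials] at this

theorem comp_taylorTerm (p i : Fin n) (f : Poly k n) :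
    comp k n i (taylorTerm k n p f) = if i = p then taylor k n f - f ⊗ₜ 1 else 0 := by
  have key : ∀ r : Fin n →₀ ℕ, comp k n i (taylorTerm k n p (MvPolynomial.monomial r 1)) =
      if i = p then taylor k n (MvPolynomial.monomial r 1) - MvPolynomial.monomial r 1 ⊗ₜ 1
        else 0 := by
    intro r
    rw [taylorTerm_monomial, map_sum]
    have h1 : ∀ m ∈ (Finset.Iic r).erase 0,
        comp k n i (((∏ i, (r i).choose (m i) : ℕ) : k) •
          ((MvPolynomial.monomial (r - m) (1 : k) : Poly k n) ⊗ₜ[k] LPlus.elt k m p)) =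
        if i = p then ((∏ i, (r i).choose (m i) : ℕ) : k) •
          ((MvPolynomial.monomial (r - m) (1 : k) : Poly k n) ⊗ₜ[k]
            (MvPolynomial.monomial m (1 : k) : Poly k n)) else 0 := by
      intro m hm
      rw [map_smul, comp_tmul, elt_apply_X (Finset.ne_of_mem_erase hm)]
      split_ifs <;> simp
    rw [Finset.sum_congr rfl h1]
    split_ifs with hip
    · rw [taylor_monomial, ← Finset.sum_erase_add (Finset.Iic r) _
        (Finset.mem_Iic.2 (zero_le (a := r)))]
      simp
    · simp
  induction f using MvPolynomial.induction_on' with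
  | monomial r a =>
    have h : (MvPolynomial.monomial r a : Poly k n) = a • MvPolynomial.monomial r 1 := by
      rw [MvPolynomial.smul_monomial, smul_eq_mul, mul_one]
    rw [h, map_smul, map_smul, key, map_smul]
    split_ifs
    · rw [smul_sub, TensorProduct.smul_tmul']
    · rw [smul_zero]
  | add f g hf hg =>
    rw [map_add, map_add, hf, hg, map_add]
    split_ifs
    · rw [TensorProduct.add_tmul]; abel
    · rw [add_zero]

theorem comp_taylorPart (d : Vect k n) (i : Fin n) :
    comp k n i (taylorPart k n d) =
      taylor k n (d (MvPolynomial.X i)) - d (MvPolynomial.X i) ⊗ₜ 1 := by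
  change comp k n i (∑ p, taylorTerm k n p (d (MvPolynomial.X p))) = _
  rw [map_sum]
  simp only [comp_taylorTerm, Finset.sum_ite_eq, Finset.mem_univ, if_true]

theorem taylor_apply (d : Vect k n) (f : Poly k n) :
    LinearMap.rTensor (Poly k n) (d : Poly k n →ₗ[k] Poly k n) (taylor k n f) +
      hat k n (taylorPart k n d) (taylor k n f) = taylor k n (d f) := by
  induction f using MvPolynomial.induction_on with
  | C a =>
    have h : taylor k n (MvPolynomial.C a) = MvPolynomial.C a ⊗ₜ 1 :=
      MvPolynomial.aeval_C _ a
    rw [h, hat_tmul_one, LinearMap.rTensor_tmul]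
    simp
  | add p q hp hq => simp only [map_add, ← hp, ← hq]; abel
  | mul_X p i hp =>
    have h : taylor k n (MvPolynomial.X i) = MvPolynomial.X i ⊗ₜ 1 + 1 ⊗ₜ MvPolynomial.X i :=
      MvPolynomial.aeval_X _ i
    rw [map_mul, rTensor_mul, hat_mul, Derivation.leibniz, smul_eq_mul, smul_eq_mul, map_add,
      map_mul, map_mul, ← hp]
    have h1 : LinearMap.rTensor (Poly k n) (d : Poly k n →ₗ[k] Poly k n)
        (taylor k n (MvPolynomial.X i)) = d (MvPolynomial.X i) ⊗ₜ 1 := by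
      rw [h, map_add, LinearMap.rTensor_tmul, LinearMap.rTensor_tmul]
      simp
    have h2 : hat k n (taylorPart k n d) (taylor k n (MvPolynomial.X i)) =
        taylor k n (d (MvPolynomial.X i)) - d (MvPolynomial.X i) ⊗ₜ 1 := by
      rw [h, map_add, hat_tmul_one, hat_one_tmul_X, comp_taylorPart, zero_add]
    rw [h1, h2]
    ring

theorem comp_lie (s t : Poly k n ⊗[k] LPlus k n) (i : Fin n) :
    comp k n i (extBracket k n s t) = hat k n s (comp k n i t) - hat k n t (comp k n i s) := by
  induction s with
  | zero => simp
  | add x y hx hy => simp only [map_add, LinearMap.add_apply, hx, hy]; abel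
  | tmul a l =>
    induction t with
    | zero => simp
    | add x y hx hy => simp only [map_add, LinearMap.add_apply, hx, hy]; abel
    | tmul b l' =>
      rw [extBracket_tmul, comp_tmul, comp_tmul, comp_tmul, hat_tmul,
        hat_tmul, mul_comm b a, ← TensorProduct.tmul_sub]
      rfl

theorem comp_rTensor (d : Vect k n) (t : Poly k n ⊗[k] LPlus k n) (i : Fin n) :
    comp k n i (LinearMap.rTensor (LPlus k n) (d : Poly k n →ₗ[k] Poly k n) t) =
      LinearMap.rTensor (Poly k n) (d : Poly k n →ₗ[k] Poly k n) (comp k n i t) := by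
  induction t with
  | zero => simp
  | add x y hx hy => simp only [map_add, hx, hy]
  | tmul b l => rfl

theorem taylorPart_lie (d e : Vect k n) :
    taylorPart k n ⁅d, e⁆ =
      LinearMap.rTensor (LPlus k n) (d : Poly k n →ₗ[k] Poly k n) (taylorPart k n e) -
      LinearMap.rTensor (LPlus k n) (e : Poly k n →ₗ[k] Poly k n) (taylorPart k n d) +
      extBracket k n (taylorPart k n d) (taylorPart k n e) := by
  apply comp_injective
  intro i
  simp only [map_add, map_sub, comp_rTensor, comp_lie, comp_taylorPart, hat_tmul_one,
    LinearMap.rTensor_tmul, Derivation.commutator_apply, ← taylor_apply, TensorProduct.sub_tmul,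
    Derivation.coeFn_coe]
  abel

theorem tensorIncl_lie (s t : Poly k n ⊗[k] LPlus k n) :
    tensorIncl k n (extBracket k n s t) =
      tensorIncl k n s * tensorIncl k n t - tensorIncl k n t * tensorIncl k n s := by
  have hT : ∀ (a : Poly k n) (l : LPlus k n), tensorIncl k n (a ⊗ₜ l) =
      Weyl.ofPoly k n a ⊗ₜ UniversalEnvelopingAlgebra.ι k l := fun _ _ => rfl
  induction s with
  | zero => simp
  | add x y hx hy => simp only [map_add, LinearMap.add_apply, hx, hy, add_mul, mul_add]; abel
  | tmul a l =>
    induction t with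
    | zero => simp
    | add x y hx hy => simp only [map_add, hx, hy, add_mul, mul_add]; abel
    | tmul b l' =>
      rw [extBracket_tmul, hT, hT, hT, Algebra.TensorProduct.tmul_mul_tmul,
        Algebra.TensorProduct.tmul_mul_tmul, ← map_mul (Weyl.ofPoly k n),
        ← map_mul (Weyl.ofPoly k n), mul_comm b a,
        ← TensorProduct.tmul_sub, LieHom.map_lie, LieRing.of_associative_ring_bracket]

theorem ofVect_tensorIncl (d : Vect k n) (t : Poly k n ⊗[k] LPlus k n) :
    (Weyl.ofVect k n d ⊗ₜ 1) * tensorIncl k n t - tensorIncl k n t * (Weyl.ofVect k n d ⊗ₜ 1) =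
      tensorIncl k n (LinearMap.rTensor (LPlus k n) (d : Poly k n →ₗ[k] Poly k n) t) := by
  have hT : ∀ (a : Poly k n) (l : LPlus k n), tensorIncl k n (a ⊗ₜ l) =
      Weyl.ofPoly k n a ⊗ₜ UniversalEnvelopingAlgebra.ι k l := fun _ _ => rfl
  induction t with
  | zero => simp
  | add x y hx hy => simp only [map_add, add_mul, mul_add, ← hx, ← hy]; abel
  | tmul a l =>
    rw [LinearMap.rTensor_tmul, hT, hT, Algebra.TensorProduct.tmul_mul_tmul,
      Algebra.TensorProduct.tmul_mul_tmul, one_mul, mul_one, Weyl.ofVect_mul_ofPoly,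
      ← TensorProduct.sub_tmul, add_sub_cancel_right]
    rfl

theorem phiVectAux_lie (d e : Vect k n) :
    phiVectAux k n ⁅d, e⁆ =
      phiVectAux k n d * phiVectAux k n e - phiVectAux k n e * phiVectAux k n d := by
  have hp : ∀ d, phiVectAux k n d =
      Weyl.ofVect k n d ⊗ₜ 1 + tensorIncl k n (taylorPart k n d) := fun _ => rfl
  rw [hp, hp, hp, taylorPart_lie, map_add, map_sub, tensorIncl_lie, ← ofVect_tensorIncl,
    ← ofVect_tensorIncl, LieHom.map_lie, LieRing.of_associative_ring_bracket,
    TensorProduct.sub_tmul]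
  have h1 : ∀ a b : Weyl k n, (a * b) ⊗ₜ[k] (1 : UniversalEnvelopingAlgebra k (LPlus k n)) =
      (a ⊗ₜ 1) * (b ⊗ₜ 1) := by simp
  rw [h1, h1]
  noncomm_ring

variable (k n) in
/-- The Lie algebra homomorphism `Der A → 𝓓 ⊗ U(𝓛₊)`,
`x^r ∂/∂x_p ↦ x^r ∂/∂x_p ⊗ 1 + ∑_{0 < m ≤ r} (r choose m) x^{r-m} ⊗ X^m ∂/∂X_p`. -/
noncomputable def phiVect : Vect k n →ₗ⁅k⁆
    Weyl k n ⊗[k] UniversalEnvelopingAlgebra k (LPlus k n) :=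
  { phiVectAux k n with map_lie' := fun {d e} => phiVectAux_lie d e }

variable (k n) in
/-- The algebra homomorphism `A → 𝓓 ⊗ U(𝓛₊)`, `f ↦ f ⊗ 1`. -/
noncomputable def phiPoly :
    Poly k n →ₐ[k] Weyl k n ⊗[k] UniversalEnvelopingAlgebra k (LPlus k n) :=
  (Algebra.TensorProduct.includeLeft (R := k) (S := k) (A := Weyl k n)
    (B := UniversalEnvelopingAlgebra k (LPlus k n))).comp (Weyl.ofPoly k n)

theorem phiPoly_apply (f : Poly k n) : phiPoly k n f = Weyl.ofPoly k n f ⊗ₜ 1 := rfl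

theorem phiVect_mul (d : Vect k n) (f : Poly k n) :
    phiVect k n d * phiPoly k n f = phiPoly k n (d f) + phiPoly k n f * phiVect k n d := by
  simp only [phiPoly_apply]
  have hp : phiVect k n d = Weyl.ofVect k n d ⊗ₜ 1 + tensorIncl k n (taylorPart k n d) := rfl
  have hc : ∀ t, tensorIncl k n t * (Weyl.ofPoly k n f ⊗ₜ 1) =
      (Weyl.ofPoly k n f ⊗ₜ 1) * tensorIncl k n t := by
    intro t
    have hT : ∀ (a : Poly k n) (l : LPlus k n), tensorIncl k n (a ⊗ₜ l) =
        Weyl.ofPoly k n a ⊗ₜ UniversalEnvelopingAlgebra.ι k l := fun _ _ => rfl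
    induction t with
    | zero => simp
    | add x y hx hy => simp only [map_add, add_mul, mul_add, hx, hy]
    | tmul a l =>
      rw [hT, Algebra.TensorProduct.tmul_mul_tmul, Algebra.TensorProduct.tmul_mul_tmul, ← map_mul,
        ← map_mul, mul_comm, one_mul, mul_one]
  rw [hp, add_mul, mul_add, hc, Algebra.TensorProduct.tmul_mul_tmul,
    Algebra.TensorProduct.tmul_mul_tmul, Weyl.ofVect_mul_ofPoly, TensorProduct.add_tmul, one_mul,
    add_assoc]

variable (k n) in
/-- The algebra homomorphism `A # U(Der A) → 𝓓 ⊗ U(𝓛₊)` given on `A` by `f ↦ f ⊗ 1` and on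
`Der A` by
`x^r ∂/∂x_p ↦ x^r ∂/∂x_p ⊗ 1 + ∑_{0 < m ≤ r} (r choose m) x^{r-m} ⊗ X^m ∂/∂X_p`. -/
noncomputable def phi :
    AVAlg k n →ₐ[k] Weyl k n ⊗[k] UniversalEnvelopingAlgebra k (LPlus k n) :=
  AVAlg.lift (phiPoly k n) (phiVect k n) phiVect_mul

theorem phi_mk_one (f : Poly k n) : phi k n (AVAlg.mk f 1) = Weyl.ofPoly k n f ⊗ₜ 1 := by
  rw [phi, AVAlg.lift_mk, map_one, mul_one, phiPoly_apply]

theorem phi_mk_ι (r : Fin n →₀ ℕ) (p : Fin n) :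
    phi k n (AVAlg.mk 1 (UniversalEnvelopingAlgebra.ι k
        (MvPolynomial.monomial r (1 : k) • MvPolynomial.pderiv p : Vect k n))) =
      Weyl.ofVect k n (MvPolynomial.monomial r (1 : k) • MvPolynomial.pderiv p) ⊗ₜ 1 +
        ∑ m ∈ (Finset.Iic r).erase 0, ((∏ j, (r j).choose (m j) : ℕ) : k) •
          (Weyl.ofPoly k n (MvPolynomial.monomial (r - m) 1) ⊗ₜ
            UniversalEnvelopingAlgebra.ι k (LPlus.elt k m p)) := by
  rw [phi, AVAlg.lift_mk, map_one, one_mul, UniversalEnvelopingAlgebra.lift_ι_apply]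
  have hp : ∀ d, phiVect k n d =
      Weyl.ofVect k n d ⊗ₜ 1 + tensorIncl k n (taylorPart k n d) := fun _ => rfl
  have ht : ∀ d, taylorPart k n d = ∑ p, taylorTerm k n p (d (MvPolynomial.X p)) := fun _ => rfl
  rw [hp, ht, Finset.sum_eq_single p]
  · have hX : (MvPolynomial.monomial r (1 : k) • MvPolynomial.pderiv p : Vect k n)
        (MvPolynomial.X p) = MvPolynomial.monomial r 1 := by
      rw [Derivation.smul_apply, MvPolynomial.pderiv_X_self, smul_eq_mul, mul_one]
    rw [hX, taylorTerm_monomial, map_sum]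
    simp only [map_smul]
    rfl
  · intro b _ hb
    rw [Derivation.smul_apply, MvPolynomial.pderiv_X_of_ne hb, smul_zero, map_zero]
  · intro h; exact absurd (Finset.mem_univ p) h

end Phi

/-! ### Tensor product modules, Gelfand–Kirillov dimension and holonomicity -/

section TensorModule

variable (k : Type u) [Field k] (n : ℕ)
  (P : Type v) [AddCommGroup P] [Module k P] [Module (Weyl k n) P] [IsScalarTower k (Weyl k n) P]
  {Q : Type w} [AddCommGroup Q] [Module k Q]

/-- For a `𝓓`-module `P` and a representation `ρ` of `𝓛₊` on `Q`, the `A # U(Der A)`-module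
structure on `P ⊗ Q`, obtained from the `𝓓 ⊗ U(𝓛₊)`-module `P ⊗ Q` by restriction along `phi`. -/
noncomputable def tensorRep (ρ : LPlus k n →ₗ⁅k⁆ Module.End k Q) :
    AVAlg k n →ₐ[k] Module.End k (P ⊗[k] Q) :=
  ((Module.endTensorEndAlgHom (R := k) (S := k) (A := k) (M := P) (N := Q)).comp
    (Algebra.TensorProduct.map (Algebra.lsmul k k P)
      (UniversalEnvelopingAlgebra.lift k ρ))).comp (phi k n)

variable {k n P}

theorem tensorRep_poly (ρ : LPlus k n →ₗ⁅k⁆ Module.End k Q) (f : Poly k n) (p : P) (q : Q) :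
    tensorRep k n P ρ (AVAlg.mk f 1) (p ⊗ₜ q) = (Weyl.ofPoly k n f • p) ⊗ₜ q := by
  rw [tensorRep, AlgHom.comp_apply, phi_mk_one, AlgHom.comp_apply, Algebra.TensorProduct.map_tmul,
    map_one]
  rfl

theorem tensorRep_vect (ρ : LPlus k n →ₗ⁅k⁆ Module.End k Q) (r : Fin n →₀ ℕ) (i : Fin n)
    (p : P) (q : Q) :
    tensorRep k n P ρ (AVAlg.mk 1 (UniversalEnvelopingAlgebra.ι k
        (MvPolynomial.monomial r (1 : k) • MvPolynomial.pderiv i : Vect k n))) (p ⊗ₜ q) =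
      (Weyl.ofVect k n (MvPolynomial.monomial r (1 : k) • MvPolynomial.pderiv i) • p) ⊗ₜ q +
        ∑ m ∈ (Finset.Iic r).erase 0, ((∏ j, (r j).choose (m j) : ℕ) : k) •
          ((Weyl.ofPoly k n (MvPolynomial.monomial (r - m) 1) • p) ⊗ₜ
            ρ (LPlus.elt k m i) q) := by
  rw [tensorRep, AlgHom.comp_apply, phi_mk_ι, AlgHom.comp_apply, map_add, map_add,
    Algebra.TensorProduct.map_tmul, map_one (UniversalEnvelopingAlgebra.lift k ρ), map_sum,
    map_sum, LinearMap.add_apply,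
    LinearMap.sum_apply]
  simp only [map_smul, LinearMap.smul_apply, Algebra.TensorProduct.map_tmul,
    UniversalEnvelopingAlgebra.lift_ι_apply]
  rfl

end TensorModule

section GK

variable (k : Type u) [Field k] (R : Type v) [Ring R] [Algebra k R]
  (M : Type w) [AddCommGroup M] [Module k M] [Module R M] [IsScalarTower k R M]

/-- `M` is finitely generated over the finitely generated algebra `R`, with Gelfand–Kirillov
dimension `d`: for a finite-dimensional generating subspace `C ∋ 1` of `R` and a finite-dimensional
generating subspace `M₀` of `M`, one has `limsup_m log_m (dim C^m M₀) = d`.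
(The upper limit does not depend on the choice of `C` and `M₀`.) -/
def HasGKDim (d : EReal) : Prop :=
  ∃ (C : Submodule k R) (M₀ : Submodule k M),
    FiniteDimensional k C ∧ (1 : R) ∈ C ∧ Algebra.adjoin k (C : Set R) = ⊤ ∧
    FiniteDimensional k M₀ ∧ Submodule.span R (M₀ : Set M) = ⊤ ∧
    Filter.limsup (fun m : ℕ =>
      ((Real.logb m (Module.finrank k ↥(C ^ m • M₀)) : ℝ) : EReal)) Filter.atTop = d

/-- `M` is a finitely generated `R`-module which is zero or has Gelfand–Kirillov dimension `n`.
For `R = A # U(Der A)` and for `R = 𝓓`, with `A` the polynomial algebra in `n` variables, these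
are the holonomic modules. -/
def IsHolonomic (n : ℕ) : Prop :=
  Module.Finite R M ∧ (Subsingleton M ∨ HasGKDim k R M ((n : ℝ) : EReal))

end GK

end AVMod

/-!
Write `𝓓` for the Weyl algebra and `𝓛₊` for the vector fields in `X` vanishing at the origin.

*Structure of the smash product.* `A # U(Der A)` contains commuting copies of `𝓓` and of `𝓛₊`. The
first is generated by the `xᵢ # 1` and the `1 # ∂ᵢ` (`AVAlg.ofWeyl`); the second consists of the
elements `∑ gᵢ(X - x) ∂/∂Xᵢ`, the vector fields in `𝓛₊` translated to `x` (`AVAlg.ofLPlus`), which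
commute with functions because they vanish at `X = x` and with the `∂ᵢ` because they are invariant
under simultaneous translation of `x` and `X`. Taylor's formula `g(X) = g(x + (X - x))` shows that
the two copies generate the smash product, and recovers the formula for its action on `P ⊗ Q`
(`AVAlg.ofVect_eq`).

*A simple `𝓓`-submodule.* Let `M` be simple and holonomic over the smash product. Its growth is
below `m ^ (n + 1 / 2)`, hence so is that of every cyclic `𝓓`-submodule. The growth of such a
submodule is the Hilbert function of a lower set of exponents (`exists_finrank_degSpan_eq`), and so
cannot lie strictly between the orders `m ^ n` and `m ^ (n + 1)` (`ballCard_dichotomy`): it is at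
most of order `m ^ n`. By Bernstein's inequality (`bernstein_inequality`) every nonzero subquotient
contributes to it at least a fixed multiple of `m ^ n`, so cyclic submodules are artinian and `M` has a
simple `𝓓`-submodule `P` (`exists_simple_submodule_of_orbit_le`), which is holonomic by the same
estimates (`isHolonomic_of_orbit_le`).

*The decomposition.* The `P`-isotypic component of `M` is stable under `𝓓` and under the operators
commuting with `𝓓`, in particular under `𝓛₊`; since `M` is simple, it is all of `M`, so `M ≅ P ⊗ Q`
over `𝓓` (`exists_linearEquiv_tensor`). As `P` has countable dimension and `k` is uncountable and
algebraically closed, `P` has only scalar endomorphisms (`exists_eq_smul_of_rank_le_aleph0`), so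
that `𝓛₊` acts through a representation on `Q` (`exists_lieHom_of_commute`), which is irreducible
because `M` is simple (`eq_bot_or_eq_top_of_stable`).

*The space `Q`.* The smash product being finitely generated, finitely many elements of `𝓛₊` generate
it together with `𝓓`. If `Q` were infinite-dimensional, the subspaces generated from a vector by
products of at most `m` of these elements would have dimension at least `m + 1`, and `M` would have
growth at least of order `m ^ (n + 1)` (`finiteDimensional_of_hasGKDim`). Finally, in a
finite-dimensional irreducible representation of `𝓛₊` the fields without linear part raise the
eigenvalues of the Euler field, so they have a common null vector and hence act by zero: the
representation factors through `𝔤𝔩ₙ` (`exists_rep_gl`).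
-/

namespace AVMod

/-! ### Growth of lower sets of exponents and filtered Hilbert functions -/

section Growth

/-- The number of exponents of degree at most `m` in `D`. -/
noncomputable def ballCard {σ : Type*} (D : Set (σ →₀ ℕ)) (m : ℕ) : ℕ :=
  (D ∩ {e | e.degree ≤ m}).ncard

theorem finite_degree_le (σ : Type*) [Finite σ] (m : ℕ) :
    {e : σ →₀ ℕ | e.degree ≤ m}.Finite := by
  have := Finsupp.finite_of_degree_le (σ := σ) m
  exact this

theorem degree_cons {N : ℕ} (t : ℕ) (e : Fin N →₀ ℕ) :
    (Finsupp.cons t e).degree = t + e.degree := by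
  simp [Finsupp.degree_eq_sum, Fin.sum_univ_succ]

theorem cons_le_cons {N : ℕ} {s t : ℕ} {e f : Fin N →₀ ℕ} (h : s ≤ t) (h' : e ≤ f) :
    Finsupp.cons s e ≤ Finsupp.cons t f := by
  intro i
  refine Fin.cases ?_ (fun j => ?_) i
  · simpa using h
  · simpa using h' j

/-- A decreasing sequence of lower sets of exponents is eventually constant, by Dickson's lemma. -/
theorem exists_slice_stable {σ : Type*} [Finite σ] (D : ℕ → Set (σ →₀ ℕ)) (hD : Antitone D)
    (hl : ∀ t, IsLowerSet (D t)) : ∃ t₀, ∀ t, D t₀ ⊆ D t := by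
  by_contra! h
  have h' : ∀ t, ∃ s e, e ∈ D t ∧ e ∉ D s := fun t => by
    obtain ⟨s, hs⟩ := h t
    obtain ⟨e, he, he'⟩ := Set.not_subset.1 hs
    exact ⟨s, e, he, he'⟩
  choose s e he he' using h'
  let T : ℕ → ℕ := fun i => Nat.rec 0 (fun _ t => max t (s t)) i
  have hT : Monotone T := monotone_nat_of_le_succ fun i => le_max_left _ _
  obtain ⟨i, j, hij, hle⟩ := wellQuasiOrdered_le (fun i => e (T i))
  have h1 : s (T i) ≤ T j := le_trans (le_max_right _ _) (hT (Nat.succ_le_of_lt hij))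
  exact he' (T i) (hl _ hle (hD h1 (he (T j))))

/-- If `D` contains `ℕ × E`, it contains `j + 1` copies of `E`, translated by degrees at most `j`. -/
theorem ballCard_lower_bound {N : ℕ} {D : Set (Fin (N + 1) →₀ ℕ)} {E : Set (Fin N →₀ ℕ)}
    (h : ∀ t, ∀ e ∈ E, Finsupp.cons t e ∈ D) {j m : ℕ} (hj : j ≤ m) :
    (j + 1) * ballCard E (m - j) ≤ ballCard D m := by
  have h1 : ((fun q : ℕ × (Fin N →₀ ℕ) => Finsupp.cons q.1 q.2) ''
      (Set.Iic j ×ˢ (E ∩ {e | e.degree ≤ m - j}))) ⊆ D ∩ {e | e.degree ≤ m} := by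
    rintro _ ⟨⟨t, e⟩, ⟨ht, he, hd⟩, rfl⟩
    refine ⟨h t e he, ?_⟩
    simp only [Set.mem_Iic, Set.mem_ofPred_eq] at ht hd
    simp only [Set.mem_ofPred_eq, degree_cons]
    omega
  have h2 : Function.Injective (fun q : ℕ × (Fin N →₀ ℕ) => Finsupp.cons q.1 q.2) := by
    rintro ⟨t, e⟩ ⟨t', e'⟩ hq
    have ha := DFunLike.congr_fun hq 0
    have hb := congrArg Finsupp.tail hq
    simp at ha hb
    rw [ha, hb]
  have h3 := Set.ncard_le_ncard h1 ((finite_degree_le _ m).subset Set.inter_subset_right)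
  rw [Set.ncard_image_of_injective _ h2, Set.ncard_prod] at h3
  rwa [← Finset.coe_Iic, Set.ncard_coe_finset, Nat.card_Iic] at h3

/-- If all slices of `D` are contained in `E`, and those from height `t₀` on in `E'`, then `D` is
covered by `t₀` copies of `E` and by `ℕ × E'`. -/
theorem ballCard_upper_bound {N : ℕ} {D : Set (Fin (N + 1) →₀ ℕ)} {E E' : Set (Fin N →₀ ℕ)}
    {t₀ : ℕ} (h : ∀ t e, Finsupp.cons t e ∈ D → e ∈ E)
    (h' : ∀ t e, t₀ ≤ t → Finsupp.cons t e ∈ D → e ∈ E') (m : ℕ) :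
    ballCard D m ≤ t₀ * ballCard E m + (m + 1) * ballCard E' m := by
  have h1 : D ∩ {e | e.degree ≤ m} ⊆ (fun q : ℕ × (Fin N →₀ ℕ) => Finsupp.cons q.1 q.2) ''
      ((Set.Iio t₀ ×ˢ (E ∩ {e | e.degree ≤ m})) ∪ (Set.Iic m ×ˢ (E' ∩ {e | e.degree ≤ m}))) := by
    rintro e ⟨he, hd⟩
    rw [← Finsupp.cons_tail e] at he hd
    simp only [Set.mem_ofPred_eq, degree_cons] at hd
    refine ⟨(e 0, e.tail), ?_, Finsupp.cons_tail e⟩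
    rcases lt_or_ge (e 0) t₀ with ht | ht
    · exact Or.inl ⟨ht, h _ _ he, by simp only [Set.mem_ofPred_eq]; omega⟩
    · exact Or.inr ⟨by simp only [Set.mem_Iic]; omega, h' _ _ ht he,
        by simp only [Set.mem_ofPred_eq]; omega⟩
  have hf : ∀ F : Set (Fin N →₀ ℕ), (F ∩ {e | e.degree ≤ m}).Finite := fun F =>
    (finite_degree_le _ m).subset Set.inter_subset_right
  have hfin := ((Set.finite_Iio t₀).prod (hf E)).union ((Set.finite_Iic m).prod (hf E'))
  refine (Set.ncard_le_ncard h1 (hfin.image _)).trans ((Set.ncard_image_le hfin).trans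
    ((Set.ncard_union_le _ _).trans ?_))
  rw [Set.ncard_prod, Set.ncard_prod, ← Finset.coe_Iic, ← Finset.coe_Iio, Set.ncard_coe_finset,
    Set.ncard_coe_finset, Nat.card_Iic, Nat.card_Iio]
  rfl

/-- By induction on the number `N` of variables: the slices `S t` of `D` at height `t` decrease and
become stationary at some `S t₀`. The growth of `D` is at least that of `S 0`, and `m` times that of
`S t₀`, and at most the sum of the two, up to constants. -/
theorem ballCard_dichotomy_fin (N d : ℕ) (D : Set (Fin N →₀ ℕ)) (hD : IsLowerSet D) :
    (∃ C, ∀ m, ballCard D m ≤ C * (m + 1) ^ d) ∨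
      ∃ K, ∀ m, (m + 1) ^ (d + 1) ≤ K * ballCard D m := by
  induction N generalizing d with
  | zero =>
    refine Or.inl ⟨1, fun m => ?_⟩
    have : ballCard D m ≤ 1 := Set.ncard_le_one_of_subsingleton _
    exact this.trans (by simpa using Nat.one_le_pow _ _ (Nat.succ_pos m))
  | succ N ih =>
    let S : ℕ → Set (Fin N →₀ ℕ) := fun t => {e | Finsupp.cons t e ∈ D}
    have hS : Antitone S := fun s t hst e he => hD (cons_le_cons hst le_rfl) he
    have hSl : ∀ t, IsLowerSet (S t) := fun t e f hef he => hD (cons_le_cons le_rfl hef) he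
    obtain ⟨t₀, ht₀⟩ := exists_slice_stable S hS hSl
    have hlow : ∀ j m, j ≤ m → (j + 1) * ballCard (S t₀) (m - j) ≤ ballCard D m := fun j m hj =>
      ballCard_lower_bound (fun t e he => ht₀ t he) hj
    have hup : ∀ m, ballCard D m ≤ t₀ * ballCard (S 0) m + (m + 1) * ballCard (S t₀) m :=
      ballCard_upper_bound (fun t e he => hS (Nat.zero_le t) he) fun t e ht he => hS ht he
    have h0 : ∀ m, ballCard (S 0) m ≤ ballCard D m := fun m => by
      have h1 : (Finsupp.cons 0 : (Fin N →₀ ℕ) → _) '' (S 0 ∩ {e | e.degree ≤ m}) ⊆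
          D ∩ {e | e.degree ≤ m} := by
        rintro _ ⟨e, ⟨he, hd⟩, rfl⟩
        exact ⟨he, by simpa [degree_cons] using hd⟩
      have h2 : Function.Injective (Finsupp.cons 0 : (Fin N →₀ ℕ) → _) := fun e f hef => by
        simpa using congrArg Finsupp.tail hef
      have h3 := Set.ncard_le_ncard h1 ((finite_degree_le _ m).subset Set.inter_subset_right)
      rwa [Set.ncard_image_of_injective _ h2] at h3
    rcases ih d (S 0) (hSl 0) with ⟨C, hC⟩ | ⟨K, hK⟩
    · rcases (S t₀).eq_empty_or_nonempty with he | hne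
      · refine Or.inl ⟨t₀ * C, fun m => (hup m).trans ?_⟩
        have : ballCard (S t₀) m = 0 := by rw [ballCard, he]; simp
        rw [this, mul_zero, add_zero, mul_assoc]
        exact Nat.mul_le_mul_left _ (hC m)
      · have hz : (0 : Fin N →₀ ℕ) ∈ S t₀ := by
          obtain ⟨e, he⟩ := hne
          exact hSl t₀ (zero_le (a := e)) he
        have hpos : ∀ m, 1 ≤ ballCard (S t₀) m := fun m =>
          (Set.ncard_pos ((finite_degree_le _ m).subset Set.inter_subset_right)).2 ⟨0, hz, by simp⟩
        cases d with
        | zero =>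
          refine Or.inr ⟨1, fun m => ?_⟩
          have := hlow m m le_rfl
          calc (m + 1) ^ (0 + 1) = (m + 1) * 1 := by ring
            _ ≤ (m + 1) * ballCard (S t₀) (m - m) := Nat.mul_le_mul_left _ (hpos _)
            _ ≤ 1 * ballCard D m := by rwa [one_mul]
        | succ d =>
          rcases ih d (S t₀) (hSl t₀) with ⟨C', hC'⟩ | ⟨K, hK⟩
          · refine Or.inl ⟨t₀ * C + C', fun m => (hup m).trans ?_⟩
            calc t₀ * ballCard (S 0) m + (m + 1) * ballCard (S t₀) m
                ≤ t₀ * (C * (m + 1) ^ (d + 1)) + (m + 1) * (C' * (m + 1) ^ d) := by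
                  gcongr
                  · exact hC m
                  · exact hC' m
              _ = _ := by ring
          · refine Or.inr ⟨2 ^ (d + 2) * K, fun m => ?_⟩
            have h1 := hlow (m / 2) m (Nat.div_le_self m 2)
            have h2 := hK (m - m / 2)
            have h3 : m + 1 ≤ 2 * (m / 2 + 1) := by omega
            have h4 : m + 1 ≤ 2 * (m - m / 2 + 1) := by omega
            calc (m + 1) ^ (d + 1 + 1) = (m + 1) * (m + 1) ^ (d + 1) := by ring
              _ ≤ (2 * (m / 2 + 1)) * (2 * (m - m / 2 + 1)) ^ (d + 1) := by gcongr
              _ = 2 ^ (d + 2) * ((m / 2 + 1) * (m - m / 2 + 1) ^ (d + 1)) := by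
                rw [mul_pow]; ring
              _ ≤ 2 ^ (d + 2) * ((m / 2 + 1) * (K * ballCard (S t₀) (m - m / 2))) := by gcongr
              _ = 2 ^ (d + 2) * K * ((m / 2 + 1) * ballCard (S t₀) (m - m / 2)) := by ring
              _ ≤ _ := by gcongr
    · exact Or.inr ⟨K, fun m => (hK m).trans (Nat.mul_le_mul_left _ (h0 m))⟩

theorem ballCard_comap {σ τ : Type*} (f : σ ≃ τ) (D : Set (σ →₀ ℕ)) (m : ℕ) :
    ballCard {e : τ →₀ ℕ | e.mapDomain f.symm ∈ D} m = ballCard D m := by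
  have h1 : ∀ e : σ →₀ ℕ, (e.mapDomain f).mapDomain f.symm = e := fun e => by
    rw [← Finsupp.mapDomain_comp, Equiv.symm_comp_self, Finsupp.mapDomain_id]
  have h2 : ∀ e : τ →₀ ℕ, (e.mapDomain f.symm).mapDomain f = e := fun e => by
    rw [← Finsupp.mapDomain_comp, Equiv.self_comp_symm, Finsupp.mapDomain_id]
  have h : {e : τ →₀ ℕ | e.mapDomain f.symm ∈ D} ∩ {e | e.degree ≤ m} =
      (Finsupp.mapDomain f) '' (D ∩ {e | e.degree ≤ m}) := by
    ext e
    constructor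
    · rintro ⟨he, hd⟩
      exact ⟨e.mapDomain f.symm, ⟨he, by simpa using hd⟩, h2 e⟩
    · rintro ⟨e, ⟨he, hd⟩, rfl⟩
      exact ⟨by simpa [h1] using he, by simpa using hd⟩
  rw [ballCard, h, Set.ncard_image_of_injective _ (Function.LeftInverse.injective h1)]
  rfl

/-- The number of exponents of degree at most `m` in a lower set is a function of `m` which is
either at most of order `m ^ d` or at least of order `m ^ (d + 1)`. -/
theorem ballCard_dichotomy {σ : Type*} [Finite σ] (d : ℕ) (D : Set (σ →₀ ℕ)) (hD : IsLowerSet D) :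
    (∃ C, ∀ m, ballCard D m ≤ C * (m + 1) ^ d) ∨
      ∃ K, ∀ m, (m + 1) ^ (d + 1) ≤ K * ballCard D m := by
  obtain ⟨N, ⟨f⟩⟩ := Finite.exists_equiv_fin σ
  simp only [← ballCard_comap f]
  refine ballCard_dichotomy_fin N d _ fun a b hab ha => hD ?_ ha
  intro i
  rw [← f.symm_apply_apply i, Finsupp.mapDomain_apply f.symm.injective,
    Finsupp.mapDomain_apply f.symm.injective]
  exact hab _

/-- The space spanned by the `w e` with `e` of degree at most `m`. -/
def degSpan (k : Type*) [Field k] {V : Type*} [AddCommGroup V] [Module k V] {σ : Type*}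
    (w : (σ →₀ ℕ) → V) (m : ℕ) : Submodule k V :=
  Submodule.span k (w '' {e | e.degree ≤ m})

/-- If the vectors `w e` behave to leading order like monomials, then the dimension of the space
spanned by those of degree at most `m` is the number of standard exponents of degree at most `m`:
an exponent is standard if `w e` is not a combination of the `w f` with `f` smaller than `e` in the
degree-lexicographic order. -/
theorem exists_finrank_degSpan_eq {k : Type*} [Field k] {V : Type*} [AddCommGroup V] [Module k V]
    {σ : Type*} [Finite σ] (w : (σ →₀ ℕ) → V) (T : σ → Module.End k V)
    (hT : ∀ i e, T i (w e) - w (e + Finsupp.single i 1) ∈ degSpan k w e.degree) :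
    ∃ D : Set (σ →₀ ℕ), IsLowerSet D ∧
      ∀ m, Module.finrank k (degSpan k w m) = ballCard D m := by
  classical
  obtain ⟨N, ⟨ε⟩⟩ := Finite.exists_equiv_fin σ
  let _ : LinearOrder σ := LinearOrder.lift' ε ε.injective
  let lt : (σ →₀ ℕ) → Submodule k V := fun e =>
    Submodule.span k (w '' {f | toDegLex f < toDegLex e})
  have hdeg : ∀ {e f : σ →₀ ℕ}, f.degree < e.degree → toDegLex f < toDegLex e := fun h =>
    Finsupp.DegLex.lt_iff.2 (Or.inl h)
  have hlt : ∀ {e f : σ →₀ ℕ}, toDegLex f < toDegLex e → f.degree ≤ e.degree := fun h =>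
    Finsupp.DegLex.monotone_degree h.le
  -- Leading terms are compatible with multiplication by a variable, as for Gröbner bases.
  have hstep : ∀ i e, w e ∈ lt e → w (e + Finsupp.single i 1) ∈ lt (e + Finsupp.single i 1) := by
    intro i e he
    have hsub : ∀ f : σ →₀ ℕ, f.degree ≤ e.degree →
        degSpan k w f.degree ≤ lt (e + Finsupp.single i 1) := by
      intro f hf
      refine Submodule.span_mono (Set.image_mono fun g (hg : g.degree ≤ f.degree) => hdeg ?_)
      simp only [map_add, Finsupp.degree_single]
      omega
    have h1 : lt e ≤ (lt (e + Finsupp.single i 1)).comap (T i) := by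
      refine Submodule.span_le.2 ?_
      rintro _ ⟨f, hf, rfl⟩
      have h2 := hsub f (hlt hf) (hT i f)
      have h3 : w (f + Finsupp.single i 1) ∈ lt (e + Finsupp.single i 1) :=
        Submodule.subset_span ⟨_, add_lt_add_left (α := DegLex (σ →₀ ℕ)) hf _, rfl⟩
      have h4 := Submodule.add_mem _ h2 h3
      rwa [sub_add_cancel] at h4
    have h6 : T i (w e) ∈ lt (e + Finsupp.single i 1) := h1 he
    have h5 := Submodule.sub_mem _ h6 (hsub e le_rfl (hT i e))
    rwa [sub_sub_cancel] at h5
  have hadd : ∀ g e, w e ∈ lt e → w (e + g) ∈ lt (e + g) := by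
    intro g
    induction g using Finsupp.induction_linear with
    | zero => simp
    | add g h hg hh => intro e he; rw [← add_assoc]; exact hh _ (hg _ he)
    | single i a =>
      induction a with
      | zero => simp
      | succ a ih => intro e he; rw [Finsupp.single_add, ← add_assoc]; exact hstep _ _ (ih _ he)
  let D : Set (σ →₀ ℕ) := {e | w e ∉ lt e}
  refine ⟨D, fun a b hba ha hb => ha ?_, fun m => ?_⟩
  · have := hadd (a - b) b hb
    rwa [add_tsub_cancel_of_le hba] at this
  have hind : LinearIndependent k fun e : D => w e := by
    rw [linearIndependent_iff']
    intro s g hg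
    by_contra! hne
    obtain ⟨i₀, hi₀, hgi₀⟩ := hne
    obtain ⟨i, hi, hmax⟩ := (s.filter (g · ≠ 0)).exists_max_image (fun e : D => toDegLex e.1)
      ⟨i₀, Finset.mem_filter.2 ⟨hi₀, hgi₀⟩⟩
    obtain ⟨his, hgi⟩ := Finset.mem_filter.1 hi
    apply i.2
    rw [← Finset.add_sum_erase s _ his, add_eq_zero_iff_eq_neg] at hg
    have h1 : g i • w i ∈ lt i := by
      rw [hg]
      refine Submodule.neg_mem _ (Submodule.sum_mem _ fun j hj => ?_)
      by_cases hgj : g j = 0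
      · rw [hgj, zero_smul]; exact Submodule.zero_mem _
      · refine Submodule.smul_mem _ _ (Submodule.subset_span ⟨j, lt_of_le_of_ne
          (hmax j (Finset.mem_filter.2 ⟨Finset.mem_of_mem_erase hj, hgj⟩)) ?_, rfl⟩)
        exact fun h => Finset.ne_of_mem_erase hj (Subtype.ext h)
    exact (Submodule.smul_mem_iff _ hgi).1 h1
  have hspan : degSpan k w m = Submodule.span k (w '' (D ∩ {e | e.degree ≤ m})) := by
    refine le_antisymm (Submodule.span_le.2 ?_)
      (Submodule.span_mono (Set.image_mono Set.inter_subset_right))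
    rintro _ ⟨e, he, rfl⟩
    have key : ∀ e : DegLex (σ →₀ ℕ), (ofDegLex e).degree ≤ m →
        w (ofDegLex e) ∈ Submodule.span k (w '' (D ∩ {e | e.degree ≤ m})) := by
      intro e
      induction e using WellFoundedLT.induction with
      | ind e ih =>
        intro he
        by_cases hD : ofDegLex e ∈ D
        · exact Submodule.subset_span ⟨_, ⟨hD, he⟩, rfl⟩
        · have h1 : lt (ofDegLex e) ≤ Submodule.span k (w '' (D ∩ {e | e.degree ≤ m})) := by
            refine Submodule.span_le.2 ?_
            rintro _ ⟨f, hf, rfl⟩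
            exact ih (toDegLex f) hf ((hlt hf).trans he)
          exact h1 (not_not.1 hD)
    exact key (toDegLex e) he
  have hfin : (D ∩ {e | e.degree ≤ m}).Finite :=
    (finite_degree_le _ m).subset Set.inter_subset_right
  have hind' : LinearIndependent k fun e : ↥(D ∩ {e | e.degree ≤ m}) => w e :=
    hind.comp (fun e : ↥(D ∩ {e | e.degree ≤ m}) => (⟨e.1, e.2.1⟩ : D)) fun e f h =>
      Subtype.ext (congrArg (fun x => x.1) h)
  let _ := hfin.fintype
  rw [hspan, Set.image_eq_range, finrank_span_eq_card hind', ballCard, Set.ncard_eq_toFinset_card',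
    Set.toFinset_card]

end Growth

/-! ### Normal ordering in the Weyl algebra -/

theorem finsupp_nat_induction {σ : Type*} {p : (σ →₀ ℕ) → Prop} (h0 : p 0)
    (hs : ∀ i e, p e → p (e + Finsupp.single i 1)) (e : σ →₀ ℕ) : p e := by
  have key : ∀ g e : σ →₀ ℕ, p e → p (e + g) := by
    intro g
    induction g using Finsupp.induction_linear with
    | zero => simp
    | add g h hg hh => intro e he; rw [← add_assoc]; exact hh _ (hg _ he)
    | single i a =>
      induction a with
      | zero => simp
      | succ a ih => intro e he; rw [Finsupp.single_add, ← add_assoc]; exact hs _ _ (ih _ he)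
  simpa using key e 0 h0

section WeylPair

variable {k : Type u} [Field k] {n : ℕ} {R : Type w} [Ring R] [Algebra k R]

open scoped IsMulCommutative in
/-- Pairwise commuting elements of a noncommutative algebra define a homomorphism from the
polynomial algebra. -/
theorem exists_algHom_of_commute (y : Fin n → R) (h : ∀ i j, y i * y j = y j * y i) :
    ∃ β : Poly k n →ₐ[k] R, ∀ i, β (MvPolynomial.X i) = y i := by
  have hc : ∀ a ∈ Set.range y, ∀ b ∈ Set.range y, a * b = b * a := by
    rintro _ ⟨i, rfl⟩ _ ⟨j, rfl⟩
    exact h i j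
  have := Algebra.isMulCommutative_adjoin k hc
  let γ : Poly k n →ₐ[k] Algebra.adjoin k (Set.range y) :=
    MvPolynomial.aeval fun i => ⟨y i, Algebra.subset_adjoin ⟨i, rfl⟩⟩
  refine ⟨(Algebra.adjoin k (Set.range y)).val.comp γ, fun i => ?_⟩
  have h1 : γ (MvPolynomial.X i) = ⟨y i, Algebra.subset_adjoin ⟨i, rfl⟩⟩ :=
    MvPolynomial.aeval_X _ i
  rw [AlgHom.comp_apply, h1]
  rfl

variable (k n R) in
/-- Two commuting families `xᵢ = α(Xᵢ)` and `yᵢ = β(Xᵢ)` of elements of an algebra which satisfy the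
canonical commutation relations `yᵢ xⱼ - xⱼ yᵢ = δᵢⱼ`. -/
structure WeylPair where
  /-- The homomorphism given by the `xᵢ`. -/
  α : Poly k n →ₐ[k] R
  /-- The homomorphism given by the `yᵢ`. -/
  β : Poly k n →ₐ[k] R
  /-- The canonical commutation relations. -/
  comm : ∀ i j, β (MvPolynomial.X i) * α (MvPolynomial.X j) =
    α (MvPolynomial.X j) * β (MvPolynomial.X i) + if i = j then 1 else 0

namespace WeylPair

variable (W : WeylPair k n R)

theorem β_X_mul_α (i : Fin n) (f : Poly k n) :
    W.β (MvPolynomial.X i) * W.α f =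
      W.α f * W.β (MvPolynomial.X i) + W.α (MvPolynomial.pderiv i f) := by
  induction f using MvPolynomial.induction_on with
  | C a =>
    rw [MvPolynomial.pderiv_C, map_zero, add_zero, ← MvPolynomial.algebraMap_eq, AlgHom.commutes]
    exact (Algebra.commutes a _).symm
  | add p q hp hq => simp only [map_add, mul_add, add_mul, hp, hq]; abel
  | mul_X p j hp =>
    rw [map_mul, ← mul_assoc, hp, add_mul, mul_assoc, W.comm, Derivation.leibniz,
      MvPolynomial.pderiv_X, smul_eq_mul, smul_eq_mul, map_add, map_mul, map_mul, mul_add,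
      mul_assoc, ← map_mul W.α (MvPolynomial.X j), mul_comm (MvPolynomial.X j), map_mul, add_assoc]
    congr 2
    by_cases hij : i = j
    · subst hij; simp
    · simp [hij, Ne.symm hij]

theorem β_mul_α_X (i : Fin n) (g : Poly k n) :
    W.β g * W.α (MvPolynomial.X i) =
      W.α (MvPolynomial.X i) * W.β g + W.β (MvPolynomial.pderiv i g) := by
  induction g using MvPolynomial.induction_on with
  | C a =>
    rw [MvPolynomial.pderiv_C, map_zero, add_zero, ← MvPolynomial.algebraMap_eq, AlgHom.commutes]
    exact Algebra.commutes a _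
  | add p q hp hq => simp only [map_add, mul_add, add_mul, hp, hq]; abel
  | mul_X p j hp =>
    rw [map_mul, mul_assoc, W.comm, mul_add, ← mul_assoc, hp, Derivation.leibniz,
      MvPolynomial.pderiv_X, smul_eq_mul, smul_eq_mul, map_add, map_mul, map_mul, add_mul,
      mul_assoc, add_assoc, ← map_mul W.β (MvPolynomial.X j), mul_comm (MvPolynomial.X j), map_mul]
    congr 1
    rw [add_comm]
    congr 1
    by_cases hij : i = j
    · subst hij; simp
    · simp [Ne.symm hij]

/-- The normally ordered monomial `x^a y^b`, where `(a, b)` are the components of the exponent. -/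
noncomputable def mon (e : Fin n ⊕ Fin n →₀ ℕ) : R :=
  W.α (MvPolynomial.monomial (Finsupp.sumFinsuppAddEquivProdFinsupp e).1 1) *
    W.β (MvPolynomial.monomial (Finsupp.sumFinsuppAddEquivProdFinsupp e).2 1)

theorem pderiv_monomial_one (i : Fin n) (a : Fin n →₀ ℕ) :
    MvPolynomial.pderiv i (MvPolynomial.monomial a (1 : k)) =
      (a i : k) • MvPolynomial.monomial (a - Finsupp.single i 1) 1 := by
  rw [MvPolynomial.pderiv_monomial, one_mul, MvPolynomial.smul_monomial, smul_eq_mul, mul_one]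

theorem sumFinsupp_single_inl (i : Fin n) :
    Finsupp.sumFinsuppAddEquivProdFinsupp (Finsupp.single (Sum.inl i : Fin n ⊕ Fin n) 1) =
      (Finsupp.single i 1, 0) := by
  ext j <;> simp [Finsupp.single_apply]

theorem sumFinsupp_single_inr (i : Fin n) :
    Finsupp.sumFinsuppAddEquivProdFinsupp (Finsupp.single (Sum.inr i : Fin n ⊕ Fin n) 1) =
      (0, Finsupp.single i 1) := by
  ext j <;> simp [Finsupp.single_apply]

theorem sumFinsupp_sub_inl (e : Fin n ⊕ Fin n →₀ ℕ) (i : Fin n) :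
    Finsupp.sumFinsuppAddEquivProdFinsupp (e - Finsupp.single (Sum.inl i) 1) =
      ((Finsupp.sumFinsuppAddEquivProdFinsupp e).1 - Finsupp.single i 1,
        (Finsupp.sumFinsuppAddEquivProdFinsupp e).2) := by
  ext j <;> simp [Finsupp.single_apply]

theorem sumFinsupp_sub_inr (e : Fin n ⊕ Fin n →₀ ℕ) (i : Fin n) :
    Finsupp.sumFinsuppAddEquivProdFinsupp (e - Finsupp.single (Sum.inr i) 1) =
      ((Finsupp.sumFinsuppAddEquivProdFinsupp e).1,
        (Finsupp.sumFinsuppAddEquivProdFinsupp e).2 - Finsupp.single i 1) := by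
  ext j <;> simp [Finsupp.single_apply]

theorem mon_zero : W.mon 0 = 1 := by
  rw [mon, map_zero]
  simp [MvPolynomial.monomial_zero']

theorem α_X_mul_mon (i : Fin n) (e : Fin n ⊕ Fin n →₀ ℕ) :
    W.α (MvPolynomial.X i) * W.mon e = W.mon (e + Finsupp.single (Sum.inl i) 1) := by
  rw [mon, mon, map_add, sumFinsupp_single_inl, ← mul_assoc, ← map_mul, mul_comm,
    MvPolynomial.X, MvPolynomial.monomial_mul]
  simp

theorem α_mul_β_X_mul (i : Fin n) (e : Fin n ⊕ Fin n →₀ ℕ) :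
    W.α (MvPolynomial.monomial (Finsupp.sumFinsuppAddEquivProdFinsupp e).1 1) *
      (W.β (MvPolynomial.X i) *
        W.β (MvPolynomial.monomial (Finsupp.sumFinsuppAddEquivProdFinsupp e).2 1)) =
      W.mon (e + Finsupp.single (Sum.inr i) 1) := by
  rw [mon, map_add, sumFinsupp_single_inr, ← map_mul, mul_comm (MvPolynomial.X i),
    MvPolynomial.X, MvPolynomial.monomial_mul]
  simp

theorem β_X_mul_mon (i : Fin n) (e : Fin n ⊕ Fin n →₀ ℕ) :
    W.β (MvPolynomial.X i) * W.mon e = W.mon (e + Finsupp.single (Sum.inr i) 1) +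
      (e (Sum.inl i) : k) • W.mon (e - Finsupp.single (Sum.inl i) 1) := by
  rw [← α_mul_β_X_mul, mon, ← mul_assoc, β_X_mul_α, add_mul, mul_assoc, mon, sumFinsupp_sub_inl,
    pderiv_monomial_one, map_smul, smul_mul_assoc]
  simp

theorem mon_mul_β_X (i : Fin n) (e : Fin n ⊕ Fin n →₀ ℕ) :
    W.mon e * W.β (MvPolynomial.X i) = W.mon (e + Finsupp.single (Sum.inr i) 1) := by
  rw [← α_mul_β_X_mul, mon, mul_assoc, ← map_mul, ← map_mul, mul_comm (MvPolynomial.X i)]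

theorem mon_mul_α_X (i : Fin n) (e : Fin n ⊕ Fin n →₀ ℕ) :
    W.mon e * W.α (MvPolynomial.X i) = W.α (MvPolynomial.X i) * W.mon e +
      (e (Sum.inr i) : k) • W.mon (e - Finsupp.single (Sum.inr i) 1) := by
  rw [mon, mul_assoc, β_mul_α_X, mul_add, ← mul_assoc, ← mul_assoc, ← map_mul, ← map_mul,
    mul_comm (MvPolynomial.X i), mon, sumFinsupp_sub_inr, pderiv_monomial_one, map_smul,
    mul_smul_comm]
  simp

theorem mon_mem_degSpan {e : Fin n ⊕ Fin n →₀ ℕ} {m : ℕ} (h : e.degree ≤ m) :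
    W.mon e ∈ degSpan k W.mon m :=
  Submodule.subset_span ⟨e, h, rfl⟩

theorem one_mem_degSpan (m : ℕ) : (1 : R) ∈ degSpan k W.mon m := by
  rw [← W.mon_zero]
  exact W.mon_mem_degSpan (by simp)

theorem degSpan_mono {m l : ℕ} (h : m ≤ l) : degSpan k W.mon m ≤ degSpan k W.mon l :=
  Submodule.span_mono (Set.image_mono fun _ he => le_trans he h)

theorem degSpan_le {m : ℕ} {S : Submodule k R}
    (h : ∀ e : Fin n ⊕ Fin n →₀ ℕ, e.degree ≤ m → W.mon e ∈ S) : degSpan k W.mon m ≤ S := by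
  refine Submodule.span_le.2 ?_
  rintro _ ⟨e, he, rfl⟩
  exact h e he

/-- The lower-order terms produced by the commutation relations have smaller degree; the coefficient
vanishes when the subtraction of exponents truncates. -/
theorem smul_mon_sub_mem {e : Fin n ⊕ Fin n →₀ ℕ} {m : ℕ} (h : e.degree ≤ m + 1)
    (i : Fin n ⊕ Fin n) :
    (e i : k) • W.mon (e - Finsupp.single i 1) ∈ degSpan k W.mon m := by
  rcases Nat.eq_zero_or_pos (e i) with hi | hi
  · rw [hi, Nat.cast_zero, zero_smul]; exact Submodule.zero_mem _
  · refine Submodule.smul_mem _ _ (W.mon_mem_degSpan ?_)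
    have h1 : e - Finsupp.single i 1 + Finsupp.single i 1 = e :=
      tsub_add_cancel_of_le (Finsupp.single_le_iff.2 hi)
    have h2 := congrArg Finsupp.degree h1
    rw [map_add, Finsupp.degree_single] at h2
    omega

theorem α_X_mul_mem {m : ℕ} {r : R} (hr : r ∈ degSpan k W.mon m) (i : Fin n) :
    W.α (MvPolynomial.X i) * r ∈ degSpan k W.mon (m + 1) := by
  have h : degSpan k W.mon m ≤ (degSpan k W.mon (m + 1)).comap
      (LinearMap.mulLeft k (W.α (MvPolynomial.X i))) := W.degSpan_le fun e he => by
    rw [Submodule.mem_comap, LinearMap.mulLeft_apply, α_X_mul_mon]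
    exact W.mon_mem_degSpan (by simp only [map_add, Finsupp.degree_single]; omega)
  exact h hr

theorem β_X_mul_mem {m : ℕ} {r : R} (hr : r ∈ degSpan k W.mon m) (i : Fin n) :
    W.β (MvPolynomial.X i) * r ∈ degSpan k W.mon (m + 1) := by
  have h : degSpan k W.mon m ≤ (degSpan k W.mon (m + 1)).comap
      (LinearMap.mulLeft k (W.β (MvPolynomial.X i))) := W.degSpan_le fun e he => by
    rw [Submodule.mem_comap, LinearMap.mulLeft_apply, β_X_mul_mon]
    exact Submodule.add_mem _
      (W.mon_mem_degSpan (by simp only [map_add, Finsupp.degree_single]; omega))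
      (W.smul_mon_sub_mem (by omega) _)
  exact h hr

/-- Commutators with the `xᵢ` lower the degree. -/
theorem commutator_α_X_mem {m : ℕ} {r : R} (hr : r ∈ degSpan k W.mon (m + 1)) (i : Fin n) :
    r * W.α (MvPolynomial.X i) - W.α (MvPolynomial.X i) * r ∈ degSpan k W.mon m := by
  have h : degSpan k W.mon (m + 1) ≤ (degSpan k W.mon m).comap
      (LinearMap.mulRight k (W.α (MvPolynomial.X i)) -
        LinearMap.mulLeft k (W.α (MvPolynomial.X i))) := W.degSpan_le fun e he => by
    rw [Submodule.mem_comap, LinearMap.sub_apply, LinearMap.mulLeft_apply,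
      LinearMap.mulRight_apply, mon_mul_α_X, add_sub_cancel_left]
    exact W.smul_mon_sub_mem he _
  exact h hr

/-- Commutators with the `yᵢ` lower the degree. -/
theorem commutator_β_X_mem {m : ℕ} {r : R} (hr : r ∈ degSpan k W.mon (m + 1)) (i : Fin n) :
    W.β (MvPolynomial.X i) * r - r * W.β (MvPolynomial.X i) ∈ degSpan k W.mon m := by
  have h : degSpan k W.mon (m + 1) ≤ (degSpan k W.mon m).comap
      (LinearMap.mulLeft k (W.β (MvPolynomial.X i)) -
        LinearMap.mulRight k (W.β (MvPolynomial.X i))) := W.degSpan_le fun e he => by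
    rw [Submodule.mem_comap, LinearMap.sub_apply, LinearMap.mulLeft_apply,
      LinearMap.mulRight_apply, mon_mul_β_X, β_X_mul_mon, add_sub_cancel_left]
    exact W.smul_mon_sub_mem he _
  exact h hr

theorem mon_mul_mem (e : Fin n ⊕ Fin n →₀ ℕ) {m : ℕ} {r : R} (hr : r ∈ degSpan k W.mon m) :
    W.mon e * r ∈ degSpan k W.mon (e.degree + m) := by
  -- It is enough to multiply by the `yᵢ`, then by the `xᵢ`, one after the other.
  have hβ : ∀ b : Fin n →₀ ℕ, W.β (MvPolynomial.monomial b 1) * r ∈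
      degSpan k W.mon (b.degree + m) := by
    intro b
    induction b using finsupp_nat_induction with
    | h0 => simpa [MvPolynomial.monomial_zero'] using hr
    | hs i b ih =>
      have h1 := W.β_X_mul_mem ih i
      rw [← mul_assoc, ← map_mul, MvPolynomial.X, MvPolynomial.monomial_mul, one_mul,
        add_comm (Finsupp.single i 1)] at h1
      rw [map_add, Finsupp.degree_single, add_right_comm]
      exact h1
  have hα : ∀ a b : Fin n →₀ ℕ, W.α (MvPolynomial.monomial a 1) *
      (W.β (MvPolynomial.monomial b 1) * r) ∈ degSpan k W.mon (a.degree + (b.degree + m)) := by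
    intro a b
    induction a using finsupp_nat_induction with
    | h0 => simpa [MvPolynomial.monomial_zero'] using hβ b
    | hs i a ih =>
      have h1 := W.α_X_mul_mem ih i
      rw [← mul_assoc, ← map_mul, MvPolynomial.X, MvPolynomial.monomial_mul, one_mul,
        add_comm (Finsupp.single i 1)] at h1
      rw [map_add, Finsupp.degree_single, add_right_comm]
      exact h1
  have h2 : e.degree = (Finsupp.sumFinsuppAddEquivProdFinsupp e).1.degree +
      (Finsupp.sumFinsuppAddEquivProdFinsupp e).2.degree := by
    simp [Finsupp.degree_eq_sum]
  rw [h2, add_assoc, mon, mul_assoc]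
  exact hα _ _

theorem mul_mem_degSpan {m l : ℕ} {r s : R} (hr : r ∈ degSpan k W.mon m)
    (hs : s ∈ degSpan k W.mon l) : r * s ∈ degSpan k W.mon (m + l) := by
  have h : degSpan k W.mon m ≤ (degSpan k W.mon (m + l)).comap (LinearMap.mulRight k s) :=
    W.degSpan_le fun e he => by
      rw [Submodule.mem_comap, LinearMap.mulRight_apply]
      exact W.degSpan_mono (by omega) (W.mon_mul_mem e hs)
  exact h hr

/-- The subspace spanned by `1`, the `xᵢ` and the `yᵢ`. -/
def gens : Submodule k R :=
  Submodule.span k ({1} ∪ (Set.range (fun i => W.α (MvPolynomial.X i)) ∪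
    Set.range (fun i => W.β (MvPolynomial.X i))))

theorem one_mem_gens : (1 : R) ∈ W.gens := Submodule.subset_span (Or.inl rfl)

theorem α_X_mem_gens (i : Fin n) : W.α (MvPolynomial.X i) ∈ W.gens :=
  Submodule.subset_span (Or.inr (Or.inl ⟨i, rfl⟩))

theorem β_X_mem_gens (i : Fin n) : W.β (MvPolynomial.X i) ∈ W.gens :=
  Submodule.subset_span (Or.inr (Or.inr ⟨i, rfl⟩))

instance finiteDimensional_gens : FiniteDimensional k W.gens :=
  FiniteDimensional.span_of_finite k
    ((Set.finite_singleton 1).union ((Set.finite_range _).union (Set.finite_range _)))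

/-- Products of at most `m` of the `xᵢ` and `yᵢ` span the same space as the normally ordered
monomials of degree at most `m`. -/
theorem gens_pow (m : ℕ) : W.gens ^ m = degSpan k W.mon m := by
  have hg : W.gens ≤ degSpan k W.mon 1 := by
    refine Submodule.span_le.2 ?_
    rintro _ (rfl | ⟨i, rfl⟩ | ⟨i, rfl⟩)
    · exact W.one_mem_degSpan 1
    · simpa using W.α_X_mul_mem (W.one_mem_degSpan 0) i
    · simpa using W.β_X_mul_mem (W.one_mem_degSpan 0) i
  have hone : ∀ m, (1 : R) ∈ W.gens ^ m := fun m => by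
    simpa using Submodule.pow_mem_pow W.gens W.one_mem_gens m
  have hmono : ∀ {m l : ℕ}, m ≤ l → W.gens ^ m ≤ W.gens ^ l := fun {m l} h => by
    obtain ⟨j, rfl⟩ := Nat.exists_eq_add_of_le h
    rw [pow_add]
    intro r hr
    simpa using Submodule.mul_mem_mul hr (hone j)
  apply le_antisymm
  · induction m with
    | zero =>
      rw [pow_zero, Submodule.one_le]
      exact W.one_mem_degSpan 0
    | succ m ih =>
      rw [pow_succ, Submodule.mul_le]
      exact fun r hr s hs => W.mul_mem_degSpan (ih hr) (hg hs)
  · refine W.degSpan_le fun e he => hmono he ?_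
    have hpow : ∀ (γ : Poly k n →ₐ[k] R), (∀ i, γ (MvPolynomial.X i) ∈ W.gens) →
        ∀ a : Fin n →₀ ℕ, γ (MvPolynomial.monomial a 1) ∈ W.gens ^ a.degree := by
      intro γ hγ a
      induction a using finsupp_nat_induction with
      | h0 => simpa [MvPolynomial.monomial_zero'] using hone 0
      | hs i a ih =>
        have h1 := Submodule.mul_mem_mul ih (hγ i)
        rw [← pow_succ, ← map_mul, MvPolynomial.X, MvPolynomial.monomial_mul, one_mul] at h1
        rwa [map_add, Finsupp.degree_single]
    have h2 : e.degree = (Finsupp.sumFinsuppAddEquivProdFinsupp e).1.degree +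
        (Finsupp.sumFinsuppAddEquivProdFinsupp e).2.degree := by
      simp [Finsupp.degree_eq_sum]
    rw [h2, pow_add]
    exact Submodule.mul_mem_mul (hpow _ W.α_X_mem_gens _) (hpow _ W.β_X_mem_gens _)

/-- Normal ordering: the normally ordered monomials span the subalgebra generated by the `xᵢ` and
the `yᵢ`. -/
theorem mem_degSpan_of_mem_adjoin {r : R} (hr : r ∈ Algebra.adjoin k
    (Set.range (fun i => W.α (MvPolynomial.X i)) ∪ Set.range (fun i => W.β (MvPolynomial.X i)))) :
    ∃ m, r ∈ degSpan k W.mon m := by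
  induction hr using Algebra.adjoin_induction with
  | mem x hx =>
    rcases hx with ⟨i, rfl⟩ | ⟨i, rfl⟩
    · exact ⟨1, by simpa using W.α_X_mul_mem (W.one_mem_degSpan 0) i⟩
    · exact ⟨1, by simpa using W.β_X_mul_mem (W.one_mem_degSpan 0) i⟩
  | algebraMap c =>
    refine ⟨0, ?_⟩
    rw [Algebra.algebraMap_eq_smul_one]
    exact Submodule.smul_mem _ _ (W.one_mem_degSpan 0)
  | add x y _ _ hx hy =>
    obtain ⟨a, ha⟩ := hx
    obtain ⟨b, hb⟩ := hy
    exact ⟨max a b, Submodule.add_mem _ (W.degSpan_mono (le_max_left _ _) ha)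
      (W.degSpan_mono (le_max_right _ _) hb)⟩
  | mul x y _ _ hx hy =>
    obtain ⟨a, ha⟩ := hx
    obtain ⟨b, hb⟩ := hy
    exact ⟨a + b, W.mul_mem_degSpan ha hb⟩

end WeylPair

end WeylPair

/-! ### The canonical basis and the centre of the Weyl algebra -/

section WeylBasis

variable (k : Type u) [Field k] (n : ℕ)

variable {k n} in
theorem pderiv_lie_pderiv (i j : Fin n) :
    ⁅(MvPolynomial.pderiv i : Vect k n), (MvPolynomial.pderiv j : Vect k n)⁆ = 0 := by
  apply MvPolynomial.derivation_ext
  intro l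
  rw [Derivation.commutator_apply, MvPolynomial.pderiv_X, MvPolynomial.pderiv_X]
  have h : ∀ a b : Fin n, (Pi.single a 1 : Fin n → Poly k n) b =
      MvPolynomial.C (if b = a then 1 else 0) := fun a b => by
    rw [Pi.single_apply]; split_ifs <;> simp
  rw [h, h, MvPolynomial.pderiv_C, MvPolynomial.pderiv_C, sub_zero]
  rfl

variable {k n} in
theorem Weyl.ofVect_pderiv_comm (i j : Fin n) :
    Weyl.ofVect k n (MvPolynomial.pderiv i) * Weyl.ofVect k n (MvPolynomial.pderiv j) =
      Weyl.ofVect k n (MvPolynomial.pderiv j) * Weyl.ofVect k n (MvPolynomial.pderiv i) := by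
  have h2 := LieHom.map_lie (Weyl.ofVect k n) (MvPolynomial.pderiv i) (MvPolynomial.pderiv j)
  rw [pderiv_lie_pderiv, map_zero, LieRing.of_associative_ring_bracket] at h2
  exact sub_eq_zero.1 h2.symm

/-- The elements `xᵢ` and `∂ᵢ` of the Weyl algebra. -/
noncomputable def weylPair : WeylPair k n (Weyl k n) where
  α := Weyl.ofPoly k n
  β := (exists_algHom_of_commute _ Weyl.ofVect_pderiv_comm).choose
  comm i j := by
    rw [(exists_algHom_of_commute _ Weyl.ofVect_pderiv_comm).choose_spec, Weyl.ofVect_mul_ofPoly,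
      MvPolynomial.pderiv_X, add_comm, Pi.single_apply]
    congr 1
    by_cases hij : i = j
    · subst hij; simp
    · simp [hij, Ne.symm hij]

variable {k n}

theorem weylPair_α : (weylPair k n).α = Weyl.ofPoly k n := rfl

theorem weylPair_β_X (i : Fin n) :
    (weylPair k n).β (MvPolynomial.X i) = Weyl.ofVect k n (MvPolynomial.pderiv i) :=
  (exists_algHom_of_commute _ Weyl.ofVect_pderiv_comm).choose_spec i

theorem vect_eq_sum (d : Vect k n) :
    d = ∑ i, d (MvPolynomial.X i) • (MvPolynomial.pderiv i : Vect k n) := by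
  apply MvPolynomial.derivation_ext
  intro j
  have h1 := congrFun (map_sum (Derivation.coeFnAddMonoidHom (R := k) (A := Poly k n)
    (M := Poly k n)) (fun i => d (MvPolynomial.X i) • MvPolynomial.pderiv i) Finset.univ)
    (MvPolynomial.X j)
  refine Eq.trans ?_ h1.symm
  simp [Finset.sum_apply, MvPolynomial.pderiv_X, Pi.single_apply]

theorem Weyl.ofVect_smul (f : Poly k n) (d : Vect k n) :
    Weyl.ofVect k n (f • d) = Weyl.ofPoly k n f * Weyl.ofVect k n d :=
  Weyl.val_injective k n (LinearMap.ext fun _ => rfl)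

theorem Weyl.val_ofPoly (f g : Poly k n) : Weyl.val k n (Weyl.ofPoly k n f) g = f * g := rfl

theorem Weyl.val_ofVect (d : Vect k n) (g : Poly k n) :
    Weyl.val k n (Weyl.ofVect k n d) g = d g := rfl

theorem weyl_adjoin_eq_top :
    Algebra.adjoin k (Set.range (fun i => (weylPair k n).α (MvPolynomial.X i)) ∪
      Set.range (fun i => (weylPair k n).β (MvPolynomial.X i))) = ⊤ := by
  set G := Algebra.adjoin k (Set.range (fun i => (weylPair k n).α (MvPolynomial.X i)) ∪
      Set.range (fun i => (weylPair k n).β (MvPolynomial.X i))) with hG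
  have hf : ∀ f, Weyl.ofPoly k n f ∈ G := by
    intro f
    induction f using MvPolynomial.induction_on with
    | C a =>
      rw [← MvPolynomial.algebraMap_eq, AlgHom.commutes]
      exact G.algebraMap_mem a
    | add p q hp hq => rw [map_add]; exact G.add_mem hp hq
    | mul_X p i hp =>
      rw [map_mul]
      exact G.mul_mem hp (Algebra.subset_adjoin (Or.inl ⟨i, rfl⟩))
  have hd : ∀ d, Weyl.ofVect k n d ∈ G := by
    intro d
    rw [vect_eq_sum d, map_sum]
    refine G.sum_mem fun i _ => ?_
    rw [Weyl.ofVect_smul, ← weylPair_β_X]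
    exact G.mul_mem (hf _) (Algebra.subset_adjoin (Or.inr ⟨i, rfl⟩))
  have hle : weylSubalgebra k n ≤ G.map (Weyl.val k n) := by
    refine Algebra.adjoin_le ?_
    rintro _ (⟨f, rfl⟩ | ⟨d, rfl⟩)
    · exact ⟨_, hf f, rfl⟩
    · exact ⟨_, hd d, rfl⟩
  refine eq_top_iff.2 fun r _ => ?_
  obtain ⟨s, hs, hsr⟩ := hle r.2
  rwa [Weyl.val_injective k n hsr] at hs

/-- Every element of the Weyl algebra is a combination of monomials `x^a ∂^b`. -/
theorem weyl_exists_mem_degSpan (r : Weyl k n) : ∃ m, r ∈ degSpan k (weylPair k n).mon m := by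
  refine (weylPair k n).mem_degSpan_of_mem_adjoin ?_
  rw [weyl_adjoin_eq_top]
  trivial

/-- `∂^b x^c` is a nonzero multiple of `x^(c - b)` if `b ≤ c`, and zero otherwise. -/
theorem weylPair_β_monomial_apply [CharZero k] (b c : Fin n →₀ ℕ) :
    ∃ s : k, (s ≠ 0 ↔ b ≤ c) ∧
      Weyl.val k n ((weylPair k n).β (MvPolynomial.monomial b 1)) (MvPolynomial.monomial c 1) =
        MvPolynomial.monomial (c - b) s := by
  induction b using finsupp_nat_induction with
  | h0 => exact ⟨1, by simp, by simp [MvPolynomial.monomial_zero']⟩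
  | hs i b ih =>
    obtain ⟨s, hs, h⟩ := ih
    refine ⟨s * ((c - b) i : ℕ), ?_, ?_⟩
    · rw [mul_ne_zero_iff, hs, Nat.cast_ne_zero]
      constructor
      · rintro ⟨hbc, hi⟩ j
        have := hbc j
        by_cases hij : i = j
        · subst hij
          simp at hi ⊢
          omega
        · simpa [Finsupp.single_apply, hij] using this
      · intro h
        refine ⟨le_trans (le_add_of_nonneg_right (zero_le)) h, ?_⟩
        have := h i
        simp at this ⊢
        omega
    · have h1 : (MvPolynomial.monomial (b + Finsupp.single i 1) 1 : Poly k n) =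
          MvPolynomial.X i * MvPolynomial.monomial b 1 := by
        rw [MvPolynomial.X, MvPolynomial.monomial_mul, one_mul, add_comm]
      rw [h1, map_mul, map_mul, Module.End.mul_apply, h, weylPair_β_X, Weyl.val_ofVect,
        MvPolynomial.pderiv_monomial, tsub_tsub]

theorem linearIndependent_weyl_mon [CharZero k] : LinearIndependent k (weylPair k n).mon := by
  classical
  rw [linearIndependent_iff']
  intro s g hg
  by_contra! hne
  obtain ⟨i₀, hi₀, hgi₀⟩ := hne
  -- Apply the relation to `x^c`, where `∂^c` has the smallest degree among the `∂^b` involved.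
  obtain ⟨e, he, hmin⟩ := (s.filter (g · ≠ 0)).exists_min_image
    (fun e => (Finsupp.sumFinsuppAddEquivProdFinsupp e).2.degree)
    ⟨i₀, Finset.mem_filter.2 ⟨hi₀, hgi₀⟩⟩
  obtain ⟨hes, hge⟩ := Finset.mem_filter.1 he
  set c := (Finsupp.sumFinsuppAddEquivProdFinsupp e).2 with hc
  have h1 := congrArg (fun r => MvPolynomial.coeff (Finsupp.sumFinsuppAddEquivProdFinsupp e).1
    (Weyl.val k n r (MvPolynomial.monomial c 1))) hg
  simp only [map_sum, LinearMap.sum_apply, MvPolynomial.coeff_sum, map_zero, LinearMap.zero_apply,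
    MvPolynomial.coeff_zero, map_smul, LinearMap.smul_apply, MvPolynomial.coeff_smul] at h1
  rw [Finset.sum_eq_single_of_mem e hes] at h1
  · obtain ⟨t, ht, h⟩ := weylPair_β_monomial_apply (k := k) c c
    rw [WeylPair.mon, map_mul, Module.End.mul_apply, ← hc, h, weylPair_α, Weyl.val_ofPoly,
      MvPolynomial.monomial_mul, MvPolynomial.coeff_monomial, tsub_self, add_zero, if_pos rfl,
      one_mul, smul_eq_mul] at h1
    exact mul_ne_zero hge (ht.2 le_rfl) h1
  · intro f hfs hfe
    by_cases hgf : g f = 0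
    · rw [hgf, zero_smul]
    obtain ⟨t, ht, h⟩ := weylPair_β_monomial_apply (k := k)
      (Finsupp.sumFinsuppAddEquivProdFinsupp f).2 c
    rw [WeylPair.mon, map_mul, Module.End.mul_apply, h, weylPair_α, Weyl.val_ofPoly,
      MvPolynomial.monomial_mul, MvPolynomial.coeff_monomial, one_mul]
    split_ifs with hif
    · by_cases ht0 : t = 0
      · rw [ht0, smul_zero]
      · exfalso
        have hle := ht.1 ht0
        have hdeg := hmin f (Finset.mem_filter.2 ⟨hfs, hgf⟩)
        have heq : (Finsupp.sumFinsuppAddEquivProdFinsupp f).2 = c := by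
          have h2 := congrArg Finsupp.degree (add_tsub_cancel_of_le hle)
          rw [map_add] at h2
          have h3 : (c - (Finsupp.sumFinsuppAddEquivProdFinsupp f).2).degree = 0 := by omega
          rw [Finsupp.degree_eq_zero_iff] at h3
          exact le_antisymm hle (tsub_eq_zero_iff_le.1 h3)
        rw [heq, tsub_self, add_zero] at hif
        exact hfe (Finsupp.sumFinsuppAddEquivProdFinsupp.injective (Prod.ext hif (heq.trans hc)))
    · rw [smul_zero]

instance finiteDimensional_degSpan {V : Type*} [AddCommGroup V] [Module k V] {σ : Type*} [Finite σ]
    (w : (σ →₀ ℕ) → V) (m : ℕ) : FiniteDimensional k (degSpan k w m) :=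
  FiniteDimensional.span_of_finite k ((finite_degree_le σ m).image w)

theorem finrank_degSpan_of_linearIndependent {V : Type*} [AddCommGroup V] [Module k V]
    {σ : Type*} [Finite σ] {w : (σ →₀ ℕ) → V} (hw : LinearIndependent k w) (m : ℕ) :
    Module.finrank k (degSpan k w m) = ballCard (Set.univ : Set (σ →₀ ℕ)) m := by
  let _ := (finite_degree_le σ m).fintype
  have h := hw.comp (fun e : ↥{e : σ →₀ ℕ | e.degree ≤ m} => e.1) Subtype.val_injective
  rw [degSpan, Set.image_eq_range]
  refine (finrank_span_eq_card h).trans ?_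
  rw [ballCard, Set.univ_inter, Set.ncard_eq_toFinset_card', Set.toFinset_card]

/-- The number of exponents of degree at most `m` in `N` variables is at least of order `m ^ N`. -/
theorem le_ballCard_univ (σ : Type*) [Fintype σ] (m : ℕ) :
    (m + 1) ^ Fintype.card σ ≤ Fintype.card σ ^ Fintype.card σ *
      ballCard (Set.univ : Set (σ →₀ ℕ)) m := by
  classical
  set N := Fintype.card σ with hN
  -- The exponents all of whose components are at most `m / N` have degree at most `m`.
  let F : (σ → Fin (m / N + 1)) → (σ →₀ ℕ) := fun a =>
    Finsupp.equivFunOnFinite.symm fun i => (a i : ℕ)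
  have hF : Function.Injective F := fun a b hab => by
    ext i
    exact DFunLike.congr_fun hab i
  have hsub : Set.range F ⊆ Set.univ ∩ {e | e.degree ≤ m} := by
    rintro _ ⟨a, rfl⟩
    refine ⟨trivial, ?_⟩
    rw [Set.mem_ofPred_eq, Finsupp.degree_eq_sum]
    calc ∑ i, F a i ≤ ∑ _i : σ, m / N := Finset.sum_le_sum fun i _ => Nat.lt_succ_iff.1 (a i).2
      _ = N * (m / N) := by rw [Finset.sum_const, Finset.card_univ, smul_eq_mul]
      _ ≤ m := Nat.mul_div_le m N
  have hcard := Set.ncard_le_ncard hsub ((finite_degree_le σ m).subset Set.inter_subset_right)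
  rw [← Set.image_univ, Set.ncard_image_of_injective _ hF, Set.ncard_univ, Nat.card_eq_fintype_card,
    Fintype.card_fun, Fintype.card_fin] at hcard
  refine le_trans ?_ (Nat.mul_le_mul_left _ hcard)
  rw [← hN, ← mul_pow]
  rcases Nat.eq_zero_or_pos N with h0 | hpos
  · rw [h0]; simp
  · refine Nat.pow_le_pow_left ?_ _
    have := Nat.lt_mul_div_succ m hpos
    omega

/-- The Weyl algebra has centre `k`. -/
theorem weyl_center [CharZero k] (r : Weyl k n)
    (hα : ∀ i, r * (weylPair k n).α (MvPolynomial.X i) = (weylPair k n).α (MvPolynomial.X i) * r)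
    (hβ : ∀ i, r * (weylPair k n).β (MvPolynomial.X i) = (weylPair k n).β (MvPolynomial.X i) * r) :
    ∃ c : k, r = algebraMap k (Weyl k n) c := by
  have hf : ∀ f, r * Weyl.ofPoly k n f = Weyl.ofPoly k n f * r := by
    intro f
    induction f using MvPolynomial.induction_on with
    | C a =>
      rw [← MvPolynomial.algebraMap_eq, AlgHom.commutes]
      exact (Algebra.commutes a r).symm
    | add p q hp hq => rw [map_add, mul_add, add_mul, hp, hq]
    | mul_X p i hp =>
      have h1 := hα i
      rw [weylPair_α] at h1
      rw [map_mul, ← mul_assoc, hp, mul_assoc, h1, mul_assoc]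
  have h1 : ∀ f, Weyl.val k n r f = f * Weyl.val k n r 1 := fun f => by
    have h2 := congrArg (fun s => Weyl.val k n s 1) (hf f)
    simpa [Module.End.mul_apply, Weyl.val_ofPoly] using h2
  have h2 : ∀ i, MvPolynomial.pderiv i (Weyl.val k n r 1) = 0 := fun i => by
    have h3 := congrArg (fun s => Weyl.val k n s 1) (hβ i)
    simpa [Module.End.mul_apply, weylPair_β_X, Weyl.val_ofVect] using h3.symm
  have h3 : Weyl.val k n r 1 = MvPolynomial.C (MvPolynomial.coeff 0 (Weyl.val k n r 1)) := by
    ext e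
    rw [MvPolynomial.coeff_C]
    split_ifs with he
    · rw [he]
    · obtain ⟨i, hi⟩ := Finsupp.ne_iff.1 (Ne.symm he)
      have h4 := congrArg (MvPolynomial.coeff (e - Finsupp.single i 1)) (h2 i)
      rw [MvPolynomial.coeff_pderiv, MvPolynomial.coeff_zero, tsub_add_cancel_of_le
        (Finsupp.single_le_iff.2 (Nat.one_le_iff_ne_zero.2 hi))] at h4
      exact (mul_eq_zero.1 h4).resolve_right (Nat.cast_add_one_ne_zero _)
  refine ⟨MvPolynomial.coeff 0 (Weyl.val k n r 1),
    Weyl.val_injective k n (LinearMap.ext fun f => ?_)⟩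
  rw [h1, AlgHom.commutes, h3, MvPolynomial.coeff_C, if_pos rfl, mul_comm,
    ← MvPolynomial.smul_eq_C_mul]
  rfl

end WeylBasis

/-! ### The Bernstein filtration of a module over the Weyl algebra -/

section Orbit

variable {k : Type u} [Field k] {n : ℕ} {M : Type v} [AddCommGroup M] [Module k M]
  [Module (Weyl k n) M] [IsScalarTower k (Weyl k n) M]

variable (k n) in
/-- The subspace `B_m p` of a `𝓓`-module, where `B_m` is the `m`-th piece of the Bernstein
filtration of `𝓓`. -/
noncomputable def orbit (p : M) (m : ℕ) : Submodule k M :=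
  degSpan k (fun e => (weylPair k n).mon e • p) m

theorem mem_orbit {p q : M} {m : ℕ} :
    q ∈ orbit k n p m ↔ ∃ r ∈ degSpan k (weylPair k n).mon m, r • p = q := by
  have h : orbit k n p m = (degSpan k (weylPair k n).mon m).map
      ((LinearMap.toSpanSingleton (Weyl k n) M p).restrictScalars k) := by
    rw [orbit, degSpan, degSpan, Submodule.map_span, Set.image_image]
    rfl
  rw [h]
  rfl

instance finiteDimensional_orbit (p : M) (m : ℕ) : FiniteDimensional k (orbit k n p m) :=
  finiteDimensional_degSpan _ m

theorem smul_mem_orbit {r : Weyl k n} {p q : M} {m l : ℕ}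
    (hr : r ∈ degSpan k (weylPair k n).mon m) (hq : q ∈ orbit k n p l) :
    r • q ∈ orbit k n p (m + l) := by
  obtain ⟨s, hs, rfl⟩ := mem_orbit.1 hq
  exact mem_orbit.2 ⟨r * s, (weylPair k n).mul_mem_degSpan hr hs, mul_smul r s p⟩

theorem orbit_mono (p : M) {m l : ℕ} (h : m ≤ l) :
    orbit k n p m ≤ orbit k n p l := fun q hq => by
  obtain ⟨s, hs, rfl⟩ := mem_orbit.1 hq
  exact mem_orbit.2 ⟨s, (weylPair k n).degSpan_mono h hs, rfl⟩

theorem self_mem_orbit (p : M) (m : ℕ) : p ∈ orbit k n p m :=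
  mem_orbit.2 ⟨1, (weylPair k n).one_mem_degSpan m, one_smul _ p⟩

theorem orbit_le_orbit {p q : M} {s : ℕ} (h : q ∈ orbit k n p s) (m : ℕ) :
    orbit k n q m ≤ orbit k n p (m + s) := fun x hx => by
  obtain ⟨r, hr, rfl⟩ := mem_orbit.1 hx
  exact smul_mem_orbit hr h

/-- An operator of degree at most `m` which annihilates `B_m p` is zero: by induction on `m`, its
commutators with the `xᵢ` and the `∂ᵢ` vanish, so that it is central and hence a scalar. -/
theorem eq_zero_of_smul_orbit [CharZero k] {p : M} (hp : p ≠ 0) (m : ℕ) (r : Weyl k n)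
    (hr : r ∈ degSpan k (weylPair k n).mon m) (h : ∀ q ∈ orbit k n p m, r • q = 0) : r = 0 := by
  have hscalar : ∀ (m : ℕ) (c : k), (∀ q ∈ orbit k n p m, algebraMap k (Weyl k n) c • q = 0) →
      algebraMap k (Weyl k n) c = 0 := by
    intro m c hc
    have h1 := hc p (self_mem_orbit p m)
    rw [algebraMap_smul] at h1
    rw [(smul_eq_zero.1 h1).resolve_right hp, map_zero]
  induction m generalizing r with
  | zero =>
    have h0 : degSpan k (weylPair k n).mon 0 ≤
        LinearMap.range (Algebra.linearMap k (Weyl k n)) := by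
      refine (weylPair k n).degSpan_le fun e he => ?_
      have : e = 0 := (Finsupp.degree_eq_zero_iff e).1 (Nat.le_zero.1 he)
      rw [this, WeylPair.mon_zero]
      exact ⟨1, map_one (algebraMap k (Weyl k n))⟩
    obtain ⟨c, rfl⟩ := h0 hr
    exact hscalar 0 c h
  | succ m ih =>
    have hx : ∀ s : Weyl k n, s ∈ degSpan k (weylPair k n).mon 1 →
        ∀ q ∈ orbit k n p m, r • s • q = 0 := fun s hs q hq =>
      h _ (by rw [add_comm]; exact smul_mem_orbit hs hq)
    have h0 : ∀ q ∈ orbit k n p m, r • q = 0 := fun q hq => h q (orbit_mono p (Nat.le_succ m) hq)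
    have hα1 : ∀ i, (weylPair k n).α (MvPolynomial.X i) ∈ degSpan k (weylPair k n).mon 1 :=
      fun i => by simpa using (weylPair k n).α_X_mul_mem ((weylPair k n).one_mem_degSpan 0) i
    have hβ1 : ∀ i, (weylPair k n).β (MvPolynomial.X i) ∈ degSpan k (weylPair k n).mon 1 :=
      fun i => by simpa using (weylPair k n).β_X_mul_mem ((weylPair k n).one_mem_degSpan 0) i
    obtain ⟨c, rfl⟩ := weyl_center r
      (fun i => sub_eq_zero.1 (ih _ ((weylPair k n).commutator_α_X_mem hr i) fun q hq => by
        rw [sub_smul, mul_smul, mul_smul, hx _ (hα1 i) q hq, h0 q hq, smul_zero, sub_zero]))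
      (fun i => (sub_eq_zero.1 (ih _ ((weylPair k n).commutator_β_X_mem hr i) fun q hq => by
        rw [sub_smul, mul_smul, mul_smul, hx _ (hβ1 i) q hq, h0 q hq, smul_zero, sub_zero])).symm)
    exact hscalar _ c h

/-- Bernstein's inequality: the piece `B_m` of the Bernstein filtration embeds in
`Hom_k(B_m p, B_{2m} p)`. -/
theorem bernstein_inequality [CharZero k] {p : M} (hp : p ≠ 0) (m : ℕ) :
    (m + 1) ^ (2 * n) ≤ (2 * n) ^ (2 * n) *
      (Module.finrank k (orbit k n p m) * Module.finrank k (orbit k n p (2 * m))) := by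
  have hcard : Fintype.card (Fin n ⊕ Fin n) = 2 * n := by simp [two_mul]
  have h := le_ballCard_univ (Fin n ⊕ Fin n) m
  rw [hcard, ← finrank_degSpan_of_linearIndependent (linearIndependent_weyl_mon (k := k) (n := n))]
    at h
  refine h.trans (Nat.mul_le_mul_left _ ?_)
  have hmem : ∀ r : degSpan k (weylPair k n).mon m, ∀ q ∈ orbit k n p m,
      Algebra.lsmul k k M r.1 q ∈ orbit k n p (2 * m) := fun r q hq => by
    rw [two_mul]; exact smul_mem_orbit r.2 hq
  let Φ : degSpan k (weylPair k n).mon m →ₗ[k] orbit k n p m →ₗ[k] orbit k n p (2 * m) :=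
    { toFun := fun r => (Algebra.lsmul k k M r.1).restrict (hmem r)
      map_add' := fun r s => LinearMap.ext fun q => Subtype.ext (add_smul r.1 s.1 q.1)
      map_smul' := fun c r => LinearMap.ext fun q => Subtype.ext (smul_assoc c r.1 q.1) }
  have hΦ : Function.Injective Φ := by
    rw [injective_iff_map_eq_zero]
    intro r hr
    refine Subtype.ext (eq_zero_of_smul_orbit hp m r.1 r.2 fun q hq => ?_)
    exact congrArg Subtype.val (DFunLike.congr_fun hr ⟨q, hq⟩)
  have := LinearMap.finrank_le_finrank_of_injective hΦ
  rwa [Module.finrank_linearMap] at this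

end Orbit

/-! ### Cyclic modules of minimal growth over the Weyl algebra -/

section Artinian

variable {k : Type u} [Field k] {n : ℕ} {M : Type v} [AddCommGroup M] [Module k M]
  [Module (Weyl k n) M] [IsScalarTower k (Weyl k n) M]

/-- A lower bound for the growth of `𝓓 q`, whose constant depends only on that of an upper bound. -/
theorem orbit_lower_bound [CharZero k] {q : M} (hq : q ≠ 0) {C s : ℕ}
    (hC : ∀ m, Module.finrank k (orbit k n q m) ≤ C * (m + s + 1) ^ n) {m : ℕ} (hm : s ≤ m) :
    (m + 1) ^ n ≤ (2 * n) ^ (2 * n) * C * 3 ^ n * Module.finrank k (orbit k n q m) := by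
  have h : 2 * m + s + 1 ≤ 3 * (m + 1) := by omega
  refine le_of_mul_le_mul_right ?_ (by positivity : 0 < (m + 1) ^ n)
  calc (m + 1) ^ n * (m + 1) ^ n = (m + 1) ^ (2 * n) := by rw [← pow_add, two_mul]
    _ ≤ (2 * n) ^ (2 * n) * (Module.finrank k (orbit k n q m) *
        Module.finrank k (orbit k n q (2 * m))) := bernstein_inequality hq m
    _ ≤ (2 * n) ^ (2 * n) * (Module.finrank k (orbit k n q m) * (C * (3 * (m + 1)) ^ n)) := by
        gcongr
        exact (hC _).trans (by gcongr)
    _ = _ := by rw [mul_pow 3]; ring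

theorem orbit_map {M' : Type*} [AddCommGroup M'] [Module k M'] [Module (Weyl k n) M']
    [IsScalarTower k (Weyl k n) M'] (f : M →ₗ[Weyl k n] M') (q : M) (m : ℕ) :
    orbit k n (f q) m = (orbit k n q m).map (f.restrictScalars k) := by
  ext x
  simp only [Submodule.mem_map, mem_orbit]
  constructor
  · rintro ⟨r, hr, rfl⟩
    exact ⟨r • q, ⟨r, hr, rfl⟩, map_smul f r q⟩
  · rintro ⟨_, ⟨r, hr, rfl⟩, rfl⟩
    exact ⟨r, hr, (map_smul f r q).symm⟩

/-- The subquotient `N / N'` contributes at least the growth of the cyclic module generated by the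
class of `q ∈ N` to the growth of the ambient module. -/
theorem finrank_inf_add_finrank_orbit_le {N N' : Submodule (Weyl k n) M} (h : N' ≤ N) {q : M}
    (hq : q ∈ N) (V : Submodule k M) [FiniteDimensional k V] {m : ℕ} (hV : orbit k n q m ≤ V) :
    Module.finrank k ↥(V ⊓ N'.restrictScalars k) +
      Module.finrank k (orbit k n (N'.mkQ q) m) ≤
      Module.finrank k ↥(V ⊓ N.restrictScalars k) := by
  set U := V ⊓ N.restrictScalars k
  let g : U →ₗ[k] M ⧸ N' := (N'.mkQ.restrictScalars k).domRestrict U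
  have h1 := LinearMap.finrank_range_add_finrank_ker g
  have h2 : orbit k n (N'.mkQ q) m ≤ LinearMap.range g := by
    rw [orbit_map]
    rintro _ ⟨x, hx, rfl⟩
    obtain ⟨r, hr, rfl⟩ := mem_orbit.1 hx
    exact ⟨⟨r • q, hV hx, N.smul_mem r hq⟩, rfl⟩
  have h3 : Module.finrank k ↥(V ⊓ N'.restrictScalars k) ≤ Module.finrank k (LinearMap.ker g) := by
    have hsub : ∀ x : ↥(V ⊓ N'.restrictScalars k), g (Submodule.inclusion
        (inf_le_inf_left V h : V ⊓ N'.restrictScalars k ≤ U) x) = 0 := fun x =>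
      (Submodule.Quotient.mk_eq_zero N').2 x.2.2
    refine LinearMap.finrank_le_finrank_of_injective (f := (Submodule.inclusion
      (inf_le_inf_left V h : V ⊓ N'.restrictScalars k ≤ U)).codRestrict (LinearMap.ker g)
      hsub) fun x y hxy => ?_
    exact Subtype.ext (congrArg (fun z => z.1.1) hxy)
  have h4 := Submodule.finrank_mono h2
  omega

/-- A cyclic module over the Weyl algebra with growth of order at most `m ^ n` has no infinite
descending chain of submodules: each step contributes at least `c m ^ n` to the growth, where `c` is
the same for all steps. -/
theorem not_strictAnti_of_orbit_le [CharZero k] {p : M} {C : ℕ}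
    (hC : ∀ m, Module.finrank k (orbit k n p m) ≤ C * (m + 1) ^ n)
    (f : ℕ → Submodule (Weyl k n) M) (hf0 : f 0 ≤ Submodule.span (Weyl k n) {p}) :
    ¬ StrictAnti f := by
  intro hf
  have hex : ∀ i, ∃ q ∈ f i, q ∉ f (i + 1) := fun i =>
    SetLike.exists_of_lt (hf (Nat.lt_succ_self i))
  choose q hq hq' using hex
  have hs : ∀ i, ∃ s, q i ∈ orbit k n p s := fun i => by
    obtain ⟨r, hr⟩ := Submodule.mem_span_singleton.1 (hf0 (hf.antitone (Nat.zero_le i) (hq i)))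
    obtain ⟨s, hs⟩ := weyl_exists_mem_degSpan r
    exact ⟨s, mem_orbit.2 ⟨r, hs, hr⟩⟩
  choose s hs using hs
  set A := (2 * n) ^ (2 * n) * C * 3 ^ n with hA
  -- One step more than `A C 2 ^ n`, the number of steps that the growth of the whole module allows.
  let r := A * C * 2 ^ n + 1
  let S := (Finset.range r).sup s
  have hqS : ∀ i < r, q i ∈ orbit k n p S := fun i hi =>
    orbit_mono p (Finset.le_sup (Finset.mem_range.2 hi)) (hs i)
  have hlow : ∀ i < r, (S + 1) ^ n ≤
      A * Module.finrank k (orbit k n ((f (i + 1)).mkQ (q i)) S) := by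
    intro i hi
    refine orbit_lower_bound (s := S) ?_ (fun m => ?_) le_rfl
    · exact fun h => hq' i ((Submodule.Quotient.mk_eq_zero _).1 h)
    · rw [orbit_map]
      exact (Submodule.finrank_map_le _ _).trans
        ((Submodule.finrank_mono (orbit_le_orbit (hqS i hi) m)).trans (hC _))
  have hsum : ∀ j ≤ r, j * (S + 1) ^ n +
      A * Module.finrank k ↥(orbit k n p (S + S) ⊓ (f j).restrictScalars k) ≤
      A * Module.finrank k (orbit k n p (S + S)) := by
    intro j
    induction j with
    | zero =>
      intro _
      rw [zero_mul, zero_add]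
      exact Nat.mul_le_mul_left _ (Submodule.finrank_mono inf_le_left)
    | succ j ih =>
      intro hj
      have h1 := ih (by omega)
      have h2 := finrank_inf_add_finrank_orbit_le (hf.antitone (Nat.le_add_right j 1)) (hq j)
        (orbit k n p (S + S)) (orbit_le_orbit (hqS j (by omega)) S)
      have h3 := Nat.mul_le_mul_left A h2
      rw [mul_add] at h3
      have h4 := hlow j (by omega)
      rw [add_mul, one_mul]
      omega
  have h5 := hsum r le_rfl
  have h6 : A * Module.finrank k (orbit k n p (S + S)) ≤ A * C * 2 ^ n * (S + 1) ^ n := by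
    calc A * Module.finrank k (orbit k n p (S + S)) ≤ A * (C * (2 * (S + 1)) ^ n) := by
          gcongr
          exact (hC _).trans (by gcongr; omega)
      _ = _ := by rw [mul_pow]; ring
  have h7 : 0 < (S + 1) ^ n := by positivity
  have h8 : r * (S + 1) ^ n = A * C * 2 ^ n * (S + 1) ^ n + (S + 1) ^ n := by
    rw [add_mul, one_mul]
  omega

theorem exists_simple_submodule_of_orbit_le [CharZero k] {p : M} (hp : p ≠ 0) {C : ℕ}
    (hC : ∀ m, Module.finrank k (orbit k n p m) ≤ C * (m + 1) ^ n) :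
    ∃ S : Submodule (Weyl k n) M, IsSimpleModule (Weyl k n) S := by
  let N := Submodule.span (Weyl k n) {p}
  have hart : IsArtinian (Weyl k n) N := by
    refine ⟨(RelEmbedding.wellFounded_iff_isEmpty).2 ⟨fun e => ?_⟩⟩
    refine not_strictAnti_of_orbit_le hC (fun i => (e i).map N.subtype)
      (Submodule.map_subtype_le N _) fun i j hij => ?_
    exact Submodule.map_strictMono_of_injective N.injective_subtype (e.map_rel_iff.2 hij)
  have hnt : Nontrivial N := ⟨⟨⟨p, Submodule.mem_span_singleton_self p⟩, 0,
    fun h => hp (congrArg Subtype.val h)⟩⟩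
  obtain ⟨S, hS⟩ := IsAtomic.exists_atom (Submodule (Weyl k n) N)
  rw [← isSimpleModule_iff_isAtom] at hS
  exact ⟨S.map N.subtype, IsSimpleModule.congr
    (Submodule.equivMapOfInjective N.subtype N.injective_subtype S).symm⟩

end Artinian

/-! ### The Weyl algebra inside the smash product -/

section SmashStructure

variable (k : Type u) [Field k] (n : ℕ)

theorem AVAlg.mk_one_mul_mk {k : Type u} [Field k] {n : ℕ} (f g : Poly k n) (u : UVect k n) :
    AVAlg.mk f 1 * AVAlg.mk g u = AVAlg.mk (f * g) u := by
  have h : smashMul k n (f ⊗ₜ 1) (g ⊗ₜ u) = (f * g) ⊗ₜ u := by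
    rw [smashMul_tmul, map_one]
    rfl
  exact h

theorem AVAlg.mk_one_mul_one_mk {k : Type u} [Field k] {n : ℕ} (u v : UVect k n) :
    AVAlg.mk (1 : Poly k n) u * AVAlg.mk 1 v = AVAlg.mk 1 (u * v) := by
  have h : smashMul k n (1 ⊗ₜ u) (1 ⊗ₜ v) = 1 ⊗ₜ (u * v) := by
    have h1 := congrArg (smashMul k n (1 ⊗ₜ u)) (diagAct_one_tmul v)
    have h2 : smashMul k n (1 ⊗ₜ u) (1 ⊗ₜ v) = diagAct k n u (1 ⊗ₜ v) := by
      rw [smashMul_tmul, LinearMap.mulLeft_one, LinearMap.rTensor_id]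
      rfl
    rw [h2, ← diagAct_one_tmul v, ← Module.End.mul_apply, ← map_mul, diagAct_one_tmul]
  exact h

/-- The inclusion of `A` in the smash product. -/
noncomputable def AVAlg.ofPoly : Poly k n →ₐ[k] AVAlg k n :=
  AlgHom.ofLinearMap (B := AVAlg k n)
    { toFun := fun f => AVAlg.mk f 1
      map_add' := fun f g => TensorProduct.add_tmul f g (1 : UVect k n)
      map_smul' := fun c f => (TensorProduct.smul_tmul' c f (1 : UVect k n)).symm }
    rfl fun f g => (AVAlg.mk_one_mul_mk f g 1).symm

/-- The inclusion of `Der A` in the smash product. -/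
noncomputable def AVAlg.ofVect : Vect k n →ₗ⁅k⁆ AVAlg k n where
  toFun d := AVAlg.mk 1 (UniversalEnvelopingAlgebra.ι k d)
  map_add' d e := by
    rw [map_add]
    exact TensorProduct.tmul_add (1 : Poly k n) _ _
  map_smul' c d := by
    rw [map_smul]
    exact TensorProduct.tmul_smul c (1 : Poly k n) _
  map_lie' := fun {d e} => by
    rw [LieHom.map_lie, LieRing.of_associative_ring_bracket, LieRing.of_associative_ring_bracket,
      AVAlg.mk_one_mul_one_mk, AVAlg.mk_one_mul_one_mk]
    exact TensorProduct.tmul_sub (1 : Poly k n) _ _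

variable {k n}

theorem AVAlg.ofPoly_apply (f : Poly k n) : AVAlg.ofPoly k n f = AVAlg.mk f 1 := rfl

theorem AVAlg.ofVect_apply (d : Vect k n) :
    AVAlg.ofVect k n d = AVAlg.mk 1 (UniversalEnvelopingAlgebra.ι k d) := rfl

theorem AVAlg.ofVect_mul_ofPoly (d : Vect k n) (f : Poly k n) :
    AVAlg.ofVect k n d * AVAlg.ofPoly k n f =
      AVAlg.ofPoly k n (d f) + AVAlg.ofPoly k n f * AVAlg.ofVect k n d := by
  rw [ofVect_apply, ofPoly_apply, ofPoly_apply, mk_ι_mul_mk, mk_one_mul_mk, one_mul, one_mul,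
    mul_one, mul_one]

theorem AVAlg.adjoin_eq_top : Algebra.adjoin k (Set.range (AVAlg.ofPoly k n) ∪
    Set.range (AVAlg.ofVect k n)) = ⊤ := by
  set G := Algebra.adjoin k (Set.range (AVAlg.ofPoly k n) ∪ Set.range (AVAlg.ofVect k n))
  have hu : ∀ u : UVect k n, (AVAlg.mk 1 u : AVAlg k n) ∈ G := by
    intro u
    induction u using uvect_induction with
    | hc c =>
      have h : (AVAlg.mk 1 (algebraMap k (UVect k n) c) : AVAlg k n) = c • 1 := by
        rw [Algebra.algebraMap_eq_smul_one]
        exact TensorProduct.tmul_smul c (1 : Poly k n) (1 : UVect k n)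
      rw [h]
      exact G.smul_mem G.one_mem c
    | hι d => exact Algebra.subset_adjoin (Or.inr ⟨d, rfl⟩)
    | hm a b ha hb => rw [← AVAlg.mk_one_mul_one_mk]; exact G.mul_mem ha hb
    | ha a b ha hb =>
      have h : (AVAlg.mk 1 (a + b) : AVAlg k n) = AVAlg.mk 1 a + AVAlg.mk 1 b :=
        TensorProduct.tmul_add (1 : Poly k n) a b
      rw [h]
      exact G.add_mem ha hb
  refine eq_top_iff.2 fun a _ => ?_
  have h : ∀ t : Poly k n ⊗[k] UVect k n, (show AVAlg k n from t) ∈ G := by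
    intro t
    induction t with
    | zero => exact G.zero_mem
    | add x y hx hy => exact G.add_mem hx hy
    | tmul f u =>
      have h1 : (AVAlg.mk f 1 * AVAlg.mk 1 u : AVAlg k n) ∈ G :=
        G.mul_mem (Algebra.subset_adjoin (Or.inl ⟨f, rfl⟩)) (hu u)
      rw [AVAlg.mk_one_mul_mk, mul_one] at h1
      exact h1
  exact h a

theorem AVAlg.ofVect_pderiv_comm (i j : Fin n) :
    AVAlg.ofVect k n (MvPolynomial.pderiv i) * AVAlg.ofVect k n (MvPolynomial.pderiv j) =
      AVAlg.ofVect k n (MvPolynomial.pderiv j) * AVAlg.ofVect k n (MvPolynomial.pderiv i) := by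
  have h2 := LieHom.map_lie (AVAlg.ofVect k n) (MvPolynomial.pderiv i) (MvPolynomial.pderiv j)
  rw [pderiv_lie_pderiv, map_zero, LieRing.of_associative_ring_bracket] at h2
  exact sub_eq_zero.1 h2.symm

variable (k n) in
/-- The elements `xᵢ # 1` and `1 # ∂ᵢ` of the smash product. -/
noncomputable def avPair : WeylPair k n (AVAlg k n) where
  α := AVAlg.ofPoly k n
  β := (exists_algHom_of_commute _ AVAlg.ofVect_pderiv_comm).choose
  comm i j := by
    rw [(exists_algHom_of_commute _ AVAlg.ofVect_pderiv_comm).choose_spec,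
      AVAlg.ofVect_mul_ofPoly, MvPolynomial.pderiv_X, add_comm, Pi.single_apply]
    congr 1
    by_cases hij : i = j
    · subst hij; simp
    · simp [hij, Ne.symm hij]

theorem avPair_β_X (i : Fin n) :
    (avPair k n).β (MvPolynomial.X i) = AVAlg.ofVect k n (MvPolynomial.pderiv i) :=
  (exists_algHom_of_commute _ AVAlg.ofVect_pderiv_comm).choose_spec i

variable (k n) in
/-- The homomorphism `f # d ↦ f d` from the smash product to the Weyl algebra. -/
noncomputable def AVAlg.toWeyl : AVAlg k n →ₐ[k] Weyl k n :=
  AVAlg.lift (Weyl.ofPoly k n) (Weyl.ofVect k n) Weyl.ofVect_mul_ofPoly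

theorem AVAlg.toWeyl_ofPoly (f : Poly k n) :
    AVAlg.toWeyl k n (AVAlg.ofPoly k n f) = Weyl.ofPoly k n f := by
  rw [ofPoly_apply, toWeyl, AVAlg.lift_mk, map_one, mul_one]

theorem AVAlg.toWeyl_ofVect (d : Vect k n) :
    AVAlg.toWeyl k n (AVAlg.ofVect k n d) = Weyl.ofVect k n d := by
  rw [ofVect_apply, toWeyl, AVAlg.lift_mk, map_one, one_mul,
    UniversalEnvelopingAlgebra.lift_ι_apply]

theorem AVAlg.toWeyl_mon (e : Fin n ⊕ Fin n →₀ ℕ) :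
    AVAlg.toWeyl k n ((avPair k n).mon e) = (weylPair k n).mon e := by
  have h1 : (AVAlg.toWeyl k n).comp (avPair k n).α = (weylPair k n).α :=
    AlgHom.ext fun f => AVAlg.toWeyl_ofPoly f
  have h2 : (AVAlg.toWeyl k n).comp (avPair k n).β = (weylPair k n).β := by
    refine MvPolynomial.algHom_ext fun i => ?_
    rw [AlgHom.comp_apply, avPair_β_X, AVAlg.toWeyl_ofVect, weylPair_β_X]
  rw [WeylPair.mon, WeylPair.mon, ← h1, ← h2, map_mul]
  rfl

/-- The homomorphism to the Weyl algebra is an isomorphism on the subalgebra generated by the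
`xᵢ # 1` and the `1 # ∂ᵢ`, because the normally ordered monomials span the latter and are mapped to
a basis. -/
theorem AVAlg.exists_ofWeyl [CharZero k] : ∃ θ : Weyl k n →ₐ[k] AVAlg k n,
    (∀ f, θ (Weyl.ofPoly k n f) = AVAlg.ofPoly k n f) ∧
    ∀ i, θ (Weyl.ofVect k n (MvPolynomial.pderiv i)) =
      AVAlg.ofVect k n (MvPolynomial.pderiv i) := by
  set T := Algebra.adjoin k (Set.range (fun i => (avPair k n).α (MvPolynomial.X i)) ∪
      Set.range (fun i => (avPair k n).β (MvPolynomial.X i)))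
  let π := (AVAlg.toWeyl k n).comp T.val
  have hα : ∀ i, (avPair k n).α (MvPolynomial.X i) ∈ T := fun i =>
    Algebra.subset_adjoin (Or.inl ⟨i, rfl⟩)
  have hβ : ∀ i, (avPair k n).β (MvPolynomial.X i) ∈ T := fun i =>
    Algebra.subset_adjoin (Or.inr ⟨i, rfl⟩)
  have hπα : ∀ i, π ⟨_, hα i⟩ = (weylPair k n).α (MvPolynomial.X i) := fun i =>
    AVAlg.toWeyl_ofPoly _
  have hπβ : ∀ i, π ⟨_, hβ i⟩ = (weylPair k n).β (MvPolynomial.X i) := fun i => by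
    change AVAlg.toWeyl k n ((avPair k n).β (MvPolynomial.X i)) = _
    rw [avPair_β_X, AVAlg.toWeyl_ofVect, weylPair_β_X]
  have hinj : Function.Injective π := by
    rw [injective_iff_map_eq_zero]
    rintro ⟨t, ht⟩ h
    obtain ⟨m, hm⟩ := (avPair k n).mem_degSpan_of_mem_adjoin ht
    have h1 : t ∈ Submodule.span k (Set.range (avPair k n).mon) :=
      Submodule.span_mono (Set.image_subset_range _ _) hm
    obtain ⟨c, rfl⟩ := Finsupp.mem_span_range_iff_exists_finsupp.1 h1
    have h2 : AVAlg.toWeyl k n (c.sum fun i a => a • (avPair k n).mon i) = 0 := h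
    rw [Finsupp.sum, map_sum] at h2
    simp only [map_smul, AVAlg.toWeyl_mon] at h2
    have h3 : c = 0 := linearIndependent_iff.1 linearIndependent_weyl_mon c h2
    subst h3
    exact Subtype.ext (by simp)
  have hsurj : Function.Surjective π := by
    rw [← AlgHom.range_eq_top, eq_top_iff, ← weyl_adjoin_eq_top]
    refine Algebra.adjoin_le ?_
    rintro _ (⟨i, rfl⟩ | ⟨i, rfl⟩)
    · exact ⟨_, hπα i⟩
    · exact ⟨_, hπβ i⟩
  let E := AlgEquiv.ofBijective π ⟨hinj, hsurj⟩
  have hEα : ∀ i, E.symm ((weylPair k n).α (MvPolynomial.X i)) = ⟨_, hα i⟩ := fun i => by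
    rw [AlgEquiv.symm_apply_eq]; exact (hπα i).symm
  have hEβ : ∀ i, E.symm ((weylPair k n).β (MvPolynomial.X i)) = ⟨_, hβ i⟩ := fun i => by
    rw [AlgEquiv.symm_apply_eq]; exact (hπβ i).symm
  let θ : Weyl k n →ₐ[k] AVAlg k n := T.val.comp E.symm.toAlgHom
  have hθ : θ.comp (Weyl.ofPoly k n) = AVAlg.ofPoly k n :=
    MvPolynomial.algHom_ext fun i => congrArg Subtype.val (hEα i)
  refine ⟨θ, fun f => DFunLike.congr_fun hθ f, fun i => ?_⟩
  rw [← weylPair_β_X, ← avPair_β_X]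
  exact congrArg Subtype.val (hEβ i)

variable (k n) in
/-- The embedding of the Weyl algebra in the smash product, with `xᵢ ↦ xᵢ # 1` and
`∂ᵢ ↦ 1 # ∂ᵢ`. -/
noncomputable def AVAlg.ofWeyl [CharZero k] : Weyl k n →ₐ[k] AVAlg k n :=
  (AVAlg.exists_ofWeyl (k := k) (n := n)).choose

theorem AVAlg.ofWeyl_ofPoly [CharZero k] (f : Poly k n) :
    AVAlg.ofWeyl k n (Weyl.ofPoly k n f) = AVAlg.ofPoly k n f :=
  (AVAlg.exists_ofWeyl (k := k) (n := n)).choose_spec.1 f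

theorem AVAlg.ofWeyl_ofVect_pderiv [CharZero k] (i : Fin n) :
    AVAlg.ofWeyl k n (Weyl.ofVect k n (MvPolynomial.pderiv i)) =
      AVAlg.ofVect k n (MvPolynomial.pderiv i) :=
  (AVAlg.exists_ofWeyl (k := k) (n := n)).choose_spec.2 i

end SmashStructure

/-! ### The Lie algebra of vanishing vector fields inside the smash product -/

section PolyVect

variable (k : Type u) [Field k] (n : ℕ)

/-- The linear map `A ⊗ Der A → A # U(Der A)`, `f ⊗ d ↦ f # d`. -/
noncomputable def polyVectIncl : Poly k n ⊗[k] Vect k n →ₗ[k] AVAlg k n :=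
  TensorProduct.lift ((LinearMap.mul k (AVAlg k n)).compl₁₂ (AVAlg.ofPoly k n).toLinearMap
    (AVAlg.ofVect k n : Vect k n →ₗ[k] AVAlg k n))

/-- The linear map `A ⊗ Der A → Der A`, `f ⊗ d ↦ f d`. -/
noncomputable def polyVectAct : Poly k n ⊗[k] Vect k n →ₗ[k] Vect k n :=
  TensorProduct.lift (LinearMap.lsmul (Poly k n) (Vect k n) |>.restrictScalars₁₂ k k)

/-- The `A`-bilinear extension of the bracket of `Der A` to `A ⊗ Der A`. -/
noncomputable def polyVectBracket : Poly k n ⊗[k] Vect k n →ₗ[k] Poly k n ⊗[k] Vect k n →ₗ[k]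
    Poly k n ⊗[k] Vect k n :=
  TensorProduct.map₂ (LinearMap.mul k (Poly k n))
    (LieModule.toEnd k (Vect k n) (Vect k n) : Vect k n →ₗ[k] Module.End k (Vect k n))

/-- The `A`-linear extension of the action of `Der k[X]` on `k[X]` to an action of `A ⊗ Der k[X]`
on `A ⊗ k[X]`. -/
noncomputable def polyVectHat :
    Poly k n ⊗[k] Vect k n →ₗ[k] Module.End k (Poly k n ⊗[k] Poly k n) :=
  TensorProduct.lift
    ((TensorProduct.mapBilinear (.id k) (Poly k n) (Poly k n) (Poly k n) (Poly k n)).compl₁₂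
      (Algebra.lmul k (Poly k n)).toLinearMap
      { toFun := fun d : Vect k n => (d : Poly k n →ₗ[k] Poly k n)
        map_add' := fun _ _ => rfl
        map_smul' := fun _ _ => rfl })

/-- The `i`-th coefficient of an element of `A ⊗ Der k[X]`. -/
noncomputable def polyVectCoeff (i : Fin n) :
    Poly k n ⊗[k] Vect k n →ₗ[k] Poly k n ⊗[k] Poly k n :=
  LinearMap.lTensor (Poly k n)
    { toFun := fun d : Vect k n => d (MvPolynomial.X i)
      map_add' := fun _ _ => rfl
      map_smul' := fun _ _ => rfl }

/-- The homomorphism `f(X) ↦ f(X - x)`, where `x` and `X` are the variables of the left and of the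
right tensor factor. -/
noncomputable def antiTaylor : Poly k n →ₐ[k] Poly k n ⊗[k] Poly k n :=
  MvPolynomial.aeval fun i => 1 ⊗ₜ MvPolynomial.X i - MvPolynomial.X i ⊗ₜ 1

/-- The translation by `x` of vector fields in `X`, `∑ gᵢ(X) ∂/∂Xᵢ ↦ ∑ gᵢ(X - x) ∂/∂Xᵢ`: the
coefficients in `x` are the left tensor factors. -/
noncomputable def antiTaylorVect : Vect k n →ₗ[k] Poly k n ⊗[k] Vect k n where
  toFun d := ∑ i, LinearMap.lTensor (Poly k n)
    ((LinearMap.toSpanSingleton (Poly k n) (Vect k n) (MvPolynomial.pderiv i)).restrictScalars k)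
      (antiTaylor k n (d (MvPolynomial.X i)))
  map_add' d e := by simp [Finset.sum_add_distrib]
  map_smul' c d := by simp [Finset.smul_sum]

variable {k n}

theorem polyVectIncl_tmul (f : Poly k n) (d : Vect k n) :
    polyVectIncl k n (f ⊗ₜ d) = AVAlg.ofPoly k n f * AVAlg.ofVect k n d := rfl

theorem polyVectAct_tmul (f : Poly k n) (d : Vect k n) :
    polyVectAct k n (f ⊗ₜ d) = f • d := rfl

theorem polyVectBracket_tmul (a b : Poly k n) (d e : Vect k n) :
    polyVectBracket k n (a ⊗ₜ d) (b ⊗ₜ e) = (a * b) ⊗ₜ ⁅d, e⁆ := rfl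

theorem polyVectHat_tmul (a b g : Poly k n) (d : Vect k n) :
    polyVectHat k n (a ⊗ₜ d) (b ⊗ₜ g) = (a * b) ⊗ₜ (d g) := rfl

theorem polyVectCoeff_tmul (i : Fin n) (a : Poly k n) (d : Vect k n) :
    polyVectCoeff k n i (a ⊗ₜ d) = a ⊗ₜ d (MvPolynomial.X i) := rfl

theorem antiTaylor_X (i : Fin n) : antiTaylor k n (MvPolynomial.X i) =
    1 ⊗ₜ MvPolynomial.X i - MvPolynomial.X i ⊗ₜ 1 :=
  MvPolynomial.aeval_X _ i

end PolyVect

section PolyVectLemmas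

variable {k : Type u} [Field k] {n : ℕ}

theorem polyVectCoeff_injective {s t : Poly k n ⊗[k] Vect k n}
    (h : ∀ i, polyVectCoeff k n i s = polyVectCoeff k n i t) : s = t := by
  let j : Vect k n →ₗ[k] (Fin n → Poly k n) :=
    { toFun := fun d i => d (MvPolynomial.X i)
      map_add' := fun _ _ => rfl
      map_smul' := fun _ _ => rfl }
  have hj : Function.Injective j := fun d e hde =>
    MvPolynomial.derivation_ext fun i => congrFun hde i
  apply Module.Flat.lTensor_preserves_injective_linearMap (M := Poly k n) j hj
  apply (TensorProduct.piRight k k (Poly k n) (fun _ : Fin n => Poly k n)).injective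
  have hc : ∀ t i, TensorProduct.piRight k k (Poly k n) (fun _ : Fin n => Poly k n)
      (j.lTensor (Poly k n) t) i = polyVectCoeff k n i t := by
    intro t i
    induction t with
    | zero => simp
    | add x y hx hy => simp only [map_add, Pi.add_apply, hx, hy]
    | tmul a l => rfl
  ext1 i
  rw [hc, hc, h i]

theorem polyVectHat_mul (s : Poly k n ⊗[k] Vect k n) (x y : Poly k n ⊗[k] Poly k n) :
    polyVectHat k n s (x * y) = x * polyVectHat k n s y + polyVectHat k n s x * y := by
  induction s with
  | zero => simp
  | add a b ha hb => simp only [map_add, LinearMap.add_apply, ha, hb]; ring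
  | tmul a d =>
    induction x with
    | zero => simp
    | add x x' hx hx' => simp only [add_mul, map_add, hx, hx']; ring
    | tmul b g =>
      induction y with
      | zero => simp
      | add y y' hy hy' => simp only [mul_add, map_add, hy, hy']; ring
      | tmul c h =>
        simp only [Algebra.TensorProduct.tmul_mul_tmul, polyVectHat_tmul, Derivation.leibniz,
          smul_eq_mul, TensorProduct.tmul_add]
        rw [mul_left_comm b a c, mul_assoc a b c, mul_comm (d g) h]

theorem polyVectHat_tmul_one (s : Poly k n ⊗[k] Vect k n) (a : Poly k n) :
    polyVectHat k n s (a ⊗ₜ 1) = 0 := by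
  induction s with
  | zero => simp
  | add x y hx hy => simp [hx, hy]
  | tmul b l => simp [polyVectHat_tmul]

theorem polyVectHat_one_tmul_X (s : Poly k n ⊗[k] Vect k n) (i : Fin n) :
    polyVectHat k n s (1 ⊗ₜ MvPolynomial.X i) = polyVectCoeff k n i s := by
  induction s with
  | zero => simp
  | add x y hx hy => simp [hx, hy]
  | tmul b l => simp [polyVectHat_tmul, polyVectCoeff_tmul]

theorem polyVectCoeff_bracket (s t : Poly k n ⊗[k] Vect k n) (i : Fin n) :
    polyVectCoeff k n i (polyVectBracket k n s t) =
      polyVectHat k n s (polyVectCoeff k n i t) - polyVectHat k n t (polyVectCoeff k n i s) := by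
  induction s with
  | zero => simp
  | add x y hx hy => simp only [map_add, LinearMap.add_apply, hx, hy]; abel
  | tmul a l =>
    induction t with
    | zero => simp
    | add x y hx hy => simp only [map_add, LinearMap.add_apply, hx, hy]; abel
    | tmul b l' =>
      rw [polyVectBracket_tmul, polyVectCoeff_tmul, polyVectCoeff_tmul, polyVectCoeff_tmul,
        polyVectHat_tmul, polyVectHat_tmul, mul_comm b a, ← TensorProduct.tmul_sub,
        Derivation.commutator_apply]

theorem polyVectCoeff_rTensor (d : Vect k n) (t : Poly k n ⊗[k] Vect k n) (i : Fin n) :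
    polyVectCoeff k n i (LinearMap.rTensor (Vect k n) (d : Poly k n →ₗ[k] Poly k n) t) =
      LinearMap.rTensor (Poly k n) (d : Poly k n →ₗ[k] Poly k n) (polyVectCoeff k n i t) := by
  induction t with
  | zero => simp
  | add x y hx hy => simp only [map_add, hx, hy]
  | tmul b l => rfl

theorem polyVectCoeff_antiTaylorVect (d : Vect k n) (i : Fin n) :
    polyVectCoeff k n i (antiTaylorVect k n d) = antiTaylor k n (d (MvPolynomial.X i)) := by
  have h : ∀ (p : Fin n) (t : Poly k n ⊗[k] Poly k n), polyVectCoeff k n i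
      (LinearMap.lTensor (Poly k n) ((LinearMap.toSpanSingleton (Poly k n) (Vect k n)
        (MvPolynomial.pderiv p)).restrictScalars k) t) = if p = i then t else 0 := by
    intro p t
    induction t with
    | zero => simp
    | add x y hx hy => simp only [map_add, hx, hy]; split_ifs <;> simp
    | tmul a g =>
      rw [LinearMap.lTensor_tmul, polyVectCoeff_tmul]
      change a ⊗ₜ (g • MvPolynomial.pderiv p (MvPolynomial.X i) : Poly k n) = _
      rw [MvPolynomial.pderiv_X, Pi.single_apply]
      by_cases hpi : p = i
      · subst hpi; simp
      · simp [hpi, Ne.symm hpi]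
  have h' : antiTaylorVect k n d = ∑ p, LinearMap.lTensor (Poly k n)
      ((LinearMap.toSpanSingleton (Poly k n) (Vect k n)
        (MvPolynomial.pderiv p)).restrictScalars k)
          (antiTaylor k n (d (MvPolynomial.X p))) := rfl
  rw [h', map_sum]
  simp only [h, Finset.sum_ite_eq', Finset.mem_univ, if_true]

theorem polyVectHat_antiTaylorVect (d : Vect k n) (f : Poly k n) :
    polyVectHat k n (antiTaylorVect k n d) (antiTaylor k n f) = antiTaylor k n (d f) := by
  induction f using MvPolynomial.induction_on with
  | C a =>
    have h : antiTaylor k n (MvPolynomial.C a) = MvPolynomial.C a ⊗ₜ 1 :=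
      MvPolynomial.aeval_C _ a
    rw [h, polyVectHat_tmul_one]
    simp
  | add p q hp hq => simp only [map_add, hp, hq]
  | mul_X p i hp =>
    rw [map_mul, polyVectHat_mul, hp, antiTaylor_X, map_sub, polyVectHat_one_tmul_X,
      polyVectHat_tmul_one, sub_zero, polyVectCoeff_antiTaylorVect, Derivation.leibniz,
      smul_eq_mul, smul_eq_mul, map_add, map_mul, map_mul, antiTaylor_X]
    ring

theorem antiTaylorVect_lie (d e : Vect k n) :
    antiTaylorVect k n ⁅d, e⁆ =
      polyVectBracket k n (antiTaylorVect k n d) (antiTaylorVect k n e) := by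
  refine polyVectCoeff_injective fun i => ?_
  rw [polyVectCoeff_bracket]
  simp only [polyVectCoeff_antiTaylorVect, polyVectHat_antiTaylorVect,
    Derivation.commutator_apply, map_sub]

/-- A translated vector field `∑ gᵢ(X - x) ∂/∂Xᵢ` is invariant under simultaneous translations of
`x` and `X`. -/
theorem antiTaylorVect_invariant (d : Vect k n) (j : Fin n) :
    LinearMap.rTensor (Vect k n) ((MvPolynomial.pderiv j : Vect k n) : Poly k n →ₗ[k] Poly k n)
        (antiTaylorVect k n d) +
      polyVectBracket k n (1 ⊗ₜ MvPolynomial.pderiv j) (antiTaylorVect k n d) = 0 := by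
  have key : ∀ f : Poly k n, LinearMap.rTensor (Poly k n)
      ((MvPolynomial.pderiv j : Vect k n) : Poly k n →ₗ[k] Poly k n) (antiTaylor k n f) +
      polyVectHat k n (1 ⊗ₜ MvPolynomial.pderiv j) (antiTaylor k n f) = 0 := by
    intro f
    induction f using MvPolynomial.induction_on with
    | C a =>
      have h : antiTaylor k n (MvPolynomial.C a) = MvPolynomial.C a ⊗ₜ 1 :=
        MvPolynomial.aeval_C _ a
      rw [h, polyVectHat_tmul_one]
      simp
    | add p q hp hq =>
      rw [map_add, map_add, map_add, add_add_add_comm, hp, hq, add_zero]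
    | mul_X p i hp =>
      have h2 : LinearMap.rTensor (Poly k n)
          ((MvPolynomial.pderiv j : Vect k n) : Poly k n →ₗ[k] Poly k n)
            (antiTaylor k n (MvPolynomial.X i)) +
          polyVectHat k n (1 ⊗ₜ MvPolynomial.pderiv j) (antiTaylor k n (MvPolynomial.X i)) = 0 := by
        rw [antiTaylor_X, map_sub, map_sub, polyVectHat_tmul_one, polyVectHat_tmul,
          LinearMap.rTensor_tmul, LinearMap.rTensor_tmul]
        by_cases hij : i = j
        · subst hij; simp
        · simp [MvPolynomial.pderiv_X_of_ne hij]
      rw [map_mul, rTensor_mul, polyVectHat_mul]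
      linear_combination (antiTaylor k n p) * h2 + antiTaylor k n (MvPolynomial.X i) * hp
  refine polyVectCoeff_injective fun i => ?_
  have hc : polyVectHat k n (antiTaylorVect k n d)
      (polyVectCoeff k n i (1 ⊗ₜ MvPolynomial.pderiv j)) = 0 := by
    rw [polyVectCoeff_tmul, MvPolynomial.pderiv_X, Pi.single_apply]
    split_ifs
    · exact polyVectHat_tmul_one _ _
    · simp
  rw [map_add, polyVectCoeff_rTensor, polyVectCoeff_bracket, hc, sub_zero,
    polyVectCoeff_antiTaylorVect, key, map_zero]

theorem polyVectAct_apply_X (s : Poly k n ⊗[k] Vect k n) (i : Fin n) :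
    polyVectAct k n s (MvPolynomial.X i) =
      LinearMap.mul' k (Poly k n) (polyVectCoeff k n i s) := by
  induction s with
  | zero => simp
  | add x y hx hy => simp only [map_add, Derivation.add_apply, hx, hy]
  | tmul a d => rfl

/-- A vector field vanishing at the origin, translated by `x`, vanishes at `X = x`. -/
theorem polyVectAct_antiTaylorVect {d : Vect k n} (hd : d ∈ LPlus k n) :
    polyVectAct k n (antiTaylorVect k n d) = 0 := by
  have h : ∀ f : Poly k n, Algebra.TensorProduct.lmul' k (antiTaylor k n f) =
      MvPolynomial.C (MvPolynomial.constantCoeff f) := by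
    intro f
    induction f using MvPolynomial.induction_on with
    | C a =>
      have h : antiTaylor k n (MvPolynomial.C a) = MvPolynomial.C a ⊗ₜ 1 :=
        MvPolynomial.aeval_C _ a
      rw [h, Algebra.TensorProduct.lmul'_apply_tmul]
      simp
    | add p q hp hq => simp only [map_add, hp, hq]
    | mul_X p i hp =>
      rw [map_mul, map_mul, antiTaylor_X, map_sub, Algebra.TensorProduct.lmul'_apply_tmul,
        Algebra.TensorProduct.lmul'_apply_tmul]
      simp
  refine MvPolynomial.derivation_ext fun i => ?_
  rw [polyVectAct_apply_X, polyVectCoeff_antiTaylorVect]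
  refine (h _).trans ?_
  rw [MvPolynomial.constantCoeff_eq, coeff_zero_of_mem ((mem_LPlus d).1 hd _), map_zero]
  rfl

theorem polyVectIncl_mul_ofPoly (s : Poly k n ⊗[k] Vect k n) (g : Poly k n) :
    polyVectIncl k n s * AVAlg.ofPoly k n g =
      AVAlg.ofPoly k n (polyVectAct k n s g) + AVAlg.ofPoly k n g * polyVectIncl k n s := by
  induction s with
  | zero => simp
  | add x y hx hy =>
    simp only [map_add, Derivation.add_apply, add_mul, mul_add, hx, hy]; abel
  | tmul a d =>
    rw [polyVectIncl_tmul, polyVectAct_tmul, mul_assoc, AVAlg.ofVect_mul_ofPoly, mul_add,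
      ← map_mul, ← mul_assoc, ← mul_assoc, ← map_mul, ← map_mul, mul_comm a g]
    rfl

/-- The commutator in the smash product of two elements of `A ⊗ Der A`. -/
theorem polyVectIncl_commutator (s t : Poly k n ⊗[k] Vect k n) :
    polyVectIncl k n s * polyVectIncl k n t - polyVectIncl k n t * polyVectIncl k n s =
      polyVectIncl k n (LinearMap.rTensor (Vect k n)
        (polyVectAct k n s : Poly k n →ₗ[k] Poly k n) t +
        polyVectBracket k n s t -
        LinearMap.rTensor (Vect k n) (polyVectAct k n t : Poly k n →ₗ[k] Poly k n) s) := by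
  have hc : ∀ (s s' t : Poly k n ⊗[k] Vect k n), LinearMap.rTensor (Vect k n)
      (polyVectAct k n (s + s') : Poly k n →ₗ[k] Poly k n) t =
      LinearMap.rTensor (Vect k n) (polyVectAct k n s : Poly k n →ₗ[k] Poly k n) t +
      LinearMap.rTensor (Vect k n) (polyVectAct k n s' : Poly k n →ₗ[k] Poly k n) t := by
    intro s s' t
    rw [map_add, Derivation.coe_add_linearMap, LinearMap.rTensor_add, LinearMap.add_apply]
  induction s with
  | zero => simp
  | add x y hx hy =>
    rw [map_add, add_mul, mul_add, hc, map_add, LinearMap.add_apply,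
      map_add (LinearMap.rTensor _ _), add_sub_add_comm, hx, hy, ← map_add]
    congr 1
    abel
  | tmul a d =>
    induction t with
    | zero => simp
    | add x y hx hy =>
      rw [map_add, add_mul, mul_add, hc, map_add (polyVectBracket k n _),
        map_add (LinearMap.rTensor _ _), add_sub_add_comm, hx, hy, ← map_add]
      congr 1
      abel
    | tmul b e =>
      rw [map_sub, map_add, LinearMap.rTensor_tmul, LinearMap.rTensor_tmul, polyVectBracket_tmul,
        polyVectIncl_tmul, polyVectIncl_tmul, polyVectIncl_tmul, polyVectIncl_tmul,
        polyVectIncl_tmul, LieHom.map_lie, LieRing.of_associative_ring_bracket]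
      have h1 : ∀ (a b : Poly k n) (d e : Vect k n),
          AVAlg.ofPoly k n a * AVAlg.ofVect k n d * (AVAlg.ofPoly k n b * AVAlg.ofVect k n e) =
          AVAlg.ofPoly k n (polyVectAct k n (a ⊗ₜ d) b) * AVAlg.ofVect k n e +
            AVAlg.ofPoly k n (a * b) * (AVAlg.ofVect k n d * AVAlg.ofVect k n e) := by
        intro a b d e
        have h2 := polyVectIncl_mul_ofPoly (a ⊗ₜ d) b
        rw [polyVectIncl_tmul] at h2
        rw [← mul_assoc, h2, add_mul, ← mul_assoc (AVAlg.ofPoly k n b), ← map_mul, mul_comm b a,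
          mul_assoc (AVAlg.ofPoly k n (a * b))]
      rw [h1, h1, mul_comm b a, mul_sub]
      simp only [Derivation.coeFn_coe]
      abel

variable (k n) in
/-- The embedding of `𝓛₊` in the smash product,
`∑ gᵢ(X) ∂/∂Xᵢ ↦ ∑ gᵢ(X - x) ∂/∂Xᵢ`. -/
noncomputable def AVAlg.ofLPlus : LPlus k n →ₗ⁅k⁆ AVAlg k n where
  toFun l := polyVectIncl k n (antiTaylorVect k n l.1)
  map_add' l l' := by rw [← map_add, ← map_add]; rfl
  map_smul' c l := by rw [← map_smul, ← map_smul]; rfl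
  map_lie' := fun {l l'} => by
    have h := polyVectIncl_commutator (antiTaylorVect k n l.1) (antiTaylorVect k n l'.1)
    rw [polyVectAct_antiTaylorVect l.2, polyVectAct_antiTaylorVect l'.2,
      ← antiTaylorVect_lie] at h
    simp only [Derivation.coe_zero_linearMap, LinearMap.rTensor_zero, LinearMap.zero_apply,
      zero_add, sub_zero] at h
    exact h.symm

theorem AVAlg.ofLPlus_mul_ofPoly (l : LPlus k n) (g : Poly k n) :
    AVAlg.ofLPlus k n l * AVAlg.ofPoly k n g = AVAlg.ofPoly k n g * AVAlg.ofLPlus k n l := by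
  have h := polyVectIncl_mul_ofPoly (antiTaylorVect k n l.1) g
  rw [polyVectAct_antiTaylorVect l.2, Derivation.zero_apply, map_zero, zero_add] at h
  exact h

theorem AVAlg.ofLPlus_mul_ofVect_pderiv (l : LPlus k n) (j : Fin n) :
    AVAlg.ofLPlus k n l * AVAlg.ofVect k n (MvPolynomial.pderiv j) =
      AVAlg.ofVect k n (MvPolynomial.pderiv j) * AVAlg.ofLPlus k n l := by
  have h := polyVectIncl_commutator (1 ⊗ₜ MvPolynomial.pderiv j) (antiTaylorVect k n l.1)
  rw [polyVectAct_antiTaylorVect l.2, polyVectAct_tmul, one_smul, antiTaylorVect_invariant,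
    polyVectIncl_tmul, map_one, one_mul] at h
  simp only [Derivation.coe_zero_linearMap, LinearMap.rTensor_zero, LinearMap.zero_apply,
    sub_zero, map_zero] at h
  exact (sub_eq_zero.1 h).symm

/-- The images of the Weyl algebra and of `𝓛₊` in the smash product commute. -/
theorem AVAlg.ofLPlus_mul_ofWeyl [CharZero k] (l : LPlus k n) (r : Weyl k n) :
    AVAlg.ofLPlus k n l * AVAlg.ofWeyl k n r = AVAlg.ofWeyl k n r * AVAlg.ofLPlus k n l := by
  have hr : r ∈ Algebra.adjoin k (Set.range (fun i => (weylPair k n).α (MvPolynomial.X i)) ∪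
      Set.range (fun i => (weylPair k n).β (MvPolynomial.X i))) := by
    rw [weyl_adjoin_eq_top]; trivial
  induction hr using Algebra.adjoin_induction with
  | mem x hx =>
    rcases hx with ⟨i, rfl⟩ | ⟨i, rfl⟩
    · rw [weylPair_α, ofWeyl_ofPoly, ofLPlus_mul_ofPoly]
    · simp only [weylPair_β_X]
      rw [ofWeyl_ofVect_pderiv, ofLPlus_mul_ofVect_pderiv]
  | algebraMap c => rw [AlgHom.commutes]; exact (Algebra.commutes c _).symm
  | add x y _ _ hx hy => rw [map_add, mul_add, add_mul, hx, hy]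
  | mul x y _ _ hx hy => rw [map_mul, ← mul_assoc, hx, mul_assoc, hy, mul_assoc]

variable (k n) in
/-- The linear map `A ⊗ 𝓛₊ → A # U(Der A)`, the product of the two embeddings. -/
noncomputable def polyLPlusIncl : Poly k n ⊗[k] LPlus k n →ₗ[k] AVAlg k n :=
  TensorProduct.lift ((LinearMap.mul k (AVAlg k n)).compl₁₂ (AVAlg.ofPoly k n).toLinearMap
    (AVAlg.ofLPlus k n : LPlus k n →ₗ[k] AVAlg k n))

theorem polyLPlusIncl_tmul (f : Poly k n) (l : LPlus k n) :
    polyLPlusIncl k n (f ⊗ₜ l) = AVAlg.ofPoly k n f * AVAlg.ofLPlus k n l := rfl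

/-- Taylor's formula `f(X) = f(x + (X - x))` expresses a vector field through the embeddings of the
Weyl algebra and of `𝓛₊`. -/
theorem AVAlg.ofVect_eq [CharZero k] (d : Vect k n) :
    AVAlg.ofVect k n d =
      AVAlg.ofWeyl k n (Weyl.ofVect k n d) + polyLPlusIncl k n (taylorPart k n d) := by
  let Ψ : Poly k n ⊗[k] Poly k n →ₐ[k] Poly k n ⊗[k] Poly k n :=
    Algebra.TensorProduct.productMap Algebra.TensorProduct.includeLeft (antiTaylor k n)
  have hΨ : ∀ f g, Ψ (f ⊗ₜ g) = (f ⊗ₜ 1) * antiTaylor k n g := fun f g =>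
    Algebra.TensorProduct.productMap_apply_tmul _ _ f g
  have hΨt : ∀ f, Ψ (taylor k n f) = 1 ⊗ₜ f := by
    intro f
    have h : Ψ.comp (taylor k n) = Algebra.TensorProduct.includeRight := by
      refine MvPolynomial.algHom_ext fun i => ?_
      have h1 : taylor k n (MvPolynomial.X i) = MvPolynomial.X i ⊗ₜ 1 + 1 ⊗ₜ MvPolynomial.X i :=
        MvPolynomial.aeval_X _ i
      rw [AlgHom.comp_apply, h1, map_add, hΨ, hΨ, antiTaylor_X, map_one, mul_one,
        ← Algebra.TensorProduct.one_def, one_mul, add_sub_cancel]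
      rfl
    exact DFunLike.congr_fun h f
  -- The map `f ⊗ l ↦ f · l(X - x)`.
  let Λ : Poly k n ⊗[k] LPlus k n →ₗ[k] Poly k n ⊗[k] Vect k n :=
    TensorProduct.lift (((LinearMap.rTensorHom (Vect k n)).comp
      (Algebra.lmul k (Poly k n)).toLinearMap).compl₂
        ((antiTaylorVect k n).comp (LPlus k n).toSubmodule.subtype))
  have hΛ : ∀ f l, Λ (f ⊗ₜ l) =
      LinearMap.rTensor (Vect k n) (LinearMap.mulLeft k f) (antiTaylorVect k n l.1) :=
    fun f l => rfl
  have hcoeff : ∀ i f (t : Poly k n ⊗[k] Vect k n), polyVectCoeff k n i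
      (LinearMap.rTensor (Vect k n) (LinearMap.mulLeft k f) t) =
        (f ⊗ₜ 1) * polyVectCoeff k n i t := by
    intro i f t
    induction t with
    | zero => simp
    | add x y hx hy => simp only [map_add, mul_add, hx, hy]
    | tmul a e =>
      rw [LinearMap.rTensor_tmul, polyVectCoeff_tmul, polyVectCoeff_tmul,
        Algebra.TensorProduct.tmul_mul_tmul, one_mul]
      rfl
  have hΛc : ∀ i t, polyVectCoeff k n i (Λ t) = Ψ (comp k n i t) := by
    intro i t
    induction t with
    | zero => simp
    | add x y hx hy => simp only [map_add, hx, hy]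
    | tmul f l => rw [hΛ, hcoeff, polyVectCoeff_antiTaylorVect, comp_tmul, hΨ]
  have hJΛ : ∀ t, polyVectIncl k n (Λ t) = polyLPlusIncl k n t := by
    have hJ : ∀ f t, polyVectIncl k n (LinearMap.rTensor (Vect k n) (LinearMap.mulLeft k f) t) =
        AVAlg.ofPoly k n f * polyVectIncl k n t := by
      intro f t
      induction t with
      | zero => simp
      | add x y hx hy => simp only [map_add, mul_add, hx, hy]
      | tmul a e =>
        rw [LinearMap.rTensor_tmul, polyVectIncl_tmul, polyVectIncl_tmul, ← mul_assoc, ← map_mul]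
        rfl
    intro t
    induction t with
    | zero => simp
    | add x y hx hy => simp only [map_add, hx, hy]
    | tmul f l => rw [hΛ, hJ, polyLPlusIncl_tmul]; rfl
  have key : (1 : Poly k n) ⊗ₜ[k] d =
      (∑ i, d (MvPolynomial.X i) ⊗ₜ[k] (MvPolynomial.pderiv i : Vect k n)) +
        Λ (taylorPart k n d) := by
    refine polyVectCoeff_injective fun i => ?_
    rw [map_add, hΛc, comp_taylorPart, map_sub, hΨt, hΨ, map_one, mul_one, map_sum,
      Finset.sum_eq_single i]
    · rw [polyVectCoeff_tmul, polyVectCoeff_tmul, MvPolynomial.pderiv_X_self, add_sub_cancel]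
    · intro j _ hji
      rw [polyVectCoeff_tmul, MvPolynomial.pderiv_X_of_ne hji.symm, TensorProduct.tmul_zero]
    · intro h; exact absurd (Finset.mem_univ i) h
  have h := congrArg (polyVectIncl k n) key
  rw [map_add, hJΛ, polyVectIncl_tmul, map_one, one_mul, map_sum] at h
  rw [h]
  congr 1
  conv_rhs => rw [vect_eq_sum d]
  rw [map_sum, map_sum]
  refine Finset.sum_congr rfl fun i _ => ?_
  rw [Weyl.ofVect_smul, map_mul, ofWeyl_ofPoly, ofWeyl_ofVect_pderiv, polyVectIncl_tmul]

end PolyVectLemmas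

/-! ### Schur's lemma and operators on tensor products -/

section Schur

variable {k : Type u} [Field k] {R : Type w} [Ring R] [Algebra k R]
  {P : Type v} [AddCommGroup P] [Module k P] [Module R P] [IsScalarTower k R P]

/-- If `a` has empty spectrum, then its resolvents are linearly independent. -/
theorem linearIndependent_resolvent [IsAlgClosed k] [Nontrivial R] {a : R}
    (ha : spectrum k a = ∅) :
    LinearIndependent k fun c : k => resolvent a c := by
  classical
  have hu : ∀ c : k, IsUnit (algebraMap k R c - a) := fun c =>
    not_not.1 fun h => (ha ▸ (h : c ∈ spectrum k a) : c ∈ (∅ : Set k))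
  have hpoly : ∀ p : Polynomial k, p ≠ 0 → IsUnit (Polynomial.aeval a p) := by
    intro p hp
    have hlead : IsUnit (algebraMap k R p.leadingCoeff) :=
      (IsUnit.mk0 _ (Polynomial.leadingCoeff_ne_zero.2 hp)).map _
    rw [(IsAlgClosed.splits p).eq_prod_roots, map_mul, Polynomial.aeval_C]
    refine hlead.mul (not_not.1 fun hn => ?_)
    obtain ⟨c, hc, -⟩ := spectrum.exists_mem_of_not_isUnit_aeval_prod hn
    rw [ha] at hc
    exact hc
  refine linearIndependent_iff'.2 fun s m hm i hi => ?_
  -- Clear denominators.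
  let b : Finset k → Polynomial k := fun t =>
    t.prod fun j => Polynomial.C j - Polynomial.X
  have hb : ∀ j ∈ s, Polynomial.aeval a (b s) * resolvent a j =
      Polynomial.aeval a (b (s.erase j)) := by
    intro j hj
    have h1 : b s = b (s.erase j) * (Polynomial.C j - Polynomial.X) :=
      (Finset.prod_erase_mul _ _ hj).symm
    have h2 : (algebraMap k R j - a) * resolvent a j = 1 := Ring.mul_inverse_cancel _ (hu j)
    rw [h1, map_mul, map_sub, Polynomial.aeval_C, Polynomial.aeval_X, mul_assoc, h2, mul_one]
  let p : Polynomial k := s.sum fun j => m j • b (s.erase j)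
  have hp : p = 0 := by
    by_contra hne
    have h1 : Polynomial.aeval a p = 0 := by
      have h2 := congrArg (fun r => Polynomial.aeval a (b s) * r) hm
      simp only [Finset.mul_sum, mul_zero, mul_smul_comm] at h2
      rw [map_sum, ← h2]
      refine Finset.sum_congr rfl fun j hj => ?_
      rw [map_smul, hb j hj]
    exact not_isUnit_zero (h1 ▸ hpoly p hne)
  have h1 := congrArg (Polynomial.eval i) hp
  rw [Polynomial.eval_zero, Polynomial.eval_finsetSum, Finset.sum_eq_single_of_mem i hi] at h1
  · rw [Polynomial.eval_smul, smul_eq_mul, Polynomial.eval_prod] at h1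
    refine (mul_eq_zero.1 h1).resolve_right (Finset.prod_ne_zero_iff.2 fun j hj => ?_)
    simpa [sub_eq_zero] using Finset.ne_of_mem_erase hj
  · intro j _ hji
    rw [Polynomial.eval_smul, smul_eq_mul, Polynomial.eval_prod,
      Finset.prod_eq_zero (Finset.mem_erase.2 ⟨hji.symm, hi⟩) (by simp), mul_zero]

/-- **Schur's lemma** for simple modules of countable dimension over an uncountable algebraically
closed field. -/
theorem exists_eq_smul_of_rank_le_aleph0 [IsAlgClosed k] [Uncountable k] [IsSimpleModule R P]
    (hP : Module.rank k P ≤ Cardinal.aleph0) (f : P →ₗ[R] P) : ∃ c : k, ∀ p, f p = c • p := by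
  have := IsSimpleModule.nontrivial R P
  by_contra! hf
  have hbij : ∀ g : Module.End R P, g ≠ 0 → IsUnit g := fun g hg =>
    (Module.End.isUnit_iff g).2 (LinearMap.bijective_of_ne_zero hg)
  have hspec : spectrum k (f : Module.End R P) = ∅ := by
    refine Set.eq_empty_iff_forall_notMem.2 fun c hc => hc (hbij _ fun h0 => ?_)
    obtain ⟨p, hp⟩ := hf c
    apply hp
    have h1 := DFunLike.congr_fun h0 p
    exact (sub_eq_zero.1 h1).symm
  have hli := linearIndependent_resolvent hspec
  obtain ⟨p, hp⟩ := exists_ne (0 : P)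
  let ev : Module.End R P →ₗ[k] P :=
    { toFun := fun g => g p
      map_add' := fun _ _ => rfl
      map_smul' := fun _ _ => rfl }
  have hev : LinearMap.ker ev = ⊥ := by
    refine (LinearMap.ker_eq_bot').2 fun g hg => ?_
    by_contra hne
    have h1 := LinearMap.bijective_of_ne_zero hne
    exact hp (h1.1 (hg.trans (map_zero g).symm))
  have h1 := (hli.map' ev hev).cardinal_lift_le_rank
  have h2 : Cardinal.aleph0 < Cardinal.mk k := Cardinal.aleph0_lt_mk
  have h3 := h1.trans (Cardinal.lift_le.2 hP)
  rw [Cardinal.lift_aleph0, Cardinal.lift_le_aleph0] at h3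
  exact absurd h3 (not_le.2 h2)

end Schur

section TensorEnd

variable {k : Type u} [Field k] {R : Type w} [Ring R] [Algebra k R]
  {P : Type v} [AddCommGroup P] [Module k P] [Module R P] [IsScalarTower k R P]
  {Q : Type*} [AddCommGroup Q] [Module k Q]

variable (P) in
/-- The contraction `p ⊗ q ↦ φ(q) p`. -/
noncomputable def contractRight (φ : Q →ₗ[k] k) : P ⊗[k] Q →ₗ[k] P :=
  (TensorProduct.rid k P).toLinearMap ∘ₗ LinearMap.lTensor P φ

variable (Q) in
/-- The contraction `p ⊗ q ↦ ψ(p) q`. -/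
noncomputable def contractLeft (ψ : P →ₗ[k] k) : P ⊗[k] Q →ₗ[k] Q :=
  (TensorProduct.lid k Q).toLinearMap ∘ₗ LinearMap.rTensor Q ψ

theorem contractRight_tmul (φ : Q →ₗ[k] k) (p : P) (q : Q) :
    contractRight P φ (p ⊗ₜ q) = φ q • p := by
  simp [contractRight]

theorem contractLeft_tmul (ψ : P →ₗ[k] k) (p : P) (q : Q) :
    contractLeft Q ψ (p ⊗ₜ q) = ψ p • q := by
  simp [contractLeft]

theorem contractRight_smul (φ : Q →ₗ[k] k) (r : R) (x : P ⊗[k] Q) :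
    contractRight P φ (r • x) = r • contractRight P φ x := by
  induction x with
  | zero => simp
  | add x y hx hy => simp only [smul_add, map_add, hx, hy]
  | tmul p q =>
    rw [TensorProduct.smul_tmul', contractRight_tmul, contractRight_tmul, smul_comm]

theorem contractLeft_contractRight (φ : Q →ₗ[k] k) (ψ : P →ₗ[k] k) (x : P ⊗[k] Q) :
    φ (contractLeft Q ψ x) = ψ (contractRight P φ x) := by
  induction x with
  | zero => simp
  | add x y hx hy => simp only [map_add, hx, hy]
  | tmul p q =>
    rw [contractLeft_tmul, contractRight_tmul, map_smul, map_smul, smul_eq_mul, smul_eq_mul,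
      mul_comm]

theorem eq_of_contractRight_eq {x y : P ⊗[k] Q}
    (h : ∀ φ : Q →ₗ[k] k, contractRight P φ x = contractRight P φ y) : x = y := by
  classical
  let b := Module.Basis.ofVectorSpace k Q
  have hb : ∀ x i, TensorProduct.equivFinsuppOfBasisRight (M := P) b x i =
      contractRight P (b.coord i) x := by
    intro x i
    induction x with
    | zero => simp
    | add x y hx hy => simp only [map_add, Finsupp.add_apply, hx, hy]
    | tmul p q =>
      rw [contractRight_tmul, TensorProduct.equivFinsuppOfBasisRight_apply_tmul_apply]
      rfl
  apply (TensorProduct.equivFinsuppOfBasisRight (M := P) b).injective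
  ext i
  rw [hb, hb, h]

theorem exists_functional_eq_one [Nontrivial P] : ∃ (p : P) (ψ : P →ₗ[k] k), ψ p = 1 := by
  obtain ⟨p, hp⟩ := exists_ne (0 : P)
  obtain ⟨ψ, hψ⟩ := Module.Projective.exists_dual_eq_one k hp
  exact ⟨p, ψ, hψ⟩

/-- If `P` is a nonzero module all of whose endomorphisms are scalars, then a Lie algebra which acts
on `P ⊗ Q` by endomorphisms commuting with the operators on `P` acts through a representation on
`Q`. -/
theorem exists_lieHom_of_commute [Nontrivial P] (hP : ∀ f : P →ₗ[R] P, ∃ c : k, ∀ p, f p = c • p)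
    {L : Type*} [LieRing L] [LieAlgebra k L] (T : L →ₗ⁅k⁆ Module.End k (P ⊗[k] Q))
    (hT : ∀ l (r : R) x, T l (r • x) = r • T l x) :
    ∃ ρ : L →ₗ⁅k⁆ Module.End k Q, ∀ l p q, T l (p ⊗ₜ q) = p ⊗ₜ ρ l q := by
  obtain ⟨p₀, ψ, hψ⟩ := exists_functional_eq_one (k := k) (P := P)
  let ρ₀ : L → Module.End k Q := fun l => contractLeft Q ψ ∘ₗ T l ∘ₗ TensorProduct.mk k P Q p₀
  have hρ₀ : ∀ l q, ρ₀ l q = contractLeft Q ψ (T l (p₀ ⊗ₜ q)) := fun _ _ => rfl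
  have key : ∀ l p q, T l (p ⊗ₜ q) = p ⊗ₜ ρ₀ l q := by
    intro l p q
    refine eq_of_contractRight_eq fun φ => ?_
    let F : P →ₗ[R] P :=
      { toFun := fun p => contractRight P φ (T l (p ⊗ₜ q))
        map_add' := fun p p' => by rw [TensorProduct.add_tmul, map_add, map_add]
        map_smul' := fun r p => by
          rw [← TensorProduct.smul_tmul', hT, contractRight_smul, RingHom.id_apply] }
    obtain ⟨c, hc⟩ := hP F
    have hF : ∀ p, contractRight P φ (T l (p ⊗ₜ q)) = c • p := hc
    rw [hF, contractRight_tmul, hρ₀, contractLeft_contractRight, hF, map_smul, hψ, smul_eq_mul,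
      mul_one]
  refine ⟨{ toFun := ρ₀, map_add' := fun l l' => ?_, map_smul' := fun c l => ?_,
            map_lie' := fun {l l'} => ?_ }, key⟩
  · ext q
    simp [hρ₀]
  · ext q
    simp [hρ₀]
  · ext q
    rw [hρ₀, LieHom.map_lie, LieRing.of_associative_ring_bracket,
      LieRing.of_associative_ring_bracket,
      LinearMap.sub_apply, Module.End.mul_apply, Module.End.mul_apply, key, key, key, key, map_sub,
      contractLeft_tmul, contractLeft_tmul, hψ, one_smul, one_smul]
    rfl

end TensorEnd

/-! ### Finite-dimensional irreducible representations of the vanishing vector fields -/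

section FiniteDimensionalRep

variable (k : Type u) [Field k] (n : ℕ)

/-- The Euler vector field `∑ Xᵢ ∂/∂Xᵢ`. -/
noncomputable def euler : LPlus k n :=
  ⟨∑ i, (MvPolynomial.X i : Poly k n) • (MvPolynomial.pderiv i : Vect k n),
    sum_mem fun i _ => monomial_smul_mem_LPlus (by simp) _⟩

variable {k n}

theorem sum_vect_apply {ι : Type*} (s : Finset ι) (d : ι → Vect k n) (f : Poly k n) :
    (∑ i ∈ s, d i) f = ∑ i ∈ s, d i f := by
  have h := congrFun (map_sum (Derivation.coeFnAddMonoidHom (R := k) (A := Poly k n)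
    (M := Poly k n)) d s) f
  exact h.trans (Finset.sum_apply _ _ _)

theorem euler_monomial (m : Fin n →₀ ℕ) :
    (euler k n).1 (MvPolynomial.monomial m 1) = (m.degree : k) • MvPolynomial.monomial m 1 := by
  have h : (euler k n).1 =
      ∑ i, (MvPolynomial.X i : Poly k n) • (MvPolynomial.pderiv i : Vect k n) := rfl
  rw [h, sum_vect_apply]
  simp only [Derivation.smul_apply, smul_eq_mul, MvPolynomial.X_mul_pderiv_monomial]
  rw [← Finset.sum_smul, Finsupp.degree_eq_sum, Nat.cast_smul_eq_nsmul]

theorem euler_lie_elt {m : Fin n →₀ ℕ} (hm : m ≠ 0) (p : Fin n) :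
    ⁅euler k n, LPlus.elt k m p⁆ = ((m.degree : k) - 1) • LPlus.elt k m p := by
  refine Subtype.ext (MvPolynomial.derivation_ext fun i => ?_)
  have hX : (euler k n).1 (MvPolynomial.X i) = MvPolynomial.X i := by
    rw [MvPolynomial.X, euler_monomial, Finsupp.degree_single, Nat.cast_one, one_smul]
  have h : (⁅euler k n, LPlus.elt k m p⁆ : LPlus k n).1 (MvPolynomial.X i) =
      (euler k n).1 ((LPlus.elt k m p).1 (MvPolynomial.X i)) -
        (LPlus.elt k m p).1 ((euler k n).1 (MvPolynomial.X i)) := Derivation.commutator_apply _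
  have h' : (((m.degree : k) - 1) • LPlus.elt k m p : LPlus k n).1 (MvPolynomial.X i) =
      ((m.degree : k) - 1) • (LPlus.elt k m p).1 (MvPolynomial.X i) := rfl
  rw [h, h', hX, elt_apply_X hm]
  split_ifs
  · rw [euler_monomial, sub_smul, one_smul]
  · simp

/-- A vector field with vanishing linear part is a combination of the `X^m ∂/∂X_p` with
`|m| ≥ 2`. -/
theorem mem_span_elt_of_glProj_eq_zero {l : LPlus k n} (hl : glProj k n l = 0) :
    l ∈ Submodule.span k {x | ∃ (m : Fin n →₀ ℕ) (p : Fin n), 2 ≤ m.degree ∧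
      x = LPlus.elt k m p} := by
  have h0 : ∀ p (m : Fin n →₀ ℕ), m ∈ (l.1 (MvPolynomial.X p)).support → 2 ≤ m.degree := by
    intro p m hm
    by_contra hlt
    have hc : MvPolynomial.coeff m (l.1 (MvPolynomial.X p)) = 0 := by
      rcases Nat.lt_or_ge m.degree 1 with h | h
      · rw [(Finsupp.degree_eq_zero_iff m).1 (by omega)]
        exact coeff_zero_of_mem ((mem_LPlus _).1 l.2 _)
      · obtain ⟨j, rfl⟩ : ∃ j, m = Finsupp.single j 1 := by
          have hm0 : m ≠ 0 := by
            rintro rfl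
            simp at h
          obtain ⟨i, hi⟩ := Finsupp.ne_iff.1 hm0
          have hle : Finsupp.single i 1 ≤ m := by
            rw [Finsupp.single_le_iff]
            exact Nat.one_le_iff_ne_zero.2 hi
          have hsub := tsub_add_cancel_of_le hle
          have hdeg := congrArg Finsupp.degree hsub
          rw [map_add, Finsupp.degree_single] at hdeg
          have h0 := (Finsupp.degree_eq_zero_iff (m - Finsupp.single i 1)).1 (by omega)
          exact ⟨i, by rw [h0, zero_add] at hsub; exact hsub.symm⟩
        exact congrFun (congrFun hl j) p
    exact MvPolynomial.mem_support_iff.1 hm hc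
  have h1 : l = ∑ p, ∑ m ∈ (l.1 (MvPolynomial.X p)).support,
      MvPolynomial.coeff m (l.1 (MvPolynomial.X p)) • LPlus.elt k m p := by
    refine Subtype.ext (MvPolynomial.derivation_ext fun i => ?_)
    have hcoe : ∀ {ι : Type} (s : Finset ι) (x : ι → LPlus k n) (f : Poly k n),
        (∑ j ∈ s, x j : LPlus k n).1 f = ∑ j ∈ s, (x j).1 f := fun s x f => by
      rw [← sum_vect_apply]
      congr 1
      exact map_sum (LPlus k n).toSubmodule.subtype x s
    have hs : ∀ (c : k) (x : LPlus k n) (f : Poly k n), (c • x : LPlus k n).1 f = c • x.1 f :=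
      fun _ _ _ => rfl
    rw [hcoe]
    simp only [hcoe, hs]
    rw [Finset.sum_eq_single i]
    · conv_lhs => rw [(l.1 (MvPolynomial.X i)).as_sum]
      refine Finset.sum_congr rfl fun m hm => ?_
      have hm0 : m ≠ 0 := by
        rintro rfl
        have := h0 i 0 hm
        simp at this
      rw [elt_apply_X hm0, if_pos rfl, MvPolynomial.smul_monomial, smul_eq_mul, mul_one]
    · intro p _ hpi
      refine Finset.sum_eq_zero fun m hm => ?_
      have hm0 : m ≠ 0 := by
        rintro rfl
        have := h0 p 0 hm
        simp at this
      rw [elt_apply_X hm0, if_neg hpi.symm, smul_zero]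
    · intro h; exact absurd (Finset.mem_univ i) h
  rw [h1]
  exact Submodule.sum_mem _ fun p _ => Submodule.sum_mem _ fun m hm =>
    Submodule.smul_mem _ _ (Submodule.subset_span ⟨m, p, h0 p m hm, rfl⟩)

theorem glProj_surjective : Function.Surjective (glProj k n) := by
  intro A
  refine ⟨∑ p, ∑ j, A j p • LPlus.elt k (Finsupp.single j 1) p, ?_⟩
  have h : ∀ j p, glProj k n (LPlus.elt k (Finsupp.single j 1) p) = Matrix.single j p 1 := by
    intro j p
    ext a b
    change MvPolynomial.coeff (Finsupp.single a 1)
      ((LPlus.elt k (Finsupp.single j 1) p).1 (MvPolynomial.X b)) = _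
    rw [elt_apply_X (by simp), Matrix.single_apply]
    by_cases hb : b = p
    · subst hb
      simp [MvPolynomial.coeff_monomial, Finsupp.single_left_inj]
    · simp [hb, Ne.symm hb]
  rw [map_sum]
  simp only [map_sum, map_smul, h]
  ext a b
  simp [Matrix.sum_apply, Matrix.single_apply, ite_and]

variable {Q : Type*} [AddCommGroup Q] [Module k Q]

/-- In a finite-dimensional irreducible representation of `𝓛₊`, the vector fields without linear
part act by zero: they annihilate an eigenvector of the Euler vector field whose eigenvalue cannot
be raised, and the vectors annihilated by them form a subrepresentation. -/
theorem rep_eq_zero_of_glProj_eq_zero [IsAlgClosed k] [CharZero k] [FiniteDimensional k Q]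
    [Nontrivial Q] (ρ : LPlus k n →ₗ⁅k⁆ Module.End k Q)
    (hρ : ∀ S : Submodule k Q, (∀ l, ∀ q ∈ S, ρ l q ∈ S) → S = ⊥ ∨ S = ⊤)
    {l : LPlus k n} (hl : glProj k n l = 0) : ρ l = 0 := by
  have hlie : ∀ l l' q, ρ l (ρ l' q) = ρ ⁅l, l'⁆ q + ρ l' (ρ l q) := fun l l' q => by
    rw [LieHom.map_lie, LieRing.of_associative_ring_bracket, LinearMap.sub_apply,
      Module.End.mul_apply, Module.End.mul_apply, sub_add_cancel]
  obtain ⟨c₀, hc₀⟩ := Module.End.exists_eigenvalue (ρ (euler k n))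
  have hfin : {j : ℕ | Module.End.HasEigenvalue (ρ (euler k n)) (c₀ + j)}.Finite := by
    refine Set.Finite.preimage (f := fun j : ℕ => c₀ + (j : k)) ?_
      (Module.End.finite_hasEigenvalue (ρ (euler k n)))
    intro i _ j _ hij
    exact Nat.cast_injective (add_left_cancel hij)
  obtain ⟨j, hj, hmax⟩ := hfin.exists_maximal ⟨0, by simpa using hc₀⟩
  obtain ⟨q₀, hq₀⟩ := hj.exists_hasEigenvector
  let S : Submodule k Q :=
    { carrier := {q | ∀ l, glProj k n l = 0 → ρ l q = 0}
      zero_mem' := fun l _ => map_zero _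
      add_mem' := fun {a b} ha hb l hl => by rw [map_add, ha l hl, hb l hl, add_zero]
      smul_mem' := fun c a ha l hl => by rw [map_smul, ha l hl, smul_zero] }
  have hS : ∀ l, ∀ q ∈ S, ρ l q ∈ S := by
    intro l q hq l' hl'
    rw [hlie, hq l' hl', map_zero, add_zero]
    exact hq _ (by rw [LieHom.map_lie, hl', zero_lie])
  have hq₀S : q₀ ∈ S := by
    intro l hl
    have hmem := mem_span_elt_of_glProj_eq_zero hl
    clear hl
    induction hmem using Submodule.span_induction with
    | mem x hx =>
      obtain ⟨m, p, hm, rfl⟩ := hx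
      by_contra hne
      have hm0 : m ≠ 0 := by
        rintro rfl
        simp at hm
      -- `X^m ∂/∂X_p` raises the eigenvalue of the Euler vector field by `|m| - 1 > 0`.
      have hev : Module.End.HasEigenvalue (ρ (euler k n)) (c₀ + (j + (m.degree - 1) : ℕ)) := by
        refine Module.End.hasEigenvalue_of_hasEigenvector
          (x := ρ (LPlus.elt k m p) q₀) ⟨?_, hne⟩
        rw [Module.End.mem_eigenspace_iff, hlie, euler_lie_elt hm0, hq₀.apply_eq_smul, map_smul,
          map_smul, LinearMap.smul_apply, ← add_smul, Nat.cast_add, Nat.cast_sub (by omega)]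
        congr 1
        push_cast
        ring
      have := hmax hev (by omega)
      omega
    | zero => simp
    | add x y _ _ hx hy => rw [map_add, LinearMap.add_apply, hx, hy, add_zero]
    | smul c x _ hx => rw [map_smul, LinearMap.smul_apply, hx, smul_zero]
  have htop : S = ⊤ := (hρ S hS).resolve_left fun h =>
    hq₀.2 ((Submodule.mem_bot k).1 (h ▸ hq₀S))
  ext q
  have hq : q ∈ S := htop ▸ Submodule.mem_top
  exact hq l hl

/-- Finite-dimensional irreducible representations of `𝓛₊` factor through `𝔤𝔩ₙ`. -/
theorem exists_rep_gl [IsAlgClosed k] [CharZero k] [FiniteDimensional k Q]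
    [Nontrivial Q] (ρ : LPlus k n →ₗ⁅k⁆ Module.End k Q)
    (hρ : ∀ S : Submodule k Q, (∀ l, ∀ q ∈ S, ρ l q ∈ S) → S = ⊥ ∨ S = ⊤) :
    ∃ σ : Matrix (Fin n) (Fin n) k →ₗ⁅k⁆ Module.End k Q, σ.comp (glProj k n) = ρ := by
  obtain ⟨s, hs⟩ := LinearMap.exists_rightInverse_of_surjective
    (glProj k n : LPlus k n →ₗ[k] Matrix (Fin n) (Fin n) k)
    (LinearMap.range_eq_top.2 glProj_surjective)
  have hs' : ∀ A, glProj k n (s A) = A := fun A => DFunLike.congr_fun hs A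
  have key : ∀ l l', glProj k n l = glProj k n l' → ρ l = ρ l' := fun l l' h => by
    refine sub_eq_zero.1 ?_
    rw [← map_sub]
    exact rep_eq_zero_of_glProj_eq_zero ρ hρ (by rw [map_sub, h, sub_self])
  refine ⟨{ toFun := fun A => ρ (s A), map_add' := fun A B => by rw [map_add, map_add],
            map_smul' := fun c A => by rw [map_smul, map_smul, RingHom.id_apply],
            map_lie' := fun {A B} => ?_ }, ?_⟩
  · rw [← LieHom.map_lie]
    exact key _ _ (by rw [LieHom.map_lie, hs', hs', hs'])
  · ext1 l
    exact key _ _ (hs' _)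

end FiniteDimensionalRep

/-! ### Growth of modules of Gelfand–Kirillov dimension at most `n` -/

section Growth

variable {k : Type u} [Field k] {R : Type v} [Ring R] [Algebra k R]
  {M : Type w} [AddCommGroup M] [Module k M] [Module R M] [IsScalarTower k R M]

theorem finiteDimensional_smul (C : Submodule k R) (V : Submodule k M) [FiniteDimensional k C]
    [FiniteDimensional k V] : FiniteDimensional k ↥(C • V) := by
  have h : C • V = Submodule.map₂ (Algebra.lsmul k k M).toLinearMap C V :=
    le_antisymm (Submodule.smul_le.2 fun r hr x hx => Submodule.apply_mem_map₂ _ hr hx)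
      (Submodule.map₂_le.2 fun r hr x hx => Submodule.smul_mem_smul hr hx)
  rw [h]
  exact Module.Finite.iff_fg.2 (Submodule.FG.map₂ _ (Module.Finite.iff_fg.1 inferInstance)
    (Module.Finite.iff_fg.1 inferInstance))

theorem finiteDimensional_pow_smul (C : Submodule k R) (V : Submodule k M) [FiniteDimensional k C]
    [FiniteDimensional k V] (m : ℕ) : FiniteDimensional k ↥(C ^ m • V) := by
  have : FiniteDimensional k ↥(C ^ m) :=
    Module.Finite.iff_fg.2 ((Module.Finite.iff_fg.1 inferInstance : C.FG).pow m)
  exact finiteDimensional_smul _ _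

theorem pow_smul_mono (C : Submodule k R) (h1 : (1 : R) ∈ C) (V : Submodule k M) :
    Monotone fun m => C ^ m • V := fun _ _ h =>
  Submodule.smul_mono_left (pow_le_pow_right' (Submodule.one_le.2 h1) h)

theorem pow_add_smul (C : Submodule k R) (V : Submodule k M) (m l : ℕ) :
    C ^ (m + l) • V = C ^ m • C ^ l • V := by
  rw [pow_add]
  exact Submodule.smul_assoc ..

theorem exists_le_of_forall_mem {V : Type*} [AddCommGroup V] [Module k V] {U : ℕ → Submodule k V}
    (hU : Monotone U) (F : Submodule k V) [FiniteDimensional k F] (h : ∀ x ∈ F, ∃ s, x ∈ U s) :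
    ∃ s, F ≤ U s := by
  obtain ⟨S, rfl⟩ := (Module.Finite.iff_fg.1 inferInstance : F.FG)
  have h' : ∀ x : V, ∃ s, x ∈ S → x ∈ U s := fun x => by
    by_cases hx : x ∈ S
    · obtain ⟨s, hs⟩ := h x (Submodule.subset_span hx)
      exact ⟨s, fun _ => hs⟩
    · exact ⟨0, fun h => absurd h hx⟩
  choose s hs using h'
  exact ⟨S.sup s, Submodule.span_le.2 fun x hx => hU (Finset.le_sup hx) (hs x hx)⟩

theorem exists_mem_pow_of_adjoin_eq_top {C : Submodule k R} (h1 : (1 : R) ∈ C)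
    (hC : Algebra.adjoin k (C : Set R) = ⊤) (r : R) : ∃ s, r ∈ C ^ s := by
  have hmono : Monotone fun m => C ^ m := fun _ _ h => pow_le_pow_right' (Submodule.one_le.2 h1) h
  have hr : r ∈ Algebra.adjoin k (C : Set R) := hC ▸ Algebra.mem_top
  induction hr using Algebra.adjoin_induction with
  | mem x hx => exact ⟨1, by rwa [pow_one]⟩
  | algebraMap c => exact ⟨0, by rw [pow_zero]; exact Submodule.algebraMap_mem c⟩
  | add x y _ _ hx hy =>
    obtain ⟨s, hs⟩ := hx
    obtain ⟨t, ht⟩ := hy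
    exact ⟨max s t, add_mem (hmono (le_max_left s t) hs) (hmono (le_max_right s t) ht)⟩
  | mul x y _ _ hx hy =>
    obtain ⟨s, hs⟩ := hx
    obtain ⟨t, ht⟩ := hy
    exact ⟨s + t, pow_add C s t ▸ Submodule.mul_mem_mul hs ht⟩

theorem exists_mem_pow_smul {C : Submodule k R} (h1 : (1 : R) ∈ C)
    (hC : Algebra.adjoin k (C : Set R) = ⊤) {M₀ : Submodule k M}
    (hM₀ : Submodule.span R (M₀ : Set M) = ⊤) (x : M) : ∃ s, x ∈ C ^ s • M₀ := by
  have hmono := pow_smul_mono C h1 M₀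
  have hx : x ∈ Submodule.span R (M₀ : Set M) := hM₀ ▸ Submodule.mem_top
  induction hx using Submodule.span_induction with
  | mem x hx => exact ⟨0, one_smul R x ▸ Submodule.smul_mem_smul
      (by rw [pow_zero]; exact Submodule.one_le.1 le_rfl) hx⟩
  | zero => exact ⟨0, zero_mem _⟩
  | add x y _ _ hx hy =>
    obtain ⟨s, hs⟩ := hx
    obtain ⟨t, ht⟩ := hy
    exact ⟨max s t, add_mem (hmono (le_max_left s t) hs) (hmono (le_max_right s t) ht)⟩
  | smul r x _ hx =>
    obtain ⟨s, hs⟩ := hx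
    obtain ⟨t, ht⟩ := exists_mem_pow_of_adjoin_eq_top h1 hC r
    exact ⟨t + s, pow_add_smul C M₀ t s ▸ Submodule.smul_mem_smul ht hs⟩

theorem pow_smul_le {C F : Submodule k R} {V W : Submodule k M} {s t : ℕ} (hF : F ≤ C ^ s)
    (hV : V ≤ C ^ t • W) (m : ℕ) : F ^ m • V ≤ C ^ (s * m + t) • W := by
  rw [pow_add_smul, pow_mul]
  exact Submodule.smul_mono (pow_le_pow_left' hF m) hV

/-- For a module of Gelfand–Kirillov dimension `n`, the growth of `F ^ m V` is bounded by a multiple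
of `m ^ (n + 1 / 2)`, for all finite-dimensional `F` and `V`; here it is squared, to have integer
exponents. -/
theorem HasGKDim.exists_growth_bound {n : ℕ} (h : HasGKDim k R M ((n : ℝ) : EReal))
    (F : Submodule k R) [FiniteDimensional k F] (V : Submodule k M) [FiniteDimensional k V] :
    ∃ K : ℕ, ∀ m, Module.finrank k ↥(F ^ m • V) ^ 2 ≤ K * (m + 1) ^ (2 * n + 1) := by
  obtain ⟨C, M₀, hCf, h1, hC, hMf, hM₀, hlim⟩ := h
  have hlt : Filter.limsup (fun m : ℕ =>
      ((Real.logb m (Module.finrank k ↥(C ^ m • M₀)) : ℝ) : EReal)) Filter.atTop <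
      (((n : ℝ) + 1 / 2 : ℝ) : EReal) := by
    rw [hlim]
    exact EReal.coe_lt_coe_iff.2 (by linarith)
  obtain ⟨N, hN⟩ := Filter.eventually_atTop.1 ((Filter.eventually_lt_of_limsup_lt hlt).and
    (Filter.eventually_ge_atTop 2))
  have hb : ∀ m ≥ N, Module.finrank k ↥(C ^ m • M₀) ^ 2 ≤ m ^ (2 * n + 1) := by
    intro m hm
    obtain ⟨hlog, hm2⟩ := hN m hm
    have hm1 : (1 : ℝ) < m := by exact_mod_cast hm2
    rcases Nat.eq_zero_or_pos (Module.finrank k ↥(C ^ m • M₀)) with h0 | hpos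
    · simp [h0]
    have hx := (Real.logb_lt_iff_lt_rpow hm1 (by exact_mod_cast hpos)).1
      (EReal.coe_lt_coe_iff.1 hlog)
    have h2 : ((Module.finrank k ↥(C ^ m • M₀) : ℝ)) ^ 2 ≤ (m : ℝ) ^ (2 * n + 1) := by
      calc ((Module.finrank k ↥(C ^ m • M₀) : ℝ)) ^ 2 ≤ ((m : ℝ) ^ ((n : ℝ) + 1 / 2)) ^ 2 := by
            gcongr
        _ = (m : ℝ) ^ (2 * n + 1) := by
            rw [← Real.rpow_natCast, ← Real.rpow_natCast, ← Real.rpow_mul (by positivity)]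
            congr 1
            push_cast
            ring
    exact_mod_cast h2
  obtain ⟨s, hs⟩ := exists_le_of_forall_mem
    (fun _ _ h => pow_le_pow_right' (Submodule.one_le.2 h1) h) F
    fun r _ => exists_mem_pow_of_adjoin_eq_top h1 hC r
  obtain ⟨t, ht⟩ := exists_le_of_forall_mem (pow_smul_mono C h1 M₀) V
    fun x _ => exists_mem_pow_smul h1 hC hM₀ x
  have ht' := ht.trans (pow_smul_mono C h1 M₀ (le_max_left t N))
  -- `C ^ (s m + max t N)` has exponent at least `N` for all `m`, so the bound `hb` applies to it.
  refine ⟨(s + max t N) ^ (2 * n + 1), fun m => ?_⟩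
  have := finiteDimensional_pow_smul C M₀ (s * m + max t N)
  calc Module.finrank k ↥(F ^ m • V) ^ 2
      ≤ Module.finrank k ↥(C ^ (s * m + max t N) • M₀) ^ 2 :=
        Nat.pow_le_pow_left (Submodule.finrank_mono (pow_smul_le hs ht' m)) 2
    _ ≤ (s * m + max t N) ^ (2 * n + 1) := hb _ ((le_max_right t N).trans (Nat.le_add_left _ _))
    _ ≤ ((s + max t N) * (m + 1)) ^ (2 * n + 1) := by
        gcongr
        nlinarith [Nat.zero_le (max t N * m)]
    _ = _ := mul_pow _ _ _

theorem tendsto_logb_of_le {f : ℕ → ℕ} {n A B : ℕ} (hlow : ∀ m, (m + 1) ^ n ≤ A * f m)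
    (hup : ∀ m, f m ≤ B * (m + 1) ^ n) :
    Filter.Tendsto (fun m : ℕ => Real.logb m (f m)) Filter.atTop (nhds (n : ℝ)) := by
  have hApos : 0 < A := Nat.pos_of_ne_zero fun h => by have := hlow 0; simp [h] at this
  have hfpos : ∀ m, 0 < f m := fun m => Nat.pos_of_ne_zero fun h => by
    have := hlow m
    simp [h] at this
  have hBpos : 0 < B := Nat.pos_of_ne_zero fun h => by
    have := (hfpos 0).trans_le (hup 0)
    simp [h] at this
  have hlog : Filter.Tendsto (fun m : ℕ => Real.log m) Filter.atTop Filter.atTop :=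
    Real.tendsto_log_atTop.comp tendsto_natCast_atTop_atTop
  have hc : ∀ c : ℝ, Filter.Tendsto (fun m : ℕ => (n : ℝ) + c / Real.log m) Filter.atTop
      (nhds (n : ℝ)) := fun c => by
    simpa using (tendsto_const_nhds (x := (n : ℝ))).add
      ((tendsto_const_nhds (x := c)).div_atTop hlog)
  refine tendsto_of_tendsto_of_tendsto_of_le_of_le' (hc (-Real.log A))
    (hc (Real.log (B * 2 ^ n))) ?_ ?_
  · filter_upwards [Filter.eventually_ge_atTop 2] with m hm
    have hm1 : (1 : ℝ) < m := by exact_mod_cast hm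
    have hlm : 0 < Real.log m := Real.log_pos hm1
    have h1 : (m : ℝ) ^ n ≤ A * f m := by
      exact_mod_cast (Nat.pow_le_pow_left (Nat.le_succ m) n).trans (hlow m)
    have h2 := Real.log_le_log (by positivity) h1
    rw [Real.log_pow, Real.log_mul (by positivity) (by exact_mod_cast (hfpos m).ne')] at h2
    rw [Real.logb, le_div_iff₀ hlm, add_mul, div_mul_cancel₀ _ hlm.ne']
    linarith
  · filter_upwards [Filter.eventually_ge_atTop 2] with m hm
    have hm1 : (1 : ℝ) < m := by exact_mod_cast hm
    have hlm : 0 < Real.log m := Real.log_pos hm1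
    have h1 : (f m : ℝ) ≤ (B * 2 ^ n) * m ^ n := by
      have : f m ≤ B * 2 ^ n * m ^ n := by
        rw [mul_assoc, ← mul_pow]
        exact (hup m).trans (by gcongr; omega)
      exact_mod_cast this
    have h2 := Real.log_le_log (by exact_mod_cast hfpos m) h1
    rw [Real.log_mul (by positivity) (by positivity), Real.log_pow] at h2
    rw [Real.logb, div_le_iff₀ hlm, add_mul, div_mul_cancel₀ _ hlm.ne']
    linarith

end Growth

/-! ### Modules of minimal growth over the Weyl algebra are holonomic -/

section Holonomic

variable {k : Type u} [Field k] {n : ℕ} {P : Type v} [AddCommGroup P] [Module k P]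
  [Module (Weyl k n) P] [IsScalarTower k (Weyl k n) P]

theorem gens_pow_smul_span (p : P) (m : ℕ) :
    (weylPair k n).gens ^ m • Submodule.span k {p} = orbit k n p m := by
  rw [WeylPair.gens_pow]
  refine le_antisymm (Submodule.smul_le.2 fun r hr x hx => ?_) fun x hx => ?_
  · obtain ⟨c, rfl⟩ := Submodule.mem_span_singleton.1 hx
    rw [smul_comm]
    exact Submodule.smul_mem _ _ (mem_orbit.2 ⟨r, hr, rfl⟩)
  · obtain ⟨r, hr, rfl⟩ := mem_orbit.1 hx
    exact Submodule.smul_mem_smul hr (Submodule.mem_span_singleton_self p)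

theorem isHolonomic_of_orbit_le [CharZero k] [IsSimpleModule (Weyl k n) P] {p : P} (hp : p ≠ 0)
    {C : ℕ} (hC : ∀ m, Module.finrank k (orbit k n p m) ≤ C * (m + 1) ^ n) :
    IsHolonomic k (Weyl k n) P n := by
  refine ⟨inferInstance, Or.inr ⟨(weylPair k n).gens, Submodule.span k {p}, inferInstance,
    (weylPair k n).one_mem_gens, ?_, inferInstance, ?_, ?_⟩⟩
  · rw [eq_top_iff, ← weyl_adjoin_eq_top, Algebra.adjoin_le_iff]
    rintro _ (⟨i, rfl⟩ | ⟨i, rfl⟩)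
    · exact Algebra.subset_adjoin ((weylPair k n).α_X_mem_gens i)
    · exact Algebra.subset_adjoin ((weylPair k n).β_X_mem_gens i)
  · refine (eq_bot_or_eq_top _).resolve_left fun h => hp ?_
    exact (Submodule.span_eq_bot.1 h) p (Submodule.mem_span_singleton_self p)
  · have h1 : ∀ m, Module.finrank k ↥((weylPair k n).gens ^ m • Submodule.span k {p}) =
        Module.finrank k (orbit k n p m) := fun m => by rw [gens_pow_smul_span]
    simp only [h1]
    refine Filter.Tendsto.limsup_eq ((continuous_coe_real_ereal.tendsto _).comp ?_)
    exact tendsto_logb_of_le (fun m => orbit_lower_bound hp (s := 0) hC (Nat.zero_le m)) hC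

/-- A cyclic `𝓓`-module whose growth is at most of order `m ^ (n + 1 / 2)` has growth at most of
order `m ^ n`, since its growth is that of a lower set of exponents. -/
theorem exists_orbit_le_of_sq_le {p : P} {K : ℕ}
    (hK : ∀ m, Module.finrank k (orbit k n p m) ^ 2 ≤ K * (m + 1) ^ (2 * n + 1)) :
    ∃ C, ∀ m, Module.finrank k (orbit k n p m) ≤ C * (m + 1) ^ n := by
  let w : (Fin n ⊕ Fin n →₀ ℕ) → P := fun e => (weylPair k n).mon e • p
  have hw : ∀ {m : ℕ} {r : Weyl k n}, r ∈ degSpan k (weylPair k n).mon m →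
      r • p ∈ degSpan k w m := fun hr => mem_orbit.2 ⟨_, hr, rfl⟩
  let T : Fin n ⊕ Fin n → Module.End k P := Sum.elim
    (fun i => Algebra.lsmul k k P ((weylPair k n).α (MvPolynomial.X i)))
    (fun i => Algebra.lsmul k k P ((weylPair k n).β (MvPolynomial.X i)))
  obtain ⟨D, hD, hDm⟩ := exists_finrank_degSpan_eq w T fun i e => by
    rcases i with i | i
    · have h1 : T (Sum.inl i) (w e) = w (e + Finsupp.single (Sum.inl i) 1) := by
        change (weylPair k n).α (MvPolynomial.X i) • (weylPair k n).mon e • p = _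
        rw [← mul_smul, WeylPair.α_X_mul_mon]
      rw [h1, sub_self]
      exact zero_mem _
    · have h1 : T (Sum.inr i) (w e) - w (e + Finsupp.single (Sum.inr i) 1) =
          ((e (Sum.inl i) : k) • (weylPair k n).mon (e - Finsupp.single (Sum.inl i) 1)) • p := by
        change (weylPair k n).β (MvPolynomial.X i) • (weylPair k n).mon e • p - _ = _
        rw [← mul_smul, WeylPair.β_X_mul_mon, add_smul, add_sub_cancel_left]
      rw [h1]
      exact hw ((weylPair k n).smul_mon_sub_mem (Nat.le_succ _) _)
  have hDm' : ∀ m, Module.finrank k (orbit k n p m) = ballCard D m := hDm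
  simp only [hDm'] at hK ⊢
  refine (ballCard_dichotomy n D hD).resolve_right ?_
  rintro ⟨L, hL⟩
  have h1 : ∀ m : ℕ, m + 1 ≤ L ^ 2 * K := fun m => by
    refine le_of_mul_le_mul_right ?_ (by positivity : 0 < (m + 1) ^ (2 * n + 1))
    calc (m + 1) * (m + 1) ^ (2 * n + 1) = ((m + 1) ^ (n + 1)) ^ 2 := by ring
      _ ≤ (L * ballCard D m) ^ 2 := Nat.pow_le_pow_left (hL m) 2
      _ = L ^ 2 * ballCard D m ^ 2 := mul_pow _ _ _
      _ ≤ L ^ 2 * (K * (m + 1) ^ (2 * n + 1)) := Nat.mul_le_mul_left _ (hK m)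
      _ = _ := by ring
  exact absurd (h1 (L ^ 2 * K)) (by omega)

/-- Simple `𝓓`-modules have countable dimension. -/
theorem rank_le_aleph0 [IsSimpleModule (Weyl k n) P] : Module.rank k P ≤ Cardinal.aleph0 := by
  have := IsSimpleModule.nontrivial (Weyl k n) P
  obtain ⟨p, hp⟩ := exists_ne (0 : P)
  have htop : Submodule.span k (Set.range fun e => (weylPair k n).mon e • p) = ⊤ := by
    rw [eq_top_iff]
    intro x _
    obtain ⟨r, rfl⟩ := IsSimpleModule.toSpanSingleton_surjective (Weyl k n) hp x
    obtain ⟨m, hm⟩ := weyl_exists_mem_degSpan r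
    have h1 : r • p ∈ orbit k n p m := mem_orbit.2 ⟨r, hm, rfl⟩
    exact Submodule.span_mono (Set.image_subset_range _ _) h1
  rw [← rank_top, ← htop]
  exact (rank_span_le _).trans (Cardinal.mk_le_aleph0_iff.2 (Set.countable_range _).to_subtype)

end Holonomic

/-! ### The tensor product decomposition of simple modules -/

section Decomposition

variable {k : Type u} [Field k] {n : ℕ}

theorem smul_mem_of_adjoin_eq_top {R : Type*} [Ring R] [Algebra k R] {M : Type*} [AddCommGroup M]
    [Module k M] [Module R M] [IsScalarTower k R M] {s : Set R} (hs : Algebra.adjoin k s = ⊤)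
    (N : Submodule k M) (h : ∀ a ∈ s, ∀ x ∈ N, a • x ∈ N) (a : R) {x : M} (hx : x ∈ N) :
    a • x ∈ N := by
  have ha : a ∈ Algebra.adjoin k s := hs ▸ Algebra.mem_top
  induction ha using Algebra.adjoin_induction generalizing x with
  | mem a ha => exact h a ha x hx
  | algebraMap c => rw [algebraMap_smul]; exact N.smul_mem c hx
  | add a b _ _ ha hb => rw [add_smul]; exact add_mem (ha hx) (hb hx)
  | mul a b _ _ ha hb => rw [mul_smul]; exact ha (hb hx)

theorem eq_bot_or_eq_top_of_adjoin_eq_top {R : Type*} [Ring R] [Algebra k R] {M : Type*}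
    [AddCommGroup M] [Module k M] [Module R M] [IsScalarTower k R M] [IsSimpleModule R M]
    {s : Set R} (hs : Algebra.adjoin k s = ⊤) (N : Submodule k M)
    (h : ∀ a ∈ s, ∀ x ∈ N, a • x ∈ N) : N = ⊥ ∨ N = ⊤ := by
  let N' : Submodule R M :=
    { N with smul_mem' := fun a _ hx => smul_mem_of_adjoin_eq_top hs N h a hx }
  refine (eq_bot_or_eq_top N').imp (fun h1 => ?_) fun h1 => ?_
  · exact SetLike.coe_injective (congrArg (fun S : Submodule R M => (S : Set M)) h1)
  · exact SetLike.coe_injective (congrArg (fun S : Submodule R M => (S : Set M)) h1)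

theorem AVAlg.exists_finset_mem_adjoin [CharZero k] (a : AVAlg k n) :
    ∃ S : Finset (LPlus k n), a ∈ Algebra.adjoin k
      (Set.range (AVAlg.ofWeyl k n) ∪ AVAlg.ofLPlus k n '' S) := by
  classical
  let B : Finset (LPlus k n) → Subalgebra k (AVAlg k n) := fun S =>
    Algebra.adjoin k (Set.range (AVAlg.ofWeyl k n) ∪ AVAlg.ofLPlus k n '' S)
  have hB : ∀ {S T : Finset (LPlus k n)}, S ⊆ T → B S ≤ B T := fun h =>
    Algebra.adjoin_mono (Set.union_subset_union_right _ (Set.image_mono h))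
  have hW : ∀ S r, AVAlg.ofWeyl k n r ∈ B S := fun S r => Algebra.subset_adjoin (Or.inl ⟨r, rfl⟩)
  have hL : ∀ t, ∃ S, polyLPlusIncl k n t ∈ B S := by
    intro t
    induction t with
    | zero => exact ⟨∅, by rw [map_zero]; exact zero_mem _⟩
    | add x y hx hy =>
      obtain ⟨S, hS⟩ := hx
      obtain ⟨T, hT⟩ := hy
      exact ⟨S ∪ T, by
        rw [map_add]
        exact add_mem (hB Finset.subset_union_left hS) (hB Finset.subset_union_right hT)⟩
    | tmul f l =>
      refine ⟨{l}, ?_⟩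
      rw [polyLPlusIncl_tmul, ← AVAlg.ofWeyl_ofPoly]
      exact mul_mem (hW _ _) (Algebra.subset_adjoin (Or.inr ⟨l, by simp, rfl⟩))
  change ∃ S, a ∈ B S
  have ha : a ∈ Algebra.adjoin k
      (Set.range (AVAlg.ofPoly (k := k) (n := n)) ∪ Set.range (AVAlg.ofVect (k := k) (n := n))) :=
    AVAlg.adjoin_eq_top (k := k) (n := n) ▸ Algebra.mem_top
  induction ha using Algebra.adjoin_induction with
  | mem a ha =>
    rcases ha with ⟨f, rfl⟩ | ⟨d, rfl⟩
    · exact ⟨∅, by rw [← AVAlg.ofWeyl_ofPoly]; exact hW _ _⟩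
    · obtain ⟨S, hS⟩ := hL (taylorPart k n d)
      exact ⟨S, by rw [AVAlg.ofVect_eq]; exact add_mem (hW _ _) hS⟩
  | algebraMap c => exact ⟨∅, Subalgebra.algebraMap_mem _ c⟩
  | add x y _ _ hx hy =>
    obtain ⟨S, hS⟩ := hx
    obtain ⟨T, hT⟩ := hy
    exact ⟨S ∪ T, add_mem (hB Finset.subset_union_left hS) (hB Finset.subset_union_right hT)⟩
  | mul x y _ _ hx hy =>
    obtain ⟨S, hS⟩ := hx
    obtain ⟨T, hT⟩ := hy
    exact ⟨S ∪ T, mul_mem (hB Finset.subset_union_left hS) (hB Finset.subset_union_right hT)⟩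

/-- The smash product is generated by the Weyl algebra and finitely many elements of its subalgebra
`U(𝓛₊)`, being finitely generated. -/
theorem AVAlg.exists_finset_adjoin_eq_top [CharZero k] {C : Submodule k (AVAlg k n)}
    [FiniteDimensional k C] (hC : Algebra.adjoin k (C : Set (AVAlg k n)) = ⊤) :
    ∃ S : Finset (LPlus k n), Algebra.adjoin k
      (Set.range (AVAlg.ofWeyl k n) ∪ AVAlg.ofLPlus k n '' S) = ⊤ := by
  classical
  obtain ⟨G, rfl⟩ := (Module.Finite.iff_fg.1 inferInstance : C.FG)
  choose S hS using AVAlg.exists_finset_mem_adjoin (k := k) (n := n)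
  refine ⟨G.biUnion S, ?_⟩
  rw [eq_top_iff, ← hC, Algebra.adjoin_span, Algebra.adjoin_le_iff]
  intro a ha
  refine Algebra.adjoin_mono (Set.union_subset_union_right _ (Set.image_mono ?_)) (hS a)
  exact Finset.subset_biUnion_of_mem S ha

theorem AVAlg.adjoin_ofWeyl_ofLPlus_eq_top [CharZero k] :
    Algebra.adjoin k (Set.range (AVAlg.ofWeyl k n) ∪ Set.range (AVAlg.ofLPlus k n)) = ⊤ := by
  refine eq_top_iff.2 fun a _ => ?_
  obtain ⟨S, hS⟩ := AVAlg.exists_finset_mem_adjoin a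
  exact Algebra.adjoin_mono (Set.union_subset_union_right _ (Set.image_subset_range _ _)) hS

variable {M : Type v} [AddCommGroup M] [Module k M] [Module (AVAlg k n) M]
  [IsScalarTower k (AVAlg k n) M] [Module (Weyl k n) M]

/-- A simple module over the smash product is a multiple of any of its simple `𝓓`-submodules: the
isotypic component of such a submodule is stable under the elements commuting with `𝓓`. -/
theorem exists_linearEquiv_tensor [CharZero k] [IsScalarTower k (Weyl k n) M]
    [IsSimpleModule (AVAlg k n) M] (hM : ∀ (r : Weyl k n) (x : M), AVAlg.ofWeyl k n r • x = r • x)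
    (P : Submodule (Weyl k n) M) [IsSimpleModule (Weyl k n) P] :
    ∃ ι : Type v, Nonempty (M ≃ₗ[Weyl k n] P ⊗[k] (ι →₀ k)) := by
  let N := isotypicComponent (Weyl k n) M P
  have htop : N = ⊤ := by
    have h := eq_bot_or_eq_top_of_adjoin_eq_top
      (AVAlg.adjoin_ofWeyl_ofLPlus_eq_top (k := k) (n := n)) (N.restrictScalars k) ?_
    · rcases h with h | h
      · have h1 := bot_lt_isotypicComponent P
        exact absurd ((Submodule.restrictScalars_eq_bot_iff k (Weyl k n) M).1 h) h1.ne'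
      · exact (Submodule.restrictScalars_eq_top_iff k (Weyl k n) M).1 h
    · rintro _ (⟨r, rfl⟩ | ⟨l, rfl⟩) x hx
      · rw [hM]
        exact N.smul_mem r hx
      · let F : M →ₗ[Weyl k n] M :=
          { toFun := fun x => AVAlg.ofLPlus k n l • x
            map_add' := smul_add _
            map_smul' := fun r x => by
              rw [RingHom.id_apply, ← hM, ← hM, ← mul_smul, AVAlg.ofLPlus_mul_ofWeyl, mul_smul] }
        exact LinearMap.le_comap_isotypicComponent P F hx
  have hss : IsSemisimpleModule (Weyl k n) M := by
    have : IsSemisimpleModule (Weyl k n) N := inferInstance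
    exact IsSemisimpleModule.congr (LinearEquiv.ofTop N htop).symm
  classical
  obtain ⟨ι, ⟨e⟩⟩ := (IsIsotypicOfType.of_isotypicComponent_eq_top htop).linearEquiv_finsupp
  exact ⟨ι, ⟨e.trans (TensorProduct.finsuppScalarRight k (Weyl k n) P ι).symm⟩⟩

section Stable

variable {P : Type*} [AddCommGroup P] [Module k P] [Module (Weyl k n) P]
  [IsScalarTower k (Weyl k n) P] {Q : Type*} [AddCommGroup Q] [Module k Q]

theorem lTensor_smul {Q' : Type*} [AddCommGroup Q'] [Module k Q'] (g : Q →ₗ[k] Q') (r : Weyl k n)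
    (x : P ⊗[k] Q) : LinearMap.lTensor P g (r • x) = r • LinearMap.lTensor P g x := by
  induction x with
  | zero => simp
  | add x y hx hy => simp only [smul_add, map_add, hx, hy]
  | tmul p q => simp [TensorProduct.smul_tmul']

/-- If `P ⊗ Q` is a simple module over the smash product on which `𝓓` acts through `P` and `𝓛₊`
through `Q`, then `Q` has no proper nonzero subspaces stable under elements of `𝓛₊` which together
with `𝓓` generate the smash product. -/
theorem eq_bot_or_eq_top_of_stable [CharZero k] [IsSimpleModule (AVAlg k n) M] [Nontrivial P]
    (hM : ∀ (r : Weyl k n) (x : M), AVAlg.ofWeyl k n r • x = r • x)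
    (e : M ≃ₗ[k] P ⊗[k] Q) (he : ∀ (r : Weyl k n) x, e (r • x) = r • e x)
    (ρ : LPlus k n →ₗ⁅k⁆ Module.End k Q)
    (hρ : ∀ l x, e (AVAlg.ofLPlus k n l • x) = LinearMap.lTensor P (ρ l) (e x))
    {S : Set (LPlus k n)} (hS : Algebra.adjoin k
      (Set.range (AVAlg.ofWeyl k n) ∪ AVAlg.ofLPlus k n '' S) = ⊤)
    (N : Submodule k Q) (hN : ∀ l ∈ S, ∀ q ∈ N, ρ l q ∈ N) : N = ⊥ ∨ N = ⊤ := by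
  obtain ⟨p, ψ, hψ⟩ := exists_functional_eq_one (k := k) (P := P)
  have hp : ∀ {Q' : Type _} [AddCommGroup Q'] [Module k Q'] {q : Q'}, p ⊗ₜ[k] q = 0 → q = 0 :=
    fun {Q'} _ _ {q} h => by
      have h1 := congrArg (contractLeft Q' ψ) h
      rwa [contractLeft_tmul, hψ, one_smul, map_zero] at h1
  have h := eq_bot_or_eq_top_of_adjoin_eq_top hS
    (LinearMap.ker (LinearMap.lTensor P N.mkQ ∘ₗ e.toLinearMap)) ?_
  · refine h.imp (fun h => ?_) fun h => ?_
    · refine (Submodule.eq_bot_iff N).2 fun q hq => ?_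
      have h1 : e.symm (p ⊗ₜ q) ∈ LinearMap.ker (LinearMap.lTensor P N.mkQ ∘ₗ e.toLinearMap) := by
        rw [LinearMap.mem_ker, LinearMap.comp_apply, LinearEquiv.coe_coe, e.apply_symm_apply,
          LinearMap.lTensor_tmul, Submodule.mkQ_apply, (Submodule.Quotient.mk_eq_zero N).2 hq,
          TensorProduct.tmul_zero]
      rw [h, Submodule.mem_bot, LinearEquiv.map_eq_zero_iff] at h1
      exact hp h1
    · refine eq_top_iff.2 fun q _ => ?_
      have h1 : e.symm (p ⊗ₜ q) ∈ LinearMap.ker (LinearMap.lTensor P N.mkQ ∘ₗ e.toLinearMap) :=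
        h ▸ Submodule.mem_top
      rw [LinearMap.mem_ker, LinearMap.comp_apply, LinearEquiv.coe_coe, e.apply_symm_apply,
          LinearMap.lTensor_tmul] at h1
      exact (Submodule.Quotient.mk_eq_zero N).1 (hp h1)
  · rintro _ (⟨r, rfl⟩ | ⟨l, hl, rfl⟩) x hx
    · rw [LinearMap.mem_ker, LinearMap.comp_apply, LinearEquiv.coe_coe] at hx ⊢
      rw [hM, he, lTensor_smul, hx, smul_zero]
    · rw [LinearMap.mem_ker, LinearMap.comp_apply, LinearEquiv.coe_coe] at hx ⊢
      have h1 : N.mkQ ∘ₗ ρ l = N.mapQ N (ρ l) (hN l hl) ∘ₗ N.mkQ := rfl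
      rw [hρ, ← LinearMap.comp_apply, ← LinearMap.lTensor_comp, h1, LinearMap.lTensor_comp,
        LinearMap.comp_apply, hx, map_zero]

end Stable

end Decomposition

/-! ### Finite-dimensionality of the multiplicity space -/

section Multiplicity

variable {k : Type u} [Field k] {n : ℕ} {M : Type v} [AddCommGroup M] [Module k M]
  [Module (AVAlg k n) M] [IsScalarTower k (AVAlg k n) M] [Module (Weyl k n) M]

/-- The cyclic `𝓓`-submodules of a holonomic module over the smash product have growth of order at
most `m ^ n`. -/
theorem exists_orbit_le_of_hasGKDim [CharZero k] [IsScalarTower k (Weyl k n) M]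
    (hM : ∀ (r : Weyl k n) (x : M), AVAlg.ofWeyl k n r • x = r • x)
    (hGK : HasGKDim k (AVAlg k n) M ((n : ℝ) : EReal)) (x : M) :
    ∃ C, ∀ m, Module.finrank k (orbit k n x m) ≤ C * (m + 1) ^ n := by
  let F := (weylPair k n).gens.map (AVAlg.ofWeyl k n).toLinearMap
  obtain ⟨K, hK⟩ := hGK.exists_growth_bound F (Submodule.span k {x})
  refine exists_orbit_le_of_sq_le (K := K) fun m => le_trans (Nat.pow_le_pow_left ?_ 2) (hK m)
  have := finiteDimensional_pow_smul F (Submodule.span k {x}) m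
  refine Submodule.finrank_mono ?_
  rw [← gens_pow_smul_span, Submodule.smul_le]
  intro r hr y hy
  rw [← hM]
  refine Submodule.smul_mem_smul ?_ hy
  rw [← Submodule.map_pow]
  exact ⟨r, hr, rfl⟩

variable {P : Type*} [AddCommGroup P] [Module k P] [Module (Weyl k n) P]
  [IsScalarTower k (Weyl k n) P] {Q : Type*} [AddCommGroup Q] [Module k Q]

/-- The multiplicity space `Q` is finite-dimensional: otherwise the growth of `P ⊗ Q` would exceed
that of `P`, which is of order `m ^ n`, by at least a factor of order `m`. -/
theorem finiteDimensional_of_hasGKDim [CharZero k] [IsSimpleModule (AVAlg k n) M]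
    (hM : ∀ (r : Weyl k n) (x : M), AVAlg.ofWeyl k n r • x = r • x)
    (hGK : HasGKDim k (AVAlg k n) M ((n : ℝ) : EReal))
    (e : M ≃ₗ[k] P ⊗[k] Q) (he : ∀ (r : Weyl k n) x, e (r • x) = r • e x)
    (ρ : LPlus k n →ₗ⁅k⁆ Module.End k Q)
    (hρ : ∀ l x, e (AVAlg.ofLPlus k n l • x) = LinearMap.lTensor P (ρ l) (e x))
    {p : P} (hp : p ≠ 0) {C : ℕ}
    (hC : ∀ m, Module.finrank k (orbit k n p m) ≤ C * (m + 1) ^ n) : FiniteDimensional k Q := by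
  have : Nontrivial P := ⟨⟨p, 0, hp⟩⟩
  by_contra hinf
  obtain ⟨q₀, hq₀⟩ : ∃ q : Q, q ≠ 0 := by
    by_contra! h
    have : Subsingleton Q := ⟨fun a b => (h a).trans (h b).symm⟩
    exact hinf inferInstance
  obtain ⟨S, hS⟩ : ∃ S : Finset (LPlus k n), Algebra.adjoin k
      (Set.range (AVAlg.ofWeyl k n) ∪ AVAlg.ofLPlus k n '' S) = ⊤ := by
    obtain ⟨_, _, _, _, h, _⟩ := hGK
    exact AVAlg.exists_finset_adjoin_eq_top h
  let G : Submodule k (Module.End k Q) := Submodule.span k (insert 1 (ρ '' S))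
  have hG1 : (1 : Module.End k Q) ∈ G := Submodule.subset_span (Set.mem_insert _ _)
  have hGfin : FiniteDimensional k G :=
    FiniteDimensional.span_of_finite k ((S.finite_toSet.image _).insert _)
  -- The subspaces `W m` of `Q` spanned by the images of `q₀` under products of at most `m`
  -- operators from `S`; they increase strictly, because a stationary one is stable under `S`.
  let W : ℕ → Submodule k Q := fun m => G ^ m • Submodule.span k {q₀}
  have hW : Monotone W := pow_smul_mono G hG1 _
  have hWfin : ∀ m, FiniteDimensional k (W m) := finiteDimensional_pow_smul G _
  have hWsucc : ∀ m, W (m + 1) = G • W m := fun m => by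
    change G ^ (m + 1) • _ = G • G ^ m • _
    rw [add_comm, pow_add_smul, pow_one]
  have hW0 : ∀ m, q₀ ∈ W m := fun m => hW (Nat.zero_le m)
    (one_smul (Module.End k Q) q₀ ▸ Submodule.smul_mem_smul
      (by rw [pow_zero]; exact Submodule.one_le.1 le_rfl) (Submodule.mem_span_singleton_self q₀))
  have hlt : ∀ m, W m < W (m + 1) := fun m => by
    refine lt_of_le_of_ne (hW (Nat.le_succ m)) fun heq => ?_
    rcases eq_bot_or_eq_top_of_stable hM e he ρ hρ hS (W m) fun l hl q hq => by
      rw [heq, hWsucc]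
      exact Submodule.smul_mem_smul
        (Submodule.subset_span (Set.mem_insert_of_mem _ ⟨l, hl, rfl⟩)) hq with h | h
    · exact hq₀ ((Submodule.mem_bot k).1 (h ▸ hW0 m))
    · have h1 := hWfin m
      rw [h] at h1
      exact hinf (Module.Finite.equiv Submodule.topEquiv)
  have hWdim : ∀ m, m + 1 ≤ Module.finrank k (W m) := fun m => by
    induction m with
    | zero =>
      have : Nontrivial (W 0) := ⟨⟨⟨q₀, hW0 0⟩, 0, fun h => hq₀ (congrArg Subtype.val h)⟩⟩
      exact Module.finrank_pos
    | succ m ih =>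
      have := Submodule.finrank_lt_finrank_of_lt (hlt m)
      omega
  -- A finite-dimensional space of operators containing generators of `𝓓` and the operators in `S`.
  let F : Submodule k (AVAlg k n) := (weylPair k n).gens.map (AVAlg.ofWeyl k n).toLinearMap ⊔
    Submodule.span k (insert 1 (AVAlg.ofLPlus k n '' S))
  have hFspan : FiniteDimensional k (Submodule.span k (insert 1 (AVAlg.ofLPlus k n '' S))) :=
    FiniteDimensional.span_of_finite k ((S.finite_toSet.image _).insert _)
  let V : Submodule k M := Submodule.span k {e.symm (p ⊗ₜ q₀)}
  obtain ⟨K, hK⟩ := hGK.exists_growth_bound F V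
  have hFW : ∀ m, ∀ q ∈ W m, e.symm (p ⊗ₜ q) ∈ F ^ m • V := by
    intro m
    let T : ℕ → Submodule k Q := fun m =>
      (F ^ m • V).comap (e.symm.toLinearMap ∘ₗ TensorProduct.mk k P Q p)
    have hT : ∀ m, W m ≤ T m := by
      intro m
      induction m with
      | zero =>
        have h1 : ∀ (r : k), e.symm (p ⊗ₜ (r • q₀)) ∈ V := fun r => by
          rw [TensorProduct.tmul_smul, map_smul]
          exact V.smul_mem r (Submodule.mem_span_singleton_self _)
        have h2 : W 0 = Submodule.span k {q₀} := by
          change G ^ 0 • _ = _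
          rw [pow_zero, Submodule.one_smul]
        rw [h2]
        intro q hq
        obtain ⟨c, rfl⟩ := Submodule.mem_span_singleton.1 hq
        change e.symm (p ⊗ₜ (c • q₀)) ∈ F ^ 0 • V
        rw [pow_zero, Submodule.one_smul]
        exact h1 c
      | succ m ih =>
        rw [hWsucc, Submodule.smul_le]
        intro g hg q hq
        have hq' : e.symm (p ⊗ₜ q) ∈ F ^ m • V := ih hq
        have hFs : ∀ a ∈ insert 1 (AVAlg.ofLPlus k n '' S), a • e.symm (p ⊗ₜ q) ∈
            F ^ (m + 1) • V := fun a ha => by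
          rw [add_comm, pow_add_smul, pow_one]
          exact Submodule.smul_mem_smul
            (Submodule.mem_sup_right (Submodule.subset_span ha)) hq'
        induction hg using Submodule.span_induction with
        | mem g hg =>
          rcases hg with rfl | ⟨l, hl, rfl⟩
          · have h1 := hFs 1 (Set.mem_insert _ _)
            rwa [one_smul] at h1
          · have h1 := hFs _ (Set.mem_insert_of_mem _ ⟨l, hl, rfl⟩)
            have h2 : AVAlg.ofLPlus k n l • e.symm (p ⊗ₜ q) = e.symm (p ⊗ₜ ρ l q) := by
              rw [LinearEquiv.eq_symm_apply, hρ, e.apply_symm_apply, LinearMap.lTensor_tmul]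
            rwa [h2] at h1
        | zero => rw [zero_smul]; exact zero_mem _
        | add g h _ _ hg hh => rw [add_smul]; exact add_mem hg hh
        | smul c g _ hg => rw [smul_assoc]; exact (T (m + 1)).smul_mem c hg
    exact hT m
  -- `F ^ (2 m) V` contains `B_m p ⊗ W m`.
  have hdim : ∀ m, Module.finrank k (orbit k n p m) * Module.finrank k (W m) ≤
      Module.finrank k ↥(F ^ (m + m) • V) := by
    intro m
    have := finiteDimensional_pow_smul F V (m + m)
    let f : orbit k n p m ⊗[k] W m →ₗ[k] M :=
      e.symm.toLinearMap ∘ₗ TensorProduct.map (orbit k n p m).subtype (W m).subtype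
    have hf : Function.Injective f := e.symm.injective.comp
      (TensorProduct.map_injective_of_flat_flat _ _ (Submodule.injective_subtype _)
        (Submodule.injective_subtype _))
    have hr : ∀ x, f x ∈ F ^ (m + m) • V := by
      intro x
      induction x with
      | zero => rw [map_zero]; exact zero_mem _
      | add x y hx hy => rw [map_add]; exact add_mem hx hy
      | tmul x q =>
        obtain ⟨x, hx⟩ := x
        obtain ⟨r, hr, rfl⟩ := mem_orbit.1 hx
        have h1 : f (⟨r • p, hx⟩ ⊗ₜ q) = AVAlg.ofWeyl k n r • e.symm (p ⊗ₜ q.1) := by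
          change e.symm ((r • p) ⊗ₜ q.1) = _
          rw [hM, LinearEquiv.symm_apply_eq, he, e.apply_symm_apply, TensorProduct.smul_tmul']
        rw [h1, pow_add_smul]
        refine Submodule.smul_mem_smul ?_ (hFW m q.1 q.2)
        refine pow_le_pow_left' (le_sup_left : _ ≤ F) m ?_
        rw [← Submodule.map_pow, WeylPair.gens_pow]
        exact ⟨r, hr, rfl⟩
    have h1 := LinearMap.finrank_le_finrank_of_injective
      (f := f.codRestrict (F ^ (m + m) • V) hr) fun x y h => hf (congrArg Subtype.val h)
    rwa [Module.finrank_tensorProduct] at h1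
  let A := (2 * n) ^ (2 * n) * C * 3 ^ n
  have hfinal : ∀ m : ℕ, m + 1 ≤ A ^ 2 * K * 2 ^ (2 * n + 1) := fun m => by
    refine le_of_mul_le_mul_right ?_ (by positivity : 0 < (m + 1) ^ (2 * n + 1))
    have h1 : (m + 1) ^ n ≤ A * Module.finrank k (orbit k n p m) :=
      orbit_lower_bound hp (s := 0) hC (Nat.zero_le m)
    calc (m + 1) * (m + 1) ^ (2 * n + 1) = ((m + 1) ^ n * (m + 1)) ^ 2 := by ring
      _ ≤ ((A * Module.finrank k (orbit k n p m)) * Module.finrank k (W m)) ^ 2 :=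
        Nat.pow_le_pow_left (Nat.mul_le_mul h1 (hWdim m)) 2
      _ = A ^ 2 * (Module.finrank k (orbit k n p m) * Module.finrank k (W m)) ^ 2 := by ring
      _ ≤ A ^ 2 * (K * (m + m + 1) ^ (2 * n + 1)) :=
        Nat.mul_le_mul_left _ ((Nat.pow_le_pow_left (hdim m) 2).trans (hK _))
      _ ≤ A ^ 2 * (K * (2 * (m + 1)) ^ (2 * n + 1)) := by gcongr; omega
      _ = _ := by rw [mul_pow 2 (m + 1)]; ring
  exact absurd (hfinal (A ^ 2 * K * 2 ^ (2 * n + 1))) (by omega)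

end Multiplicity

/-! ### Comparison with the tensor product modules -/

section Comparison

variable {k : Type u} [Field k] {n : ℕ} {M : Type v} [AddCommGroup M] [Module k M]
  [Module (AVAlg k n) M] {P : Type*} [AddCommGroup P] [Module k P] [Module (Weyl k n) P]
  [IsScalarTower k (Weyl k n) P] {Q : Type*} [AddCommGroup Q] [Module k Q]

theorem tensorRep_ofPoly (ρ : LPlus k n →ₗ⁅k⁆ Module.End k Q) (f : Poly k n) (y : P ⊗[k] Q) :
    tensorRep k n P ρ (AVAlg.ofPoly k n f) y = Weyl.ofPoly k n f • y := by
  induction y with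
  | zero => simp
  | add x y hx hy => rw [map_add, smul_add, hx, hy]
  | tmul p q => rw [AVAlg.ofPoly_apply, tensorRep_poly, TensorProduct.smul_tmul']

theorem endTensor_tensorIncl (ρ : LPlus k n →ₗ⁅k⁆ Module.End k Q)
    (e : M ≃ₗ[k] P ⊗[k] Q)
    (hP : ∀ (f : Poly k n) x, e (AVAlg.ofPoly k n f • x) = Weyl.ofPoly k n f • e x)
    (hρ : ∀ l x, e (AVAlg.ofLPlus k n l • x) = LinearMap.lTensor P (ρ l) (e x))
    (t : Poly k n ⊗[k] LPlus k n) (x : M) :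
    Module.endTensorEndAlgHom (R := k) (S := k) (A := k) (M := P) (N := Q)
      (Algebra.TensorProduct.map (Algebra.lsmul k k P) (UniversalEnvelopingAlgebra.lift k ρ)
        (tensorIncl k n t)) (e x) = e (polyLPlusIncl k n t • x) := by
  induction t with
  | zero => simp
  | add s t hs ht => simp only [map_add, LinearMap.add_apply, hs, ht, add_smul]
  | tmul f l =>
    have h1 : tensorIncl k n (f ⊗ₜ l) =
      Weyl.ofPoly k n f ⊗ₜ UniversalEnvelopingAlgebra.ι k l := rfl
    rw [polyLPlusIncl_tmul, mul_smul, hP, hρ, h1, Algebra.TensorProduct.map_tmul,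
      UniversalEnvelopingAlgebra.lift_ι_apply]
    induction e x with
    | zero => simp
    | add y z hy hz => simp only [map_add, smul_add, hy, hz]
    | tmul p q => rfl

/-- An isomorphism `M ≅ P ⊗ Q` compatible with the actions of `𝓓` on `P` and of `𝓛₊` on `Q` is an
isomorphism of modules over the smash product. -/
theorem map_smul_eq_tensorRep [CharZero k] [IsScalarTower k (AVAlg k n) M] [Module (Weyl k n) M]
    (hM : ∀ (r : Weyl k n) (x : M), AVAlg.ofWeyl k n r • x = r • x)
    (e : M ≃ₗ[k] P ⊗[k] Q) (he : ∀ (r : Weyl k n) x, e (r • x) = r • e x)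
    (ρ : LPlus k n →ₗ⁅k⁆ Module.End k Q)
    (hρ : ∀ l x, e (AVAlg.ofLPlus k n l • x) = LinearMap.lTensor P (ρ l) (e x))
    (a : AVAlg k n) (x : M) : e (a • x) = tensorRep k n P ρ a (e x) := by
  have hP : ∀ (f : Poly k n) x, e (AVAlg.ofPoly k n f • x) = Weyl.ofPoly k n f • e x :=
    fun f x => by rw [← AVAlg.ofWeyl_ofPoly, hM, he]
  have ha : a ∈ Algebra.adjoin k
      (Set.range (AVAlg.ofPoly k n) ∪ Set.range (AVAlg.ofVect k n)) :=
    AVAlg.adjoin_eq_top (k := k) (n := n) ▸ Algebra.mem_top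
  induction ha using Algebra.adjoin_induction generalizing x with
  | mem a ha =>
    rcases ha with ⟨f, rfl⟩ | ⟨d, rfl⟩
    · rw [tensorRep_ofPoly, hP]
    · have h1 : tensorRep k n P ρ (AVAlg.ofVect k n d) =
          Module.endTensorEndAlgHom (R := k) (S := k) (A := k) (M := P) (N := Q)
            (Algebra.TensorProduct.map (Algebra.lsmul k k P)
              (UniversalEnvelopingAlgebra.lift k ρ)
              (Weyl.ofVect k n d ⊗ₜ 1 + tensorIncl k n (taylorPart k n d))) := by
        have h2 : phi k n (AVAlg.ofVect k n d) =
            Weyl.ofVect k n d ⊗ₜ 1 + tensorIncl k n (taylorPart k n d) := by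
          rw [AVAlg.ofVect_apply, phi, AVAlg.lift_mk, map_one, one_mul,
            UniversalEnvelopingAlgebra.lift_ι_apply]
          rfl
        rw [← h2]
        rfl
      rw [h1, map_add, map_add, LinearMap.add_apply, endTensor_tensorIncl ρ e hP hρ,
        AVAlg.ofVect_eq, add_smul, map_add, hM, he, Algebra.TensorProduct.map_tmul, map_one]
      rfl
  | algebraMap c =>
    rw [AlgHom.commutes, algebraMap_smul, map_smul]
    rfl
  | add a b _ _ ha hb => rw [add_smul, map_add, ha, hb, map_add, LinearMap.add_apply]
  | mul a b _ _ ha hb => rw [mul_smul, ha, hb, map_mul, Module.End.mul_apply]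

theorem exists_lieModule_toEnd_eq {L : Type*} [LieRing L] [LieAlgebra k L]
    (σ : L →ₗ⁅k⁆ Module.End k Q) :
    ∃ (_ : LieRingModule L Q) (_ : LieModule k L Q), LieModule.toEnd k L Q = σ := by
  let i : LieRingModule L Q :=
    { bracket := fun l q => σ l q
      add_lie := fun l l' q => by rw [map_add, LinearMap.add_apply]
      lie_add := fun l q q' => map_add (σ l) q q'
      leibniz_lie := fun l l' q => by
        rw [LieHom.map_lie, LieRing.of_associative_ring_bracket, LinearMap.sub_apply,
          Module.End.mul_apply, Module.End.mul_apply, sub_add_cancel] }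
  exact ⟨i, { smul_lie := fun c l q => by
                change σ (c • l) q = c • σ l q
                rw [map_smul, LinearMap.smul_apply]
              lie_smul := fun c l q => map_smul (σ l) c q }, rfl⟩

end Comparison

end AVMod

open AVMod in
theorem mainTheorem1 {k : Type u} [Field k] [IsAlgClosed k] [CharZero k] [Uncountable k] (n : ℕ)
    (M : Type v) [AddCommGroup M] [Module k M] [Module (AVMod.AVAlg k n) M]
    [IsScalarTower k (AVMod.AVAlg k n) M]
    (hsimple : IsSimpleModule (AVMod.AVAlg k n) M)
    (hhol : AVMod.IsHolonomic k (AVMod.AVAlg k n) M n) :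
    ∃ (P : Type v) (_ : AddCommGroup P) (_ : Module k P) (_ : Module (AVMod.Weyl k n) P)
      (_ : IsScalarTower k (AVMod.Weyl k n) P)
      (Q : Type u) (_ : AddCommGroup Q) (_ : Module k Q)
      (_ : LieRingModule (Matrix (Fin n) (Fin n) k) Q)
      (_ : LieModule k (Matrix (Fin n) (Fin n) k) Q),
      IsSimpleModule (AVMod.Weyl k n) P ∧
      AVMod.IsHolonomic k (AVMod.Weyl k n) P n ∧
      FiniteDimensional k Q ∧
      LieModule.IsIrreducible k (Matrix (Fin n) (Fin n) k) Q ∧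
      ∃ e : M ≃ₗ[k] P ⊗[k] Q, ∀ (a : AVMod.AVAlg k n) (x : M),
        e (a • x) =
          AVMod.tensorRep k n P
            ((LieModule.toEnd k (Matrix (Fin n) (Fin n) k) Q).comp (AVMod.glProj k n)) a (e x) := by
  have hnt : Nontrivial M := IsSimpleModule.nontrivial (AVAlg k n) M
  have hGK := hhol.2.resolve_left (not_subsingleton M)
  let _ : Module (Weyl k n) M := Module.compHom M (AVAlg.ofWeyl k n).toRingHom
  have hM : ∀ (r : Weyl k n) (x : M), AVAlg.ofWeyl k n r • x = r • x := fun _ _ => rfl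
  have : IsScalarTower k (Weyl k n) M := ⟨fun c r x => by
    rw [← hM, ← hM, map_smul, smul_assoc]⟩
  -- A simple `𝓓`-submodule `P`, and the decomposition `M ≅ P ⊗ Q₁`.
  obtain ⟨x, hx⟩ := exists_ne (0 : M)
  obtain ⟨C₀, hC₀⟩ := exists_orbit_le_of_hasGKDim hM hGK x
  obtain ⟨P, hP⟩ := exists_simple_submodule_of_orbit_le hx hC₀
  have hPnt : Nontrivial P := IsSimpleModule.nontrivial (Weyl k n) P
  obtain ⟨ι, ⟨e₁⟩⟩ := exists_linearEquiv_tensor hM P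
  have hend : ∀ f : P →ₗ[Weyl k n] P, ∃ c : k, ∀ p, f p = c • p :=
    exists_eq_smul_of_rank_le_aleph0 (rank_le_aleph0 (k := k) (n := n))
  -- The action of `𝓛₊` on `Q₁`.
  let e : M ≃ₗ[k] P ⊗[k] (ι →₀ k) := e₁.restrictScalars k
  have he : ∀ (r : Weyl k n) x, e (r • x) = r • e x := fun r x => map_smul e₁ r x
  let L : AVAlg k n →ₐ[k] Module.End k M := Algebra.lsmul k k M
  let T : LPlus k n →ₗ⁅k⁆ Module.End k (P ⊗[k] (ι →₀ k)) :=
    (e.lieConj : Module.End k M →ₗ⁅k⁆ _).comp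
      ((L : AVAlg k n →ₗ⁅k⁆ Module.End k M).comp (AVAlg.ofLPlus k n))
  have hT : ∀ l y, T l y = e (AVAlg.ofLPlus k n l • e.symm y) := fun _ _ => rfl
  obtain ⟨ρ₁, hρ₁⟩ := exists_lieHom_of_commute hend T fun l r y => by
    have h1 : e.symm (r • y) = r • e.symm y := by
      rw [LinearEquiv.symm_apply_eq, he, e.apply_symm_apply]
    rw [hT, hT, h1, ← he, ← hM, ← hM, ← mul_smul, ← mul_smul, AVAlg.ofLPlus_mul_ofWeyl]
  have hρ₁' : ∀ l x, e (AVAlg.ofLPlus k n l • x) =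
      LinearMap.lTensor P (ρ₁ l) (e x) := fun l x => by
    have h1 : T l = LinearMap.lTensor P (ρ₁ l) := TensorProduct.ext' fun p q => hρ₁ l p q
    rw [← h1, hT, e.symm_apply_apply]
  -- `P` is holonomic and `Q₁` is finite-dimensional.
  obtain ⟨p, hp⟩ := exists_ne (0 : P)
  obtain ⟨C, hC⟩ : ∃ C, ∀ m, Module.finrank k (orbit k n p m) ≤ C * (m + 1) ^ n := by
    obtain ⟨C, hC⟩ := exists_orbit_le_of_hasGKDim hM hGK (p : M)
    refine ⟨C, fun m => le_trans (le_of_eq ?_) (hC m)⟩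
    have h1 := orbit_map (k := k) P.subtype p m
    rw [Submodule.subtype_apply] at h1
    rw [h1]
    exact (Submodule.equivMapOfInjective (P.subtype.restrictScalars k) P.injective_subtype
      (orbit k n p m)).finrank_eq
  have hfin : FiniteDimensional k (ι →₀ k) :=
    finiteDimensional_of_hasGKDim hM hGK e he ρ₁ hρ₁' hp hC
  -- Replacing `Q₁` by a coordinate space `Q` in the universe of `k`.
  let b : (ι →₀ k) ≃ₗ[k] (Fin (Module.finrank k (ι →₀ k)) → k) :=
    (Module.finBasis k (ι →₀ k)).equivFun
  let e' : M ≃ₗ[k] P ⊗[k] (Fin (Module.finrank k (ι →₀ k)) → k) := e.trans (b.lTensor P)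
  have he' : ∀ (r : Weyl k n) x, e' (r • x) = r • e' x := fun r x => by
    change LinearMap.lTensor P b.toLinearMap (e (r • x)) = _
    rw [he, lTensor_smul]
    rfl
  let ρ : LPlus k n →ₗ⁅k⁆ Module.End k (Fin (Module.finrank k (ι →₀ k)) → k) :=
    (b.lieConj : Module.End k (ι →₀ k) →ₗ⁅k⁆ _).comp ρ₁
  have hρ : ∀ l x, e' (AVAlg.ofLPlus k n l • x) = LinearMap.lTensor P (ρ l) (e' x) := fun l x => by
    change LinearMap.lTensor P b.toLinearMap (e _) =
      LinearMap.lTensor P (ρ l) (LinearMap.lTensor P b.toLinearMap (e x))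
    rw [hρ₁', ← LinearMap.comp_apply, ← LinearMap.lTensor_comp, ← LinearMap.comp_apply,
      ← LinearMap.lTensor_comp]
    congr 2
    refine LinearMap.ext fun q => ?_
    change b (ρ₁ l q) = b (ρ₁ l (b.symm (b q)))
    rw [b.symm_apply_apply]
  have hQnt : Nontrivial (Fin (Module.finrank k (ι →₀ k)) → k) := by
    by_contra h
    rw [not_nontrivial_iff_subsingleton] at h
    exact not_subsingleton M (e'.injective.subsingleton)
  have hstable := eq_bot_or_eq_top_of_stable hM e' he' ρ hρ (S := Set.univ)
    (by rw [Set.image_univ]; exact AVAlg.adjoin_ofWeyl_ofLPlus_eq_top)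
  -- The action of `𝓛₊` factors through `𝔤𝔩ₙ`.
  obtain ⟨σ, hσ⟩ := exists_rep_gl ρ fun N hN => hstable N fun l _ => hN l
  obtain ⟨i₁, i₂, hσ'⟩ := exists_lieModule_toEnd_eq σ
  refine ⟨P, inferInstance, inferInstance, inferInstance, inferInstance,
    Fin (Module.finrank k (ι →₀ k)) → k, inferInstance, inferInstance, i₁, i₂, hP,
    isHolonomic_of_orbit_le hp hC, inferInstance, LieModule.IsIrreducible.mk fun N hN => ?_,
    e', fun a x => ?_⟩
  · have h1 := hstable N.toSubmodule fun l _ q hq => by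
      have h2 : ρ l q = ⁅glProj k n l, q⁆ := by
        rw [← hσ, ← hσ']
        rfl
      rw [h2]
      exact N.lie_mem hq
    exact (LieSubmodule.toSubmodule_eq_top _).1
      (h1.resolve_left fun h => hN ((LieSubmodule.toSubmodule_eq_bot _).1 h))
  · rw [hσ', hσ]
    exact map_smul_eq_tensorRep hM e' he' ρ hρ a x
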